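/- Let $K$ be a complete discrete valuation field of characteristic $0$ with normalized valuation $v_K$, let $q\in K$ with $0<v_K(q)<\infty$, let $\mathbb K$ be an algebraic closure of $K$, and let $v:\mathbb K\to\mathbb Q\cup\{\infty\}$ be the unique valuation extending $v_K/v_K(q)$, so that $v(q)=1$. Put $\epsilon=\prod_{n\ge1}(1+q^n)\in K$ and $\bar\epsilon=\prod_{n\ge1}(1+(-q)^n)\in K$. For $r,s\in\mathbb K$ with $\epsilon r\ne\bar\epsilon s$ put $$\begin{aligned} d_{12}&=2\epsilon\bar\epsilon(\epsilon^4-\bar\epsilon^4)(\bar\epsilon s-\epsilon r),\qquad d_{34}=(\epsilon^4-\bar\epsilon^4)(\bar\epsilon^2s^2-\epsilon^2r^2),\\ d_5&=8\epsilon\bar\epsilon(\epsilon r-\bar\epsilon s)(\bar\epsilon^3r-\epsilon^3s),\\ d_{67}&=2(\epsilon r-\bar\epsilon s)\{(\bar\epsilon^4-\epsilon^4)rs+2\epsilon\bar\epsilon(\bar\epsilon^2r^2-\epsilon^2s^2)\},\\ d_8&=2(\epsilon^2s^2-\bar\epsilon^2r^2)(\bar\epsilon^2s^2-\epsilon^2r^2),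 \end{aligned}$$ let $u_{12},u_{34},u_5,u_{67},u_8\in\mathbb Q\cup\{\infty\}$ be the values of $v$ at $d_{12},d_{34},d_5,d_{67},d_8$, and let $C_{r,s}\subset\mathbb R^2$ be the set of points at which the function $$(X,Y)\mapsto\min\{u_{12}+X,\,u_{12}+Y,\,u_{34}+2X,\,u_{34}+2Y,\,u_5+X+Y,\,u_{67}+2X+Y,\,u_{67}+2Y+X,\,u_8+2X+2Y\}$$ is not differentiable; this is the tropicalization of the curve $d_{12}(x+y)+d_{34}(x^2+y^2)+d_5xy+d_{67}(x^2y+y^2x)+d_8x^2y^2=0$. Put $\delta=\delta_{r,s}=v(r+s)-v(r-s)\in\mathbb Q\cup\{\pm\infty\}$ (the two valuations are not both infinite). Let $\Theta^{\rm odd}(u)=-2(2\lfloor\frac u2\rfloor+1-u)^2$, $\Theta^{\rm even}(u)=-2(2\lfloor\frac{u+1}2\rfloor-u)^2$, $$Y(u)=\max\bigl(\Theta^{\rm odd}(u),-1+\Theta^{\rm even}(u)\bigr)-\max\bigl(-v(r-s)+\Theta^{\rm even}(u),-v(r+s)+\Theta^{\rm odd}(u)\bigr),\qquad X(u)=Y(u-\tfrac12),$$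 and let $\Lambda_{r,s}=\{(-X(u),-Y(u)):u\in\mathbb R\}$. An $n$-gonal cycle of $C_{r,s}$ is a simple closed polygon contained in $C_{r,s}$ with exactly $n$ (genuine) corners. Lengths are lattice lengths: the segment from $P$ to $Q$ has length $\ell\ge0$ if $Q-P$ is $\ell$ times a primitive integer vector, and the length of a polygon is the sum of the lengths of its sides. Then: (i) $C_{r,s}$ has a pentagonal cycle of length $8$ if and only if $2\le\delta$. (ii) $C_{r,s}$ has a heptagonal cycle of length $8$ if and only if $1<\delta<2$. (iii) $C_{r,s}$ has a square cycle of length $4(\delta+1)$ if and only if $-1<\delta\le1$. In particular, it has a square cycle of length $8$ if and only if $\delta=1$. (iv) If $\delta\le-1$, then $\Lambda_{r,s}$ is a connected union of two segments, each of length $\min(1,-\delta-1)$, having exactly one point, an end point of both, in common (if $\delta=-1$, both segments are that point). (v) Up to translation the shape depends only on $\delta$: if $(r,s)$ and $(r',s')$ are two such pairs with $\delta_{r,s}=\delta_{r',s'}$, then there is $w\in\mathbb R^2$ such that $\Lambda_{r',s'}=w+\Lambda_{r,s}$ and the polygonal cycles of $C_{r',s'}$ are exactly the translates by $w$ of the polygonal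 cycles of $C_{r,s}$. -/

import Mathlib

namespace TropEdwards

/-! ### The base field and its valuation -/

/-- The value group of the norm of `K` is infinite cyclic: it is generated by the norm of a
uniformizer.  Thus `‖x‖ = c ^ (-v_K x)` for a surjective discrete valuation
`v_K : K → ℤ ∪ {∞}` and a real number `c > 1`. -/
def IsDiscretelyValued (K : Type*) [NormedField K] : Prop :=
  ∃ ϖ : K, ϖ ≠ 0 ∧ ‖ϖ‖ < 1 ∧ ∀ x : K, x ≠ 0 → ∃ n : ℤ, ‖x‖ = ‖ϖ‖ ^ n

open Classical in
/-- The additive valuation of an algebraic extension `L` of `K` that is normalized by `v q = 1`: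
`spectralNorm K L` is the unique extension to `L` of the absolute value of `K`. -/
noncomputable def val {K : Type*} [NormedField K] (L : Type*) [Field L] [Algebra K L]
    (q : K) (x : L) : EReal :=
  if x = 0 then ⊤ else ((Real.log (spectralNorm K L x) / Real.log ‖q‖ : ℝ) : EReal)

theorem val_zero {K : Type*} [NormedField K] (L : Type*) [Field L] [Algebra K L] (q : K) :
    val L q (0 : L) = ⊤ := by
  simp [val]

/-- On `K` itself the valuation is `v_K / v_K(q)`. -/
theorem val_algebraMap {K : Type*} [NormedField K] (L : Type*) [Field L] [Algebra K L]
    (q x : K) (hx : x ≠ 0) :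
    val L q (algebraMap K L x) = ((Real.log ‖x‖ / Real.log ‖q‖ : ℝ) : EReal) := by
  have h : algebraMap K L x ≠ 0 := by simpa using hx
  rw [val, if_neg h, spectralNorm_extends]

theorem val_q {K : Type*} [NormedField K] (L : Type*) [Field L] [Algebra K L]
    (q : K) (h0 : q ≠ 0) (h1 : ‖q‖ < 1) : val L q (algebraMap K L q) = 1 := by
  rw [val_algebraMap L q q h0, div_self]
  · rfl
  · exact (Real.log_neg (norm_pos_iff.mpr h0) h1).ne

/-- The Euler product `∏_{n ≥ 1} (1 + q ^ n)`. -/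
noncomputable def eps {K : Type*} [NormedField K] (q : K) : K :=
  ∏' n : ℕ, (1 + q ^ (n + 1))

/-- The product defining `eps` converges. -/
theorem multipliable_eps {K : Type*} [NormedField K] [CompleteSpace K] (q : K) (h1 : ‖q‖ < 1) :
    Multipliable fun n : ℕ => 1 + q ^ (n + 1) := by
  refine multipliable_one_add_of_summable ?_
  simp only [norm_pow]
  exact (summable_nat_add_iff 1).2 (summable_geometric_of_lt_one (norm_nonneg q) h1)

/-! ### The coefficients of the polynomial

The polynomial is
`d12 (x + y) + d34 (x² + y²) + d5 x y + d67 (x² y + y² x) + d8 x² y²`;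
below `e` stands for `ε(q)` and `f` for `ε(-q)`. -/

def d12 {L : Type*} [Field L] (e f r s : L) : L :=
  2 * e * f * (e ^ 4 - f ^ 4) * (f * s - e * r)

def d34 {L : Type*} [Field L] (e f r s : L) : L :=
  (e ^ 4 - f ^ 4) * (f ^ 2 * s ^ 2 - e ^ 2 * r ^ 2)

def d5 {L : Type*} [Field L] (e f r s : L) : L :=
  8 * e * f * (e * r - f * s) * (f ^ 3 * r - e ^ 3 * s)

def d67 {L : Type*} [Field L] (e f r s : L) : L :=
  2 * (e * r - f * s) *
    ((f ^ 4 - e ^ 4) * (r * s) + 2 * e * f * (f ^ 2 * r ^ 2 - e ^ 2 * s ^ 2))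

def d8 {L : Type*} [Field L] (e f r s : L) : L :=
  2 * (e ^ 2 * s ^ 2 - f ^ 2 * r ^ 2) * (f ^ 2 * s ^ 2 - e ^ 2 * r ^ 2)

/-! ### Tropical curve -/

/-- The tropical polynomial with coefficient valuations `u12, u34, u5, u67, u8`
(a monomial with coefficient `∞` does not contribute to the minimum). -/
noncomputable def tropPoly (u12 u34 u5 u67 u8 : EReal) (P : ℝ × ℝ) : ℝ :=
  ((u12 + (P.1 : EReal)) ⊓ (u12 + (P.2 : EReal)) ⊓
    (u34 + ((2 * P.1 : ℝ) : EReal)) ⊓ (u34 + ((2 * P.2 : ℝ) : EReal)) ⊓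
    (u5 + ((P.1 + P.2 : ℝ) : EReal)) ⊓
    (u67 + ((2 * P.1 + P.2 : ℝ) : EReal)) ⊓ (u67 + ((2 * P.2 + P.1 : ℝ) : EReal)) ⊓
    (u8 + ((2 * P.1 + 2 * P.2 : ℝ) : EReal))).toReal

/-- The tropicalization `trop(f_{r,s})`. -/
noncomputable def trop {K : Type*} [NormedField K] {L : Type*} [Field L] [Algebra K L]
    (q : K) (r s : L) : ℝ × ℝ → ℝ :=
  let e := algebraMap K L (eps q)
  let f := algebraMap K L (eps (-q))
  tropPoly (val L q (d12 e f r s)) (val L q (d34 e f r s)) (val L q (d5 e f r s))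
    (val L q (d67 e f r s)) (val L q (d8 e f r s))

/-- The tropical curve `C(trop(f_{r,s}))`: the set of points of the plane at which
`trop(f_{r,s})` is not differentiable. -/
def tropCurve {K : Type*} [NormedField K] {L : Type*} [Field L] [Algebra K L]
    (q : K) (r s : L) : Set (ℝ × ℝ) :=
  {P | ¬ DifferentiableAt ℝ (trop q r s) P}

/-- The parameter `δ = v(r + s) - v(r - s)`. -/
noncomputable def delta {K : Type*} [NormedField K] {L : Type*} [Field L] [Algebra K L]
    (q : K) (r s : L) : EReal :=
  val L q (r + s) - val L q (r - s)

/-! ### Ultradiscrete theta functions -/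

noncomputable def thetaOdd (u : ℝ) : ℝ := -2 * (2 * (⌊u / 2⌋ : ℝ) + 1 - u) ^ 2

noncomputable def thetaEven (u : ℝ) : ℝ := -2 * (2 * (⌊(u + 1) / 2⌋ : ℝ) - u) ^ 2

noncomputable def coordY {K : Type*} [NormedField K] {L : Type*} [Field L] [Algebra K L]
    (q : K) (r s : L) (u : ℝ) : ℝ :=
  max (thetaOdd u) (-1 + thetaEven u) -
    (max (-val L q (r - s) + (thetaEven u : EReal))
      (-val L q (r + s) + (thetaOdd u : EReal))).toReal

noncomputable def coordX {K : Type*} [NormedField K] {L : Type*} [Field L] [Algebra K L]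
    (q : K) (r s : L) (u : ℝ) : ℝ :=
  coordY q r s (u - 1 / 2)

/-- The locus of the points `(-X(u), -Y(u))`, `u ∈ ℝ`. -/
def locus {K : Type*} [NormedField K] {L : Type*} [Field L] [Algebra K L]
    (q : K) (r s : L) : Set (ℝ × ℝ) :=
  Set.range fun u : ℝ => (-coordX q r s u, -coordY q r s u)

/-! ### Polygonal cycles and lattice length -/

/-- The segment from `P` to `Q` has lattice length `l`: `Q - P` is `l` times a primitive integer
vector. -/
def HasLatticeLength (P Q : ℝ × ℝ) (l : ℝ) : Prop :=
  0 ≤ l ∧ ∃ a b : ℤ, IsCoprime a b ∧ Q - P = (l * a, l * b)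

/-- The points `p 0, …, p (n - 1)` are, in cyclic order, the vertices of a simple closed `n`-gon:
there is a genuine corner at each vertex, consecutive sides meet in their common vertex only, and
other pairs of sides are disjoint. -/
def IsSimplePolygon {n : ℕ} [NeZero n] (p : Fin n → ℝ × ℝ) : Prop :=
  3 ≤ n ∧
  (∀ i, ¬ Collinear ℝ {p i, p (i + 1), p (i + 1 + 1)}) ∧
  (∀ i, segment ℝ (p i) (p (i + 1)) ∩ segment ℝ (p (i + 1)) (p (i + 1 + 1)) = {p (i + 1)}) ∧
  (∀ i j, j ≠ i → j ≠ i + 1 → i ≠ j + 1 →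
    Disjoint (segment ℝ (p i) (p (i + 1))) (segment ℝ (p j) (p (j + 1))))

/-- `p` lists the vertices of an `n`-gonal cycle contained in `C`. -/
def IsPolygonalCycle (C : Set (ℝ × ℝ)) {n : ℕ} [NeZero n] (p : Fin n → ℝ × ℝ) : Prop :=
  IsSimplePolygon p ∧ ∀ i, segment ℝ (p i) (p (i + 1)) ⊆ C

/-- The closed polygon with vertices `p` has total lattice length `l`. -/
def HasPerimeter {n : ℕ} [NeZero n] (p : Fin n → ℝ × ℝ) (l : ℝ) : Prop :=
  ∃ m : Fin n → ℝ, (∀ i, HasLatticeLength (p i) (p (i + 1)) (m i)) ∧ ∑ i, m i = l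

/-- `C` has an `n`-gonal cycle of lattice length `l`. -/
def HasPolygonalCycle (C : Set (ℝ × ℝ)) (n : ℕ) [NeZero n] (l : ℝ) : Prop :=
  ∃ p : Fin n → ℝ × ℝ, IsPolygonalCycle C p ∧ HasPerimeter p l

/-- The quadrilateral with vertices `p` is a square: a parallelogram whose sides at `p 1` are
orthogonal and of the same Euclidean length. -/
def IsSquareShape (p : Fin 4 → ℝ × ℝ) : Prop :=
  p 1 - p 0 = p 2 - p 3 ∧
  (p 1 - p 0).1 * (p 2 - p 1).1 + (p 1 - p 0).2 * (p 2 - p 1).2 = 0 ∧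
  (p 1 - p 0).1 ^ 2 + (p 1 - p 0).2 ^ 2 = (p 2 - p 1).1 ^ 2 + (p 2 - p 1).2 ^ 2

/-- `C` has a square cycle of lattice length `l`. -/
def HasSquareCycle (C : Set (ℝ × ℝ)) (l : ℝ) : Prop :=
  ∃ p : Fin 4 → ℝ × ℝ, IsPolygonalCycle C p ∧ IsSquareShape p ∧ HasPerimeter p l

/-- `S` is a connected union of two segments of lattice length `l` that have exactly one point,
an end point of both, in common. -/
def IsUnionOfTwoSegments (S : Set (ℝ × ℝ)) (l : ℝ) : Prop :=
  IsConnected S ∧ ∃ P Q R : ℝ × ℝ,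
    S = segment ℝ P Q ∪ segment ℝ P R ∧ segment ℝ P Q ∩ segment ℝ P R = {P} ∧
    HasLatticeLength P Q l ∧ HasLatticeLength P R l

end TropEdwards

namespace TropEdwards

/-! ### Simple polygons -/

/-! Write ε = x + y and ε̄ = x - y, where x and y are the even and odd parts of the Euler product in
q. Then v(x) = 0 and v(y) = 1, also in residue characteristic 2 (`exists_eps_eq`). In terms of x, y,
r + s and r - s the coefficients split into factors whose valuations can be read off (`val_d12`,
`val_d34`, `val_d5`, `val_d67`, `val_d8`).

Let δ > -1 and D = min(δ, 2). The common factor x(r - s) + y(r + s) has valuation v(r - s). After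
translation by (c, c) with c = v(2) - v(r - s), the region where the monomial xy is minimal becomes
the polygon X, Y ≤ 1, X, Y ≥ -D, |X - Y| ≤ 1 + min(D, 1), X + Y ≥ -2 min(D, 1). Cancellation can
make some coefficients larger than expected when D = 1 or D = 2, but the inequalities concerned are
then redundant (`mem_boundaryPolygon_iff`). The polygon is a square for D ≤ 1, a heptagon for 1 < D
< 2 and a pentagon for D = 2.

Every polygonal cycle of the curve runs along the boundary of this region. The exponent (1, 1) is
the only interior lattice point of the Newton polygon, so the region of any other monomial contains
a ray together with each of its points. If a side separated two such regions, two rays through them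
would form a wedge meeting the cycle in a single transverse crossing, which is impossible for a
closed polygon (`IsSimplePolygon.false_of_wedge`); this replaces the Jordan curve theorem. Hence
each side lies in the closure of the region of xy (`IsPolygonalCycle.segment_subset_closure`). A
cycle in the boundary of a convex k-gon uses every edge exactly once
(`IsCyclicArrangement.exists_edges`), which fixes the number of corners and, for the square, the
length.

For δ ≤ -1 one has u34 ≤ u5, so the region of xy is empty and there are no cycles. The difference of
the two theta functions is linear in the distance from u to the nearest even integer. Hence Y is a
constant plus a periodic trapezoid (`max_theta_sub`), X is its shift by 1/2, and their supports are
disjoint, so the locus is a pair of axis-parallel segments. Finally, equal values of δ mean that v(r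
+ s) and v(r - s) change by a common constant, which translates both the locus and the cycles. -/

theorem fin_eq_nsmul_one {n : ℕ} [NeZero n] (x : Fin n) : x = (x : ℕ) • (1 : Fin n) := by
  have h : ∀ k : ℕ, ((k • (1 : Fin n) : Fin n) : ℕ) = k % n := by
    intro k
    induction k with
    | zero => simp
    | succ k ih => rw [succ_nsmul, Fin.val_add, ih]; simp [Nat.add_mod]
  ext
  rw [h, Nat.mod_eq_of_lt x.2]

/-- A property that passes from each index to the next one holds for all of them. -/
theorem fin_cyclic_induction {n : ℕ} [NeZero n] {S : Fin n → Prop} {i : Fin n} (hi : S i)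
    (h : ∀ j, S j → S (j + 1)) (j : Fin n) : S j := by
  have h' : ∀ k : ℕ, S (i + k • (1 : Fin n)) := by
    intro k
    induction k with
    | zero => simpa using hi
    | succ k ih => rw [succ_nsmul, ← add_assoc]; exact h _ ih
  have := h' (j - i : Fin n)
  rwa [← fin_eq_nsmul_one, add_sub_cancel] at this

namespace IsSimplePolygon

variable {n : ℕ} [NeZero n] {p : Fin n → ℝ × ℝ}

theorem ne_succ (hp : IsSimplePolygon p) (i : Fin n) : p i ≠ p (i + 1) := by
  intro h
  apply hp.2.1 i
  rw [h, Set.insert_eq_of_mem (by simp)]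
  exact collinear_pair _ _ _

theorem injective (hp : IsSimplePolygon p) : Function.Injective p := by
  intro i j h
  by_contra hne
  by_cases h1 : j = i + 1
  · subst h1; exact hp.ne_succ _ h
  by_cases h2 : i = j + 1
  · subst h2; exact hp.ne_succ _ h.symm
  have := hp.2.2.2 i j (Ne.symm hne) h1 h2
  exact Set.disjoint_left.1 this (left_mem_segment ℝ _ _) (h ▸ left_mem_segment ℝ _ _)

/-- An interior point of a side lies on no other side. -/
theorem notMem_segment (hp : IsSimplePolygon p) {i j : Fin n} (hij : j ≠ i) {x : ℝ × ℝ}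
    (hx : x ∈ segment ℝ (p i) (p (i + 1))) (h1 : x ≠ p i) (h2 : x ≠ p (i + 1)) :
    x ∉ segment ℝ (p j) (p (j + 1)) := by
  intro hj
  by_cases h3 : j = i + 1
  · subst h3
    have : x ∈ ({p (i + 1)} : Set (ℝ × ℝ)) := hp.2.2.1 i ▸ ⟨hx, hj⟩
    exact h2 this
  by_cases h4 : i = j + 1
  · subst h4
    have : x ∈ ({p (j + 1)} : Set (ℝ × ℝ)) := hp.2.2.1 j ▸ ⟨hj, hx⟩
    exact h1 this
  exact Set.disjoint_left.1 (hp.2.2.2 i j hij h3 h4) hx hj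

/-- A simple polygon cannot be cut at a single point of a side. -/
theorem false_of_separation (hp : IsSimplePolygon p) {U V : Set (ℝ × ℝ)} (hU : IsOpen U)
    (hV : IsOpen V) (hUV : Disjoint U V) (i : Fin n) {t : ℝ} (ht0 : 0 < t) (ht1 : t < 1)
    (hcov : ∀ j, ∀ z ∈ segment ℝ (p j) (p (j + 1)),
      z ≠ AffineMap.lineMap (p i) (p (i + 1)) t → z ∈ U ∪ V)
    (hplus : ∀ ε > 0, ∃ s, t < s ∧ s < t + ε ∧ AffineMap.lineMap (p i) (p (i + 1)) s ∈ U)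
    (hminus : ∀ ε > 0, ∃ s, s < t ∧ t - ε < s ∧ AffineMap.lineMap (p i) (p (i + 1)) s ∈ V) :
    False := by
  set γ : ℝ → ℝ × ℝ := fun s => AffineMap.lineMap (p i) (p (i + 1)) s with hγ
  have hγc : Continuous γ := AffineMap.lineMap_continuous
  have hγi : Function.Injective γ := AffineMap.lineMap_injective ℝ (hp.ne_succ i)
  have hγ0 : γ 0 = p i := AffineMap.lineMap_apply_zero _ _
  have hγ1 : γ 1 = p (i + 1) := AffineMap.lineMap_apply_one _ _
  have hmem : ∀ s, 0 ≤ s → s ≤ 1 → γ s ∈ segment ℝ (p i) (p (i + 1)) := by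
    intro s h0 h1
    rw [segment_eq_image_lineMap]
    exact ⟨s, ⟨h0, h1⟩, rfl⟩
  have hcovγ : ∀ s, 0 ≤ s → s ≤ 1 → s ≠ t → γ s ∈ U ∪ V := fun s h0 h1 h =>
    hcov i _ (hmem s h0 h1) (fun h' => h (hγi h'))
  have hfirst : p (i + 1) ∈ U := by
    have hpre : IsPreconnected (γ '' Set.Ioc t 1) := isPreconnected_Ioc.image _ hγc.continuousOn
    obtain ⟨s, hs1, hs2, hs3⟩ := hplus (1 - t) (by linarith)
    have := hpre.subset_left_of_subset_union hU hV hUV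
      (by rintro _ ⟨s, hs, rfl⟩; exact hcovγ s (by linarith [hs.1]) hs.2 hs.1.ne')
      ⟨γ s, Set.mem_image_of_mem γ (Set.mem_Ioc.2 ⟨hs1, by linarith⟩), hs3⟩
    rw [← hγ1]; exact this (Set.mem_image_of_mem γ (Set.mem_Ioc.2 ⟨ht1, le_rfl⟩))
  have hlast : p i ∉ U := by
    have hpre : IsPreconnected (γ '' Set.Ico 0 t) := isPreconnected_Ico.image _ hγc.continuousOn
    obtain ⟨s, hs1, hs2, hs3⟩ := hminus t ht0
    have := hpre.subset_right_of_subset_union hU hV hUV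
      (by rintro _ ⟨s, hs, rfl⟩; exact hcovγ s hs.1 (by linarith [hs.2]) hs.2.ne)
      ⟨γ s, Set.mem_image_of_mem γ (Set.mem_Ico.2 ⟨by linarith, hs1⟩), hs3⟩
    rw [← hγ0]
    exact Set.disjoint_right.1 hUV
      (this (Set.mem_image_of_mem γ (Set.mem_Ico.2 ⟨le_rfl, ht0⟩)))
  -- The other sides avoid the cut point, so each of them stays on one side. Going around from `p (i
  -- + 1)` carries membership in `U` back to `p i`.
  refine hlast (fin_cyclic_induction (S := fun j => p j ∈ U) hfirst (fun j hj => ?_) i)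
  have hji : j ≠ i := by rintro rfl; exact hlast hj
  have hx := hp.notMem_segment hji (hmem t ht0.le ht1.le)
    (fun h => ht0.ne' (hγi (h.trans hγ0.symm))) (fun h => ht1.ne (hγi (h.trans hγ1.symm)))
  exact (convex_segment (𝕜 := ℝ) (p j) (p (j + 1))).isPreconnected.subset_left_of_subset_union hU hV
    hUV (fun z hz => hcov j z hz (by rintro rfl; exact hx hz)) ⟨_, left_mem_segment ℝ _ _, hj⟩
    (right_mem_segment ℝ _ _)

end IsSimplePolygon

/-- The determinant of two plane vectors. -/
def det2 (v w : ℝ × ℝ) : ℝ := v.1 * w.2 - v.2 * w.1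

theorem exists_smul_of_det2_eq_zero {v w : ℝ × ℝ} (hv : v ≠ 0) (h : det2 v w = 0) :
    ∃ c : ℝ, w = c • v := by
  unfold det2 at h
  by_cases h1 : v.1 = 0
  · have h2 : v.2 ≠ 0 := fun h2 => hv (Prod.ext h1 h2)
    refine ⟨w.2 / v.2, Prod.ext ?_ ?_⟩
    · simp only [Prod.smul_fst, smul_eq_mul, h1, mul_zero]
      rw [h1] at h
      have : v.2 * w.1 = 0 := by linarith
      exact (mul_eq_zero.1 this).resolve_left h2
    · simp [h2]
  · refine ⟨w.1 / v.1, Prod.ext ?_ ?_⟩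
    · simp [h1]
    · simp only [Prod.smul_snd, smul_eq_mul]
      field_simp
      linarith

/-- A simple polygon does not meet a pair of rays with common origin in exactly one point that is
an interior point of a side, transverse to the ray. -/
theorem IsSimplePolygon.false_of_wedge {n : ℕ} [NeZero n] {p : Fin n → ℝ × ℝ}
    (hp : IsSimplePolygon p) (i : Fin n) {t : ℝ} (ht0 : 0 < t) (ht1 : t < 1)
    {y w w' : ℝ × ℝ} {s : ℝ} (hs : 0 < s) (hw' : w' ≠ 0)
    (hx : AffineMap.lineMap (p i) (p (i + 1)) t = y + s • w)
    (htrans : det2 w (p (i + 1) - p i) ≠ 0)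
    (hopp : det2 w w' = 0 → ∃ c : ℝ, c < 0 ∧ w' = c • w)
    (h1 : ∀ j, ∀ r : ℝ, 0 ≤ r → y + r • w ∈ segment ℝ (p j) (p (j + 1)) → r = s)
    (h2 : ∀ j, ∀ r : ℝ, 0 ≤ r → y + r • w' ∉ segment ℝ (p j) (p (j + 1))) : False := by
  have hw : w ≠ 0 := by
    rintro rfl
    simp [det2] at htrans
  set v := p (i + 1) - p i with hv
  have hline : ∀ r : ℝ, AffineMap.lineMap (p i) (p (i + 1)) r = y + s • w + (r - t) • v := by
    intro r
    rw [← hx, AffineMap.lineMap_apply_module', AffineMap.lineMap_apply_module']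
    module
  -- The sign σ orients the wedge, making `U` the open cone of angle at most π between the two rays
  -- and `V` the rest of their complement.
  obtain ⟨σ, hσ0, hσ⟩ : ∃ σ : ℝ, σ ≠ 0 ∧ 0 ≤ σ * det2 w w' := by
    rcases le_total 0 (det2 w w') with h | h
    · exact ⟨1, one_ne_zero, by linarith⟩
    · exact ⟨-1, by norm_num, by linarith⟩
  set U : Set (ℝ × ℝ) := {z | 0 < σ * det2 w (z - y)} ∩ {z | 0 < σ * det2 (z - y) w'} with hU
  set V : Set (ℝ × ℝ) := {z | σ * det2 w (z - y) < 0} ∪ {z | σ * det2 (z - y) w' < 0} with hV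
  have c1 : Continuous fun z : ℝ × ℝ => σ * det2 w (z - y) := by unfold det2; fun_prop
  have c2 : Continuous fun z : ℝ × ℝ => σ * det2 (z - y) w' := by unfold det2; fun_prop
  have hUo : IsOpen U := (isOpen_lt continuous_const c1).inter (isOpen_lt continuous_const c2)
  have hVo : IsOpen V := (isOpen_lt c1 continuous_const).union (isOpen_lt c2 continuous_const)
  have hdisj : Disjoint U V := by
    rw [Set.disjoint_left]
    rintro z ⟨ha, hb⟩ hc
    rw [Set.mem_ofPred_eq] at ha hb
    rcases hc with hc | hc <;> rw [Set.mem_ofPred_eq] at hc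
    · exact lt_asymm ha hc
    · exact lt_asymm hb hc
  have hcov : ∀ j, ∀ z ∈ segment ℝ (p j) (p (j + 1)),
      z ≠ AffineMap.lineMap (p i) (p (i + 1)) t → z ∈ U ∪ V := by
    intro j z hz hne
    by_contra hcon
    rw [Set.mem_union, not_or] at hcon
    obtain ⟨hnU, hnV⟩ := hcon
    simp only [hV, Set.mem_union, Set.mem_ofPred_eq, not_or, not_lt] at hnV
    have noray1 : ∀ r : ℝ, 0 ≤ r → z - y ≠ r • w := by
      intro r hr h
      have hz' : z = y + r • w := by rw [← h]; abel
      have := h1 j r hr (hz' ▸ hz)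
      exact hne (by rw [hz', hx, this])
    have noray2 : ∀ r : ℝ, 0 ≤ r → z - y ≠ r • w' := by
      intro r hr h
      have hz' : z = y + r • w' := by rw [← h]; abel
      exact h2 j r hr (hz' ▸ hz)
    have hor : σ * det2 w (z - y) = 0 ∨ σ * det2 (z - y) w' = 0 := by
      by_contra hcon
      push Not at hcon
      exact hnU ⟨lt_of_le_of_ne hnV.1 hcon.1.symm, lt_of_le_of_ne hnV.2 hcon.2.symm⟩
    rcases hor with h | h
    · obtain ⟨c, hc⟩ := exists_smul_of_det2_eq_zero hw ((mul_eq_zero.1 h).resolve_left hσ0)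
      rcases le_or_gt 0 c with h0 | h0
      · exact noray1 c h0 hc
      · have e1 : σ * det2 (z - y) w' = c * (σ * det2 w w') := by
          rw [hc]; simp only [det2, Prod.smul_fst, Prod.smul_snd, smul_eq_mul]; ring
        have e2 : σ * det2 w w' = 0 := by
          have := hnV.2
          rw [e1] at this
          nlinarith
        obtain ⟨c', hc', e3⟩ := hopp ((mul_eq_zero.1 e2).resolve_left hσ0)
        refine noray2 (c / c') (div_nonneg_of_nonpos h0.le hc'.le) ?_
        rw [hc, e3, smul_smul, div_mul_cancel₀ _ hc'.ne]
    · have h' : det2 w' (z - y) = 0 := by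
        have := (mul_eq_zero.1 h).resolve_left hσ0
        simp only [det2] at this ⊢; linarith
      obtain ⟨c, hc⟩ := exists_smul_of_det2_eq_zero hw' h'
      rcases le_or_gt 0 c with h0 | h0
      · exact noray2 c h0 hc
      · have e1 : σ * det2 w (z - y) = c * (σ * det2 w w') := by
          rw [hc]; simp only [det2, Prod.smul_fst, Prod.smul_snd, smul_eq_mul]; ring
        have e2 : σ * det2 w w' = 0 := by
          have := hnV.1
          rw [e1] at this
          nlinarith
        obtain ⟨c', hc', e3⟩ := hopp ((mul_eq_zero.1 e2).resolve_left hσ0)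
        refine noray1 (c * c') (mul_nonneg_of_nonpos_of_nonpos h0.le hc'.le) ?_
        rw [hc, e3, smul_smul]
  have hside : ∃ ρ > 0, ∀ r : ℝ, |r| < ρ →
      (0 < r * (σ * det2 w v) → y + s • w + r • v ∈ U) ∧
      (r * (σ * det2 w v) < 0 → y + s • w + r • v ∈ V) := by
    have f1 : ∀ r : ℝ, σ * det2 w (y + s • w + r • v - y) = r * (σ * det2 w v) := by
      intro r
      simp only [det2, Prod.smul_fst, Prod.smul_snd, smul_eq_mul, Prod.fst_add, Prod.snd_add,
        Prod.fst_sub, Prod.snd_sub]; ring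
    have f2 : ∀ r : ℝ, σ * det2 (y + s • w + r • v - y) w' =
        s * (σ * det2 w w') + r * (σ * det2 v w') := by
      intro r
      simp only [det2, Prod.smul_fst, Prod.smul_snd, smul_eq_mul, Prod.fst_add, Prod.snd_add,
        Prod.fst_sub, Prod.snd_sub]; ring
    rcases hσ.eq_or_lt with h | h
    · refine ⟨1, one_pos, fun r _ => ⟨fun hr => ⟨?_, ?_⟩, fun hr => Or.inl ?_⟩⟩
      · rw [Set.mem_ofPred_eq, f1]; exact hr
      · rw [Set.mem_ofPred_eq, f2, ← h, mul_zero, zero_add]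
        obtain ⟨c, hc, e⟩ := hopp ((mul_eq_zero.1 h.symm).resolve_left hσ0)
        have : r * (σ * det2 v w') = (-c) * (r * (σ * det2 w v)) := by
          rw [e]; simp only [det2, Prod.smul_fst, Prod.smul_snd, smul_eq_mul]; ring
        rw [this]
        exact mul_pos (by linarith) hr
      · rw [Set.mem_ofPred_eq, f1]; exact hr
    · have hpos : 0 < s * (σ * det2 w w') := mul_pos hs h
      -- Within this radius the move along `v` cannot change the sign of the second determinant, so
      -- the sign of the first decides between `U` and `V`.
      refine ⟨s * (σ * det2 w w') / (|σ * det2 v w'| + 1), by positivity, fun r hr =>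
        ⟨fun hr' => ⟨?_, ?_⟩, fun hr' => Or.inl ?_⟩⟩
      · rw [Set.mem_ofPred_eq, f1]; exact hr'
      · rw [Set.mem_ofPred_eq, f2]
        rw [lt_div_iff₀ (by positivity)] at hr
        have := neg_abs_le (r * (σ * det2 v w'))
        rw [abs_mul] at this
        nlinarith [abs_nonneg r]
      · rw [Set.mem_ofPred_eq, f1]; exact hr'
  obtain ⟨ρ, hρ, hside⟩ := hside
  have hne : σ * det2 w v ≠ 0 := mul_ne_zero hσ0 htrans
  have key : ∀ ε > 0, ∃ d : ℝ, 0 < d ∧ d < ε ∧ |d| < ρ ∧ |-d| < ρ := by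
    intro ε hε
    refine ⟨min ε ρ / 2, by positivity, ?_, ?_⟩
    · have := min_le_left ε ρ; linarith
    · have h3 := min_le_right ε ρ
      have h4 : 0 < min ε ρ := lt_min hε hρ
      rw [abs_neg, and_self, abs_of_pos (by linarith)]; linarith
  rcases lt_or_gt_of_ne hne with hneg | hpos
  · refine hp.false_of_separation hVo hUo hdisj.symm i ht0 ht1
      (fun j z hz hz' => Or.symm (hcov j z hz hz')) (fun ε hε => ?_) (fun ε hε => ?_) <;>
    obtain ⟨d, d1, d2, d3, d4⟩ := key ε hε
    · refine ⟨t + d, by linarith, by linarith, ?_⟩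
      rw [hline, show t + d - t = d by ring]
      exact (hside d d3).2 (mul_neg_of_pos_of_neg d1 hneg)
    · refine ⟨t - d, by linarith, by linarith, ?_⟩
      rw [hline, show t - d - t = -d by ring]
      exact (hside (-d) d4).1 (mul_pos_of_neg_of_neg (by linarith) hneg)
  · refine hp.false_of_separation hUo hVo hdisj i ht0 ht1
      hcov (fun ε hε => ?_) (fun ε hε => ?_) <;>
    obtain ⟨d, d1, d2, d3, d4⟩ := key ε hε
    · refine ⟨t + d, by linarith, by linarith, ?_⟩
      rw [hline, show t + d - t = d by ring]
      exact (hside d d3).1 (mul_pos d1 hpos)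
    · refine ⟨t - d, by linarith, by linarith, ?_⟩
      rw [hline, show t - d - t = -d by ring]
      exact (hside (-d) d4).2 (mul_neg_of_neg_of_pos (by linarith) hpos)

end TropEdwards

namespace TropEdwards

/-! ### Tropical curves of tropical polynomials with finitely many terms -/

/-- The linear form with coefficients given by the exponent `m`. -/
def dot (m : ℤ × ℤ) (v : ℝ × ℝ) : ℝ := m.1 * v.1 + m.2 * v.2

/-- The value at `P` of the tropical monomial with coefficient `c m` and exponent `m`. -/
def monomialValue (c : ℤ × ℤ → ℝ) (m : ℤ × ℤ) (P : ℝ × ℝ) : ℝ := c m + dot m P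

/-- The monomial `m` attains the minimum at `P`. -/
def IsActive (M : Finset (ℤ × ℤ)) (c : ℤ × ℤ → ℝ) (m : ℤ × ℤ) (P : ℝ × ℝ) : Prop :=
  m ∈ M ∧ ∀ m' ∈ M, monomialValue c m P ≤ monomialValue c m' P

/-- The points at which at least two monomials attain the minimum. -/
def minCurve (M : Finset (ℤ × ℤ)) (c : ℤ × ℤ → ℝ) : Set (ℝ × ℝ) :=
  {P | ∃ m m', m ≠ m' ∧ IsActive M c m P ∧ IsActive M c m' P}

/-- The points at which `m` is the only monomial that attains the minimum. -/
def strictRegion (M : Finset (ℤ × ℤ)) (c : ℤ × ℤ → ℝ) (m : ℤ × ℤ) : Set (ℝ × ℝ) :=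
  {P | m ∈ M ∧ ∀ m' ∈ M, m' ≠ m → monomialValue c m P < monomialValue c m' P}

theorem dot_add (m : ℤ × ℤ) (v w : ℝ × ℝ) : dot m (v + w) = dot m v + dot m w := by
  simp only [dot, Prod.fst_add, Prod.snd_add]; ring

theorem dot_smul (m : ℤ × ℤ) (s : ℝ) (v : ℝ × ℝ) : dot m (s • v) = s * dot m v := by
  simp only [dot, Prod.smul_fst, Prod.smul_snd, smul_eq_mul]; ring

theorem monomialValue_add_smul (c : ℤ × ℤ → ℝ) (m : ℤ × ℤ) (P v : ℝ × ℝ) (s : ℝ) :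
    monomialValue c m (P + s • v) = monomialValue c m P + s * dot m v := by
  rw [monomialValue, dot_add, dot_smul, monomialValue]; ring

theorem continuous_monomialValue (c : ℤ × ℤ → ℝ) (m : ℤ × ℤ) : Continuous (monomialValue c m) := by
  unfold monomialValue dot; fun_prop

variable {M : Finset (ℤ × ℤ)} {c : ℤ × ℤ → ℝ}

theorem mem_strictRegion {P : ℝ × ℝ} {m : ℤ × ℤ} : P ∈ strictRegion M c m ↔
    m ∈ M ∧ ∀ m' ∈ M, m' ≠ m → monomialValue c m P < monomialValue c m' P := Iff.rfl

theorem notMem_minCurve_of_mem_strictRegion {P : ℝ × ℝ} {m : ℤ × ℤ}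
    (h : P ∈ strictRegion M c m) : P ∉ minCurve M c := by
  rintro ⟨m₁, m₂, hne, h₁, h₂⟩
  rw [mem_strictRegion] at h
  have e₁ : m₁ = m := by
    by_contra hm
    exact (h.2 m₁ h₁.1 hm).not_ge (h₁.2 m h.1)
  have e₂ : m₂ = m := by
    by_contra hm
    exact (h.2 m₂ h₂.1 hm).not_ge (h₂.2 m h.1)
  exact hne (e₁.trans e₂.symm)

theorem eq_of_mem_strictRegion {P : ℝ × ℝ} {m m' : ℤ × ℤ}
    (h : P ∈ strictRegion M c m) (h' : P ∈ strictRegion M c m') : m = m' := by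
  by_contra hne
  rw [mem_strictRegion] at h h'
  exact lt_asymm (h.2 m' h'.1 (Ne.symm hne)) (h'.2 m h.1 hne)

/-- If `m` attains the minimum at `x`, and wins against the other such monomials in the direction
`d`, then `m` is the only one to attain the minimum shortly after `x` in this direction. -/
theorem IsActive.exists_strict {x d : ℝ × ℝ} {m : ℤ × ℤ} (hm : IsActive M c m x)
    (hd : ∀ m', IsActive M c m' x → m' ≠ m → dot m d < dot m' d) :
    ∃ ε > 0, ∀ s : ℝ, 0 < s → s < ε → x + s • d ∈ strictRegion M c m := by
  have h : ∀ m' ∈ M, ∀ᶠ s : ℝ in nhdsWithin 0 (Set.Ioi 0), m' ≠ m →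
      monomialValue c m (x + s • d) < monomialValue c m' (x + s • d) := by
    intro m' hm'
    by_cases hne : m' = m
    · simp [hne]
    rcases (hm.2 m' hm').eq_or_lt with h | h
    · filter_upwards [self_mem_nhdsWithin] with s hs _
      rw [monomialValue_add_smul, monomialValue_add_smul, h]
      have := hd m' ⟨hm', fun m'' h'' => h ▸ hm.2 m'' h''⟩ hne
      have := mul_lt_mul_of_pos_left this (Set.mem_Ioi.1 hs)
      linarith
    · have hc : ∀ m, Continuous fun s : ℝ => monomialValue c m (x + s • d) := fun m =>
        (continuous_monomialValue c m).comp (by fun_prop)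
      have := (isOpen_lt (hc m) (hc m')).mem_nhds (x := (0 : ℝ)) (by
        rw [Set.mem_ofPred_eq]; simpa using h)
      filter_upwards [mem_nhdsWithin_of_mem_nhds this] with s hs _ using hs
  have h' := (Filter.eventually_all_finset M).2 h
  obtain ⟨ε, hε, hs⟩ := (mem_nhdsGT_iff_exists_Ioo_subset).1 h'
  exact ⟨ε, hε, fun s h0 h1 => ⟨hm.1, fun m' hm' => hs ⟨h0, h1⟩ m' hm'⟩⟩

/-- Moving in a direction of recession of `m` preserves strict minimality. -/
theorem add_smul_mem_strictRegion {x d : ℝ × ℝ} {m : ℤ × ℤ} (hx : x ∈ strictRegion M c m)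
    (hd : ∀ m' ∈ M, dot m d ≤ dot m' d) {s : ℝ} (hs : 0 ≤ s) : x + s • d ∈ strictRegion M c m := by
  rw [mem_strictRegion] at hx ⊢
  refine ⟨hx.1, fun m' hm' hne => ?_⟩
  rw [monomialValue_add_smul, monomialValue_add_smul]
  have := mul_le_mul_of_nonneg_left (hd m' hm') hs
  linarith [hx.2 m' hm' hne]

theorem IsActive.add_smul_mem_strictRegion {x d : ℝ × ℝ} {m : ℤ × ℤ} (hm : IsActive M c m x)
    (hd : ∀ m' ∈ M, dot m d ≤ dot m' d)
    (hd' : ∀ m', IsActive M c m' x → m' ≠ m → dot m d < dot m' d) {s : ℝ} (hs : 0 < s) :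
    x + s • d ∈ strictRegion M c m := by
  obtain ⟨ε, hε, h⟩ := hm.exists_strict hd'
  rcases lt_or_ge s ε with h1 | h1
  · exact h s hs h1
  · have h2 := TropEdwards.add_smul_mem_strictRegion (h (ε / 2) (by linarith) (by linarith)) hd
      (s := s - ε / 2) (by linarith)
    rwa [add_assoc, ← add_smul, add_sub_cancel] at h2

/-- No side of a simple polygon in the curve separates two regions that both contain a ray. -/
theorem IsPolygonalCycle.false_of_recession {n : ℕ} [NeZero n] {p : Fin n → ℝ × ℝ}
    (hp : IsPolygonalCycle (minCurve M c) p) (i : Fin n) {t : ℝ} (ht0 : 0 < t) (ht1 : t < 1)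
    {x : ℝ × ℝ} (hx : AffineMap.lineMap (p i) (p (i + 1)) t = x)
    {m₁ m₂ : ℤ × ℤ} (hne : m₁ ≠ m₂) (h₁ : IsActive M c m₁ x) (h₂ : IsActive M c m₂ x)
    {w₁ w₂ : ℝ × ℝ} (hw₂ : w₂ ≠ 0)
    (hr₁ : ∀ m' ∈ M, dot m₁ w₁ ≤ dot m' w₁) (hr₂ : ∀ m' ∈ M, dot m₂ w₂ ≤ dot m' w₂)
    (hlow : ∀ m', IsActive M c m' x → m' ≠ m₁ → dot m₁ w₁ < dot m' w₁)
    (hhigh : ∀ m', IsActive M c m' x → m' ≠ m₂ → dot m' w₁ < dot m₂ w₁)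
    (htrans : det2 w₁ (p (i + 1) - p i) ≠ 0) : False := by
  have hw₁ : w₁ ≠ 0 := by
    rintro rfl
    simp [det2] at htrans
  have hfwd : ∀ s : ℝ, 0 < s → x + s • w₁ ∈ strictRegion M c m₁ := fun s hs =>
    h₁.add_smul_mem_strictRegion hr₁ hlow hs
  obtain ⟨ε, hε, hback⟩ := h₂.exists_strict (d := -w₁) (fun m' h' hm' => by
    have := hhigh m' h' hm'
    have e : ∀ m, dot m (-w₁) = -dot m w₁ := fun m => by
      simp only [dot, Prod.fst_neg, Prod.snd_neg]; ring
    rw [e, e]; linarith)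
  set s := ε / 2 with hs
  have hs0 : 0 < s := by positivity
  -- The wedge starts just behind `x`, inside the region of `m₂`. One ray passes through `x` into
  -- the region of `m₁` and stays there; the other never leaves the region of `m₂`.
  set y := x - s • w₁ with hy
  have hy2 : y ∈ strictRegion M c m₂ := by
    have := hback s hs0 (by linarith)
    rwa [smul_neg, ← sub_eq_add_neg] at this
  have hray₂ : ∀ r : ℝ, 0 ≤ r → y + r • w₂ ∈ strictRegion M c m₂ := fun r hr =>
    TropEdwards.add_smul_mem_strictRegion hy2 hr₂ hr
  have hray₁ : ∀ r : ℝ, y + r • w₁ = x + (r - s) • w₁ := fun r => by rw [hy]; module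
  refine hp.1.false_of_wedge i ht0 ht1 (y := y) (w := w₁) (w' := w₂) (s := s) hs0 hw₂ ?_ htrans
    ?_ ?_ ?_
  · rw [hx, hy, sub_add_cancel]
  · intro hD
    obtain ⟨k, hk⟩ := exists_smul_of_det2_eq_zero hw₁ hD
    refine ⟨k, ?_, hk⟩
    by_contra hk0
    have hk1 : 0 < k := lt_of_le_of_ne (not_lt.1 hk0) (by rintro rfl; simp at hk; exact hw₂ hk)
    have e := hray₂ ((s + 1) / k) (by positivity)
    rw [hk, smul_smul, div_mul_cancel₀ _ hk1.ne', hray₁, add_sub_cancel_left] at e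
    exact hne (eq_of_mem_strictRegion (hfwd 1 one_pos) e)
  · intro j r hr hmem
    have hC := hp.2 j hmem
    by_contra hrs
    rcases lt_or_gt_of_ne hrs with h | h
    · rcases hr.eq_or_lt with h0 | h0
      · rw [← h0, zero_smul, add_zero] at hC
        exact notMem_minCurve_of_mem_strictRegion hy2 hC
      · have := hback (s - r) (by linarith) (by linarith)
        rw [smul_neg, ← neg_smul, neg_sub, ← hray₁] at this
        exact notMem_minCurve_of_mem_strictRegion this hC
    · have := hfwd (r - s) (by linarith)
      rw [← hray₁] at this
      exact notMem_minCurve_of_mem_strictRegion this hC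
  · intro j r hr hmem
    exact notMem_minCurve_of_mem_strictRegion (hray₂ r hr) (hp.2 j hmem)

end TropEdwards

/-! ### Polygonal cycles run along one region; differentiability of a tropical minimum -/

namespace TropEdwards

variable {M : Finset (ℤ × ℤ)} {c : ℤ × ℤ → ℝ}

/-- Rotation by a right angle. -/
def rot (v : ℝ × ℝ) : ℝ × ℝ := (-v.2, v.1)

theorem norm_sq_mul_dot (m : ℤ × ℤ) (v w : ℝ × ℝ) : (v.1 ^ 2 + v.2 ^ 2) * dot m w =
    (w.1 * v.1 + w.2 * v.2) * dot m v + det2 v w * dot m (rot v) := by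
  simp only [dot, det2, rot]; ring

theorem norm_sq_pos {v : ℝ × ℝ} (hv : v ≠ 0) : 0 < v.1 ^ 2 + v.2 ^ 2 := by
  by_contra h
  have h1 : v.1 ^ 2 = 0 := by nlinarith [sq_nonneg v.1, sq_nonneg v.2]
  have h2 : v.2 ^ 2 = 0 := by nlinarith [sq_nonneg v.1, sq_nonneg v.2]
  exact hv (Prod.ext (pow_eq_zero_iff two_ne_zero |>.1 h1) (pow_eq_zero_iff two_ne_zero |>.1 h2))

theorem exponent_eq {m m' : ℤ × ℤ} {v : ℝ × ℝ} (hv : v ≠ 0) (h1 : dot m v = dot m' v)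
    (h2 : dot m (rot v) = dot m' (rot v)) : m = m' := by
  have hpos := (norm_sq_pos hv).ne'
  have key : ∀ w, dot m w = dot m' w := fun w => by
    have e := norm_sq_mul_dot m v w
    rw [h1, h2, ← norm_sq_mul_dot m' v w] at e
    exact mul_left_cancel₀ hpos e
  have k1 := key (1, 0)
  have k2 := key (0, 1)
  simp only [dot, mul_one, mul_zero, add_zero, zero_add, Int.cast_inj] at k1 k2
  exact Prod.ext k1 k2

/-- If every exponent other than `m₀` has a direction of recession, and no two such directions
are simultaneously parallel to the common edge, then every polygonal cycle of the curve bounds the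
region of `m₀`. -/
theorem IsPolygonalCycle.segment_subset_closure {n : ℕ} [NeZero n] {p : Fin n → ℝ × ℝ}
    (hp : IsPolygonalCycle (minCurve M c) p) {m₀ : ℤ × ℤ} {w : ℤ × ℤ → ℝ × ℝ}
    (hw : ∀ m ∈ M, m ≠ m₀ → w m ≠ 0)
    (hr : ∀ m ∈ M, m ≠ m₀ → ∀ m' ∈ M, dot m (w m) ≤ dot m' (w m))
    (hs : ∀ m ∈ M, m ≠ m₀ → ∀ m' ∈ M, m' ≠ m₀ → m ≠ m' →
      dot m (w m) < dot m' (w m) ∨ dot m' (w m') < dot m (w m'))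
    (i : Fin n) : segment ℝ (p i) (p (i + 1)) ⊆ closure (strictRegion M c m₀) := by
  classical
  set v := p (i + 1) - p i with hv
  have hv0 : v ≠ 0 := sub_ne_zero.2 (hp.1.ne_succ i).symm
  have hpos := norm_sq_pos hv0
  set γ : ℝ → ℝ × ℝ := fun s => AffineMap.lineMap (p i) (p (i + 1)) s with hγ
  have hγc : Continuous γ := AffineMap.lineMap_continuous
  have hγv : ∀ s, γ s = p i + s • v := fun s => by
    simp only [hγ, AffineMap.lineMap_apply_module', hv]; abel
  -- `B` collects the finitely many parameters at which monomials of different slope along the side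
  -- tie. Elsewhere all active monomials have the same slope along `v`, so they are distinguished by
  -- their slope along `rot v`.
  set B : Set ℝ := ⋃ a ∈ M ×ˢ M, {t : ℝ | dot a.1 v ≠ dot a.2 v ∧
    monomialValue c a.1 (γ t) = monomialValue c a.2 (γ t)} with hB
  have hBfin : B.Finite := by
    refine Set.Finite.biUnion (Finset.finite_toSet _) fun a _ => Set.Subsingleton.finite ?_
    rintro t ⟨hne, ht⟩ t' ⟨_, ht'⟩
    rw [hγv, monomialValue_add_smul, monomialValue_add_smul] at ht ht'
    have : (t - t') * (dot a.1 v - dot a.2 v) = 0 := by linarith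
    exact sub_eq_zero.1 ((mul_eq_zero.1 this).resolve_right (sub_ne_zero.2 hne))
  have hdense : Dense Bᶜ := hBfin.countable.dense_compl ℝ
  have hgood : ∀ t ∈ Set.Ioo (0 : ℝ) 1 ∩ Bᶜ, γ t ∈ closure (strictRegion M c m₀) := by
    rintro t ⟨⟨ht0, ht1⟩, htB⟩
    set x := γ t with hx
    have hxC : x ∈ minCurve M c := hp.2 i (by
      rw [segment_eq_image_lineMap]
      exact Set.mem_image_of_mem _ (Set.mem_Icc.2 ⟨ht0.le, ht1.le⟩))
    have hval : ∀ m m', IsActive M c m x → IsActive M c m' x → dot m v = dot m' v := by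
      intro m m' h h'
      by_contra hne
      refine htB ?_
      simp only [hB, Set.mem_iUnion]
      exact ⟨(m, m'), Finset.mem_product.2 ⟨h.1, h'.1⟩, hne,
        le_antisymm (h.2 _ h'.1) (h'.2 _ h.1)⟩
    obtain ⟨ma, mb, hab, ha, hb⟩ := hxC
    set A := M.filter fun m => IsActive M c m x with hA
    have hmemA : ∀ m, m ∈ A ↔ IsActive M c m x := fun m => by
      rw [hA, Finset.mem_filter]
      exact ⟨fun h => h.2, fun h => ⟨h.1, h⟩⟩
    have hAne : A.Nonempty := ⟨ma, (hmemA _).2 ha⟩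
    -- The extreme slopes across the side belong to the monomials that are strictly minimal
    -- immediately to its left and to its right.
    obtain ⟨m₁, h₁, hmin⟩ := A.exists_min_image (fun m => dot m (rot v)) hAne
    obtain ⟨m₂, h₂, hmax⟩ := A.exists_max_image (fun m => dot m (rot v)) hAne
    rw [hmemA] at h₁ h₂
    have hlow : ∀ m, IsActive M c m x → m ≠ m₁ → dot m₁ (rot v) < dot m (rot v) :=
      fun m hm hne => lt_of_le_of_ne (hmin m ((hmemA m).2 hm))
        fun h => hne (exponent_eq hv0 (hval _ _ hm h₁) h.symm)
    have hhigh : ∀ m, IsActive M c m x → m ≠ m₂ → dot m (rot v) < dot m₂ (rot v) :=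
      fun m hm hne => lt_of_le_of_ne (hmax m ((hmemA m).2 hm))
        fun h => hne (exponent_eq hv0 (hval _ _ hm h₂) h)
    have h12 : m₁ ≠ m₂ := by
      rintro rfl
      have : ∀ m, IsActive M c m x → m = m₁ := fun m hm => by
        by_contra hne
        exact lt_asymm (hlow m hm hne) (hhigh m hm hne)
      exact hab ((this _ ha).trans (this _ hb).symm)
    have hclos : ∀ d : ℝ × ℝ, (∃ ε > 0, ∀ s : ℝ, 0 < s → s < ε → x + s • d ∈ strictRegion M c m₀) →
        x ∈ closure (strictRegion M c m₀) := by
      rintro d ⟨ε, hε, h⟩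
      have hcont : Continuous fun s : ℝ => x + s • d := by fun_prop
      have h1 : (0 : ℝ) ∈ closure (Set.Ioo 0 ε) := by
        rw [closure_Ioo hε.ne]; exact Set.mem_Icc.2 ⟨le_rfl, hε.le⟩
      have h2 := map_mem_closure hcont h1 (t := strictRegion M c m₀) (fun s hs => h s hs.1 hs.2)
      simpa using h2
    by_cases e₁ : m₁ = m₀
    · subst e₁
      exact hclos (rot v) (h₁.exists_strict hlow)
    by_cases e₂ : m₂ = m₀
    · subst e₂
      refine hclos (-rot v) (h₂.exists_strict fun m hm hne => ?_)
      have e : ∀ m u, dot m (-u) = -dot m u := fun m u => by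
        simp only [dot, Prod.fst_neg, Prod.snd_neg]; ring
      rw [e, e]
      linarith [hhigh m hm hne]
    exfalso
    have hdiff : ∀ m m', IsActive M c m x → IsActive M c m' x → ∀ u : ℝ × ℝ,
        (v.1 ^ 2 + v.2 ^ 2) * (dot m' u - dot m u) =
          det2 v u * (dot m' (rot v) - dot m (rot v)) := by
      intro m m' h h' u
      rw [mul_sub, norm_sq_mul_dot m v u, norm_sq_mul_dot m' v u, hval m m' h h']
      ring
    have hn12 := hlow m₂ h₂ h12.symm
    have hpos_of : ∀ m m', IsActive M c m x → IsActive M c m' x → ∀ u : ℝ × ℝ,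
        0 < det2 v u * (dot m' (rot v) - dot m (rot v)) → dot m u < dot m' u := by
      intro m m' h h' u hu
      rw [← hdiff m m' h h' u] at hu
      have := (mul_pos_iff_of_pos_left hpos).1 hu
      linarith
    have hsw : ∀ u, det2 u v = -det2 v u := fun u => by simp only [det2]; ring
    have case1 : 0 < det2 v (w m₁) → False := by
      intro hd
      refine hp.false_of_recession i ht0 ht1 rfl h12 h₁ h₂ (w₁ := w m₁) (w₂ := w m₂)
        (hw _ h₂.1 e₂) (hr _ h₁.1 e₁) (hr _ h₂.1 e₂) (fun m hm hne => ?_) (fun m hm hne => ?_) ?_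
      · exact hpos_of m₁ m h₁ hm _ (mul_pos hd (by linarith [hlow m hm hne]))
      · exact hpos_of m m₂ hm h₂ _ (mul_pos hd (by linarith [hhigh m hm hne]))
      · rw [hsw]; exact neg_ne_zero.2 hd.ne'
    have case2 : det2 v (w m₂) < 0 → False := by
      intro hd
      refine hp.false_of_recession i ht0 ht1 rfl h12.symm h₂ h₁ (w₁ := w m₂) (w₂ := w m₁)
        (hw _ h₁.1 e₁) (hr _ h₂.1 e₂) (hr _ h₁.1 e₁) (fun m hm hne => ?_) (fun m hm hne => ?_) ?_
      · exact hpos_of m₂ m h₂ hm _ (mul_pos_of_neg_of_neg hd (by linarith [hhigh m hm hne]))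
      · exact hpos_of m m₁ hm h₁ _ (mul_pos_of_neg_of_neg hd (by linarith [hlow m hm hne]))
      · rw [hsw]; exact neg_ne_zero.2 hd.ne
    -- The strict inequality makes the chosen recession direction transverse to the side and fixes
    -- the sign of its determinant with `v`.
    rcases hs m₁ h₁.1 e₁ m₂ h₂.1 e₂ h12 with h | h
    · refine case1 (pos_of_mul_pos_left ?_ (sub_nonneg.2 hn12.le))
      rw [← hdiff m₁ m₂ h₁ h₂]
      exact mul_pos hpos (by linarith)
    · refine case2 (by_contra fun hcon => ?_)
      have h3 := hdiff m₁ m₂ h₁ h₂ (w m₂)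
      nlinarith [mul_nonneg (not_lt.1 hcon) (sub_nonneg.2 hn12.le)]
  have hIcc : Set.Icc (0 : ℝ) 1 ⊆ closure (Set.Ioo (0 : ℝ) 1 ∩ Bᶜ) := by
    rw [← closure_Ioo zero_ne_one]
    exact closure_minimal (hdense.open_subset_closure_inter isOpen_Ioo) isClosed_closure
  rw [segment_eq_image_lineMap]
  rintro _ ⟨t, ht, rfl⟩
  have := map_mem_closure hγc (hIcc ht) (t := closure (strictRegion M c m₀)) hgood
  rwa [closure_closure] at this

theorem isActive_of_mem_closure_strictRegion {m : ℤ × ℤ} {P : ℝ × ℝ}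
    (h : P ∈ closure (strictRegion M c m)) : IsActive M c m P := by
  have hm : m ∈ M := by
    obtain ⟨Q, hQ⟩ := closure_nonempty_iff.1 ⟨P, h⟩
    exact hQ.1
  refine ⟨hm, fun m' hm' => ?_⟩
  have hc : IsClosed {Q | monomialValue c m Q ≤ monomialValue c m' Q} :=
    isClosed_le (continuous_monomialValue c m) (continuous_monomialValue c m')
  refine closure_minimal (fun Q hQ => ?_) hc h
  rw [mem_strictRegion] at hQ
  rw [Set.mem_ofPred_eq]
  by_cases hne : m' = m
  · rw [hne]
  · exact (hQ.2 m' hm' hne).le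

/-- The minimum of finitely many tropical monomials is not differentiable exactly at the points at
which two of them attain the minimum. -/
theorem not_differentiableAt_iff {F : ℝ × ℝ → ℝ} (hM : M.Nonempty)
    (hF : ∀ P z, z ≤ F P ↔ ∀ m ∈ M, z ≤ monomialValue c m P) (P : ℝ × ℝ) :
    ¬ DifferentiableAt ℝ F P ↔ P ∈ minCurve M c := by
  have hle : ∀ Q, ∀ m ∈ M, F Q ≤ monomialValue c m Q := fun Q => (hF Q _).1 le_rfl
  have hFact : ∀ Q m, IsActive M c m Q → F Q = monomialValue c m Q := fun Q m h =>
    le_antisymm (hle Q m h.1) ((hF Q _).2 h.2)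
  obtain ⟨m, hmM, hmin⟩ := M.exists_min_image (fun m => monomialValue c m P) hM
  have hm : IsActive M c m P := ⟨hmM, hmin⟩
  have hlin : ∀ m : ℤ × ℤ, HasFDerivAt (monomialValue c m)
      ((m.1 : ℝ) • ContinuousLinearMap.fst ℝ ℝ ℝ + (m.2 : ℝ) • ContinuousLinearMap.snd ℝ ℝ ℝ) P := by
    intro m
    have := ((m.1 : ℝ) • ContinuousLinearMap.fst ℝ ℝ ℝ +
      (m.2 : ℝ) • ContinuousLinearMap.snd ℝ ℝ ℝ).hasFDerivAt (x := P)
    exact this.const_add (c m)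
  constructor
  · intro hnd
    by_contra hC
    refine hnd ?_
    have hu : ∀ m', IsActive M c m' P → m' = m := fun m' h => by
      by_contra hne
      exact hC ⟨m', m, hne, h, hm⟩
    have hev : ∀ᶠ Q in nhds P, ∀ m' ∈ M, monomialValue c m Q ≤ monomialValue c m' Q := by
      refine (Filter.eventually_all_finset M).2 fun m' hm' => ?_
      by_cases hne : m' = m
      · simp [hne]
      have hlt : monomialValue c m P < monomialValue c m' P := by
        refine lt_of_le_of_ne (hm.2 m' hm') fun h => hne (hu m' ⟨hm', fun m'' h'' => ?_⟩)
        rw [← h]; exact hm.2 m'' h''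
      filter_upwards [(isOpen_lt (continuous_monomialValue c m)
        (continuous_monomialValue c m')).mem_nhds (by rw [Set.mem_ofPred_eq]; exact hlt)] with Q hQ
      exact le_of_lt hQ
    refine (hlin m).differentiableAt.congr_of_eventuallyEq ?_
    filter_upwards [hev] with Q hQ using hFact Q m ⟨hmM, hQ⟩
  · rintro ⟨m₁, m₂, hne, h₁, h₂⟩ hd
    have key : ∀ m', IsActive M c m' P → fderiv ℝ F P =
        (m'.1 : ℝ) • ContinuousLinearMap.fst ℝ ℝ ℝ + (m'.2 : ℝ) • ContinuousLinearMap.snd ℝ ℝ ℝ := by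
      intro m' h'
      -- `F` lies below each active monomial and touches it at `P`, so a derivative of `F` would
      -- have to equal the exponent of each of them.
      have hmin : IsLocalMin (fun Q => monomialValue c m' Q - F Q) P := by
        refine Filter.Eventually.of_forall fun Q => ?_
        simp only [hFact P m' h', sub_self]
        exact sub_nonneg.2 (hle Q m' h'.1)
      have := hmin.hasFDerivAt_eq_zero ((hlin m').sub hd.hasFDerivAt)
      exact (sub_eq_zero.1 this).symm
    have e := (key m₁ h₁).symm.trans (key m₂ h₂)
    have e1 := DFunLike.congr_fun e (1, 0)
    have e2 := DFunLike.congr_fun e (0, 1)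
    simp at e1 e2
    exact hne (Prod.ext e1 e2)

end TropEdwards

namespace TropEdwards

/-! ### The tropical curves under consideration -/

/-- The exponents of the tropical polynomial. -/
def exponents : Finset (ℤ × ℤ) :=
  {(1, 0), (0, 1), (2, 0), (0, 2), (1, 1), (2, 1), (1, 2), (2, 2)}

/-- The coefficient of the tropical polynomial at a given exponent. -/
noncomputable def coeffAt (u12 u34 u5 u67 u8 : EReal) (m : ℤ × ℤ) : EReal :=
  if m.1 + m.2 = 1 then u12 else if m = (1, 1) then u5 else if m.1 + m.2 = 2 then u34
  else if m.1 + m.2 = 3 then u67 else u8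

open Classical in
/-- The exponents with finite coefficient. -/
noncomputable def finiteExponents (u12 u34 u5 u67 u8 : EReal) : Finset (ℤ × ℤ) :=
  exponents.filter fun m => coeffAt u12 u34 u5 u67 u8 m ≠ ⊤

/-- The finite coefficients. -/
noncomputable def realCoeff (u12 u34 u5 u67 u8 : EReal) (m : ℤ × ℤ) : ℝ :=
  (coeffAt u12 u34 u5 u67 u8 m).toReal

/-- A direction in which the monomial `m` is minimal. -/
def recession (m : ℤ × ℤ) : ℤ × ℤ :=
  if m = (1, 0) then (1, 2) else if m = (0, 1) then (2, 1) else if m = (2, 0) then (-1, 1)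
  else if m = (0, 2) then (1, -1) else if m = (2, 1) then (-1, 0) else if m = (1, 2) then (0, -1)
  else (-1, -1)

theorem recession_ne_zero : ∀ m ∈ exponents, recession m ≠ 0 := by decide

theorem recession_le : ∀ m ∈ exponents, m ≠ (1, 1) → ∀ m' ∈ exponents,
    m.1 * (recession m).1 + m.2 * (recession m).2 ≤
      m'.1 * (recession m).1 + m'.2 * (recession m).2 := by decide

/-- For the vertices (1,0), (0,1), (2,0), (0,2), (2,2) of the Newton polygon the direction makes the
minimum strict. Only (2,1) and (1,2) have ties, and only with vertices, whose own direction then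
decides. -/
theorem recession_lt : ∀ m ∈ exponents, m ≠ (1, 1) → ∀ m' ∈ exponents, m' ≠ (1, 1) → m ≠ m' →
    m.1 * (recession m).1 + m.2 * (recession m).2 <
      m'.1 * (recession m).1 + m'.2 * (recession m).2 ∨
    m'.1 * (recession m').1 + m'.2 * (recession m').2 <
      m.1 * (recession m').1 + m.2 * (recession m').2 := by decide

/-- Minimality in a direction is inherited by subsets of the exponents, so dropping monomials with
coefficient ∞ does no harm. -/
theorem IsPolygonalCycle.segment_subset_closure_of_subset {M : Finset (ℤ × ℤ)} {c : ℤ × ℤ → ℝ}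
    (hM : M ⊆ exponents) {n : ℕ} [NeZero n] {p : Fin n → ℝ × ℝ}
    (hp : IsPolygonalCycle (minCurve M c) p) (i : Fin n) :
    segment ℝ (p i) (p (i + 1)) ⊆ closure (strictRegion M c (1, 1)) := by
  refine hp.segment_subset_closure
    (w := fun m => (((recession m).1 : ℝ), ((recession m).2 : ℝ))) ?_ ?_ ?_ i
  · intro m hm _ h
    refine recession_ne_zero m (hM hm) (Prod.ext ?_ ?_)
    · simpa using congrArg Prod.fst h
    · simpa using congrArg Prod.snd h
  · intro m hm h m' hm'
    have := recession_le m (hM hm) h m' (hM hm')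
    simp only [dot]
    exact_mod_cast this
  · intro m hm h m' hm' h' hne
    have := recession_lt m (hM hm) h m' (hM hm') h' hne
    simp only [dot]
    exact_mod_cast this

section

variable {u12 u34 u5 u67 u8 : EReal}

theorem le_add_coe_iff {u : EReal} (hu : u ≠ ⊥) (z r : ℝ) :
    (z : EReal) ≤ u + r ↔ (u ≠ ⊤ → z ≤ u.toReal + r) := by
  induction u with
  | bot => exact absurd rfl hu
  | top => simp
  | coe u =>
    rw [← EReal.coe_add, EReal.coe_le_coe_iff]
    simp

/-- Describing the minimum by its lower bounds lets infinite coefficients drop out. Finiteness of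
`u12` keeps the infimum finite, so `toReal` loses nothing. -/
theorem le_tropPoly_iff (h12 : u12 ≠ ⊥) (h34 : u34 ≠ ⊥) (h5 : u5 ≠ ⊥) (h67 : u67 ≠ ⊥)
    (h8 : u8 ≠ ⊥) (h12' : u12 ≠ ⊤) (P : ℝ × ℝ) (z : ℝ) :
    z ≤ tropPoly u12 u34 u5 u67 u8 P ↔ ∀ m ∈ finiteExponents u12 u34 u5 u67 u8,
      z ≤ monomialValue (realCoeff u12 u34 u5 u67 u8) m P := by
  have hle : ∀ z : ℝ, ((z : EReal) ≤ ((u12 + (P.1 : EReal)) ⊓ (u12 + (P.2 : EReal)) ⊓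
    (u34 + ((2 * P.1 : ℝ) : EReal)) ⊓ (u34 + ((2 * P.2 : ℝ) : EReal)) ⊓
    (u5 + ((P.1 + P.2 : ℝ) : EReal)) ⊓
    (u67 + ((2 * P.1 + P.2 : ℝ) : EReal)) ⊓ (u67 + ((2 * P.2 + P.1 : ℝ) : EReal)) ⊓
    (u8 + ((2 * P.1 + 2 * P.2 : ℝ) : EReal)))) ↔ ∀ m ∈ finiteExponents u12 u34 u5 u67 u8,
      z ≤ monomialValue (realCoeff u12 u34 u5 u67 u8) m P := by
    intro z
    simp only [le_inf_iff, le_add_coe_iff h12, le_add_coe_iff h34, le_add_coe_iff h5,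
      le_add_coe_iff h67, le_add_coe_iff h8, finiteExponents, exponents, Finset.mem_filter,
      Finset.mem_insert, Finset.mem_singleton, monomialValue, realCoeff, and_imp,
      forall_eq_or_imp, forall_eq, dot]
    norm_num [coeffAt]
    simp only [and_assoc, add_comm (P.1) (2 * P.2)]
  rw [tropPoly, ← hle]
  generalize hI : ((u12 + (P.1 : EReal)) ⊓ (u12 + (P.2 : EReal)) ⊓
    (u34 + ((2 * P.1 : ℝ) : EReal)) ⊓ (u34 + ((2 * P.2 : ℝ) : EReal)) ⊓
    (u5 + ((P.1 + P.2 : ℝ) : EReal)) ⊓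
    (u67 + ((2 * P.1 + P.2 : ℝ) : EReal)) ⊓ (u67 + ((2 * P.2 + P.1 : ℝ) : EReal)) ⊓
    (u8 + ((2 * P.1 + 2 * P.2 : ℝ) : EReal))) = I at hle ⊢
  have hbot : I ≠ ⊥ := by
    have hne : (finiteExponents u12 u34 u5 u67 u8).Nonempty := ⟨(1, 0), Finset.mem_filter.2
      ⟨by simp [exponents], by simp [coeffAt, h12']⟩⟩
    obtain ⟨m, hm, hmin⟩ := Finset.exists_min_image _
      (fun m => monomialValue (realCoeff u12 u34 u5 u67 u8) m P) hne
    rintro rfl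
    have := (hle _).2 hmin
    rw [le_bot_iff] at this
    exact EReal.coe_ne_bot _ this
  have htop : I ≠ ⊤ := by
    intro h
    have : I ≤ u12 + (P.1 : EReal) := by
      rw [← hI]; simp only [inf_assoc]; exact inf_le_left
    rw [h, top_le_iff] at this
    lift u12 to ℝ using ⟨h12', h12⟩
    rw [← EReal.coe_add] at this
    exact EReal.coe_ne_top _ this
  lift I to ℝ using ⟨htop, hbot⟩
  simp

theorem setOf_not_differentiableAt_tropPoly (h12 : u12 ≠ ⊥) (h34 : u34 ≠ ⊥) (h5 : u5 ≠ ⊥)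
    (h67 : u67 ≠ ⊥) (h8 : u8 ≠ ⊥) (h12' : u12 ≠ ⊤) :
    {P | ¬ DifferentiableAt ℝ (tropPoly u12 u34 u5 u67 u8) P} =
      minCurve (finiteExponents u12 u34 u5 u67 u8) (realCoeff u12 u34 u5 u67 u8) := by
  ext P
  refine not_differentiableAt_iff ⟨(1, 0), ?_⟩
    (le_tropPoly_iff h12 h34 h5 h67 h8 h12') P
  exact Finset.mem_filter.2 ⟨by simp [exponents], by simp [coeffAt, h12']⟩

end

end TropEdwards

/-! ### The region of the monomial xy in normalized coordinates -/

namespace TropEdwards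

/-- The boundary of the polygon cut out by the conditions that the other monomials be not smaller
than the monomial with exponent `(1, 1)`, in normalized coordinates. -/
def boundaryPolygon (D : ℝ) : Set (ℝ × ℝ) :=
  {P | (0 ≤ 1 - P.1 ∧ 0 ≤ 1 - P.2 ∧ 0 ≤ 1 + min D 1 + P.1 - P.2 ∧ 0 ≤ 1 + min D 1 + P.2 - P.1 ∧
      0 ≤ D + P.1 ∧ 0 ≤ D + P.2 ∧ 0 ≤ 2 * min D 1 + P.1 + P.2) ∧
    (1 - P.1 = 0 ∨ 1 - P.2 = 0 ∨ 1 + min D 1 + P.1 - P.2 = 0 ∨ 1 + min D 1 + P.2 - P.1 = 0 ∨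
      D + P.1 = 0 ∨ D + P.2 = 0 ∨ 2 * min D 1 + P.1 + P.2 = 0)}

/-- This absorbs the unknown coefficients; the propositions `A34`, `A67`, `A8` stand for their
finiteness. At D = 1 the diagonal inequalities follow from -1 ≤ x, y ≤ 1 as soon as a ≥ 1 and g ≥ 2.
At D = 2 the inequalities o + x ≥ 0 and o + y ≥ 0 follow from the diagonal ones as soon as o ≥ 2. A
redundant inequality can become an equality only at points already on the boundary, so lower bounds
suffice. -/
theorem mem_boundaryPolygon_iff {A34 A67 A8 : Prop} {D a o g x y : ℝ} (hD : -1 < D) (hD2 : D ≤ 2)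
    (ha : A34 → min D 1 ≤ a) (ha' : D ≠ 1 → A34 ∧ a = min D 1)
    (ho : A67 → D ≤ o) (ho' : D < 2 → A67 ∧ o = D)
    (hg : A8 → 2 * min D 1 ≤ g) (hg' : D ≠ 1 → A8 ∧ g = 2 * min D 1) :
    (0 ≤ 1 - x ∧ 0 ≤ 1 - y ∧ (A34 → 0 ≤ 1 + a + x - y ∧ 0 ≤ 1 + a + y - x) ∧
      (A67 → 0 ≤ o + x ∧ 0 ≤ o + y) ∧ (A8 → 0 ≤ g + x + y)) ∧
    (1 - x = 0 ∨ 1 - y = 0 ∨ (A34 ∧ (1 + a + x - y = 0 ∨ 1 + a + y - x = 0)) ∨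
      (A67 ∧ (o + x = 0 ∨ o + y = 0)) ∨ (A8 ∧ g + x + y = 0)) ↔
    (x, y) ∈ boundaryPolygon D := by
  rw [boundaryPolygon, Set.mem_ofPred_eq]
  dsimp only
  by_cases h1 : D = 1
  · obtain ⟨h67, rfl⟩ := ho' (by linarith)
    subst h1
    rw [min_self] at *
    constructor
    · rintro ⟨⟨p1, p2, p3, p4, p5⟩, h⟩
      have p4' := p4 h67
      refine ⟨⟨p1, p2, by linarith, by linarith, p4'.1, p4'.2, by linarith⟩, ?_⟩
      rcases h with h | h | ⟨h, h' | h'⟩ | ⟨h, h' | h'⟩ | ⟨h, h'⟩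
      · exact Or.inl h
      · exact Or.inr (Or.inl h)
      · have := ha h
        exact Or.inr (Or.inl (by linarith))
      · have := ha h
        exact Or.inl (by linarith)
      · exact Or.inr (Or.inr (Or.inr (Or.inr (Or.inl h'))))
      · exact Or.inr (Or.inr (Or.inr (Or.inr (Or.inr (Or.inl h')))))
      · have := hg h
        exact Or.inr (Or.inr (Or.inr (Or.inr (Or.inl (by linarith)))))
    · rintro ⟨⟨p1, p2, p3, p4, p5, p6, p7⟩, h⟩
      refine ⟨⟨p1, p2, fun h => ?_, fun _ => ⟨p5, p6⟩, fun h => ?_⟩, ?_⟩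
      · have := ha h
        exact ⟨by linarith, by linarith⟩
      · have := hg h
        linarith
      · rcases h with h | h | h | h | h | h | h
        · exact Or.inl h
        · exact Or.inr (Or.inl h)
        · exact Or.inr (Or.inl (by linarith))
        · exact Or.inl (by linarith)
        · exact Or.inr (Or.inr (Or.inr (Or.inl ⟨h67, Or.inl h⟩)))
        · exact Or.inr (Or.inr (Or.inr (Or.inl ⟨h67, Or.inr h⟩)))
        · exact Or.inr (Or.inr (Or.inr (Or.inl ⟨h67, Or.inl (by linarith)⟩)))
  · obtain ⟨h34, rfl⟩ := ha' h1
    obtain ⟨h8, rfl⟩ := hg' h1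
    by_cases h2 : D < 2
    · obtain ⟨h67, rfl⟩ := ho' h2
      simp only [h34, h67, h8, true_and, forall_const]
      constructor
      · rintro ⟨⟨p1, p2, ⟨p3, p4⟩, ⟨p5, p6⟩, p7⟩, h⟩
        exact ⟨⟨p1, p2, p3, p4, p5, p6, p7⟩, by tauto⟩
      · rintro ⟨⟨p1, p2, p3, p4, p5, p6, p7⟩, h⟩
        exact ⟨⟨p1, p2, ⟨p3, p4⟩, ⟨p5, p6⟩, p7⟩, by tauto⟩
    · have h2 : D = 2 := by linarith
      subst h2
      rw [min_eq_right (by norm_num : (1 : ℝ) ≤ 2)] at *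
      simp only [h34, h8, true_and, forall_const]
      constructor
      · rintro ⟨⟨p1, p2, ⟨p3, p4⟩, p5, p7⟩, h⟩
        refine ⟨⟨p1, p2, p3, p4, by linarith, by linarith, p7⟩, ?_⟩
        rcases h with h | h | (h | h) | ⟨h, h' | h'⟩ | h
        · exact Or.inl h
        · exact Or.inr (Or.inl h)
        · exact Or.inr (Or.inr (Or.inl h))
        · exact Or.inr (Or.inr (Or.inr (Or.inl h)))
        · have := ho h
          exact Or.inr (Or.inr (Or.inl (by linarith)))
        · have := ho h
          exact Or.inr (Or.inr (Or.inr (Or.inl (by linarith))))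
        · tauto
      · rintro ⟨⟨p1, p2, p3, p4, p5, p6, p7⟩, h⟩
        refine ⟨⟨p1, p2, ⟨p3, p4⟩, fun h => ?_, p7⟩, ?_⟩
        · have := ho h
          exact ⟨by linarith, by linarith⟩
        rcases h with h | h | h | h | h | h | h
        · exact Or.inl h
        · exact Or.inr (Or.inl h)
        · exact Or.inr (Or.inr (Or.inl (Or.inl h)))
        · exact Or.inr (Or.inr (Or.inl (Or.inr h)))
        · exact Or.inr (Or.inr (Or.inl (Or.inl (by linarith))))
        · exact Or.inr (Or.inr (Or.inl (Or.inr (by linarith))))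
        · tauto

theorem forall_finiteExponents_iff {u34 u67 u8 : EReal} {k12 k5 : ℝ} {f : ℤ × ℤ → Prop} :
    (∀ m ∈ finiteExponents k12 u34 k5 u67 u8, f m) ↔ f (0, 1) ∧ f (1, 0) ∧ f (1, 1) ∧
      (u34 ≠ ⊤ → f (2, 0) ∧ f (0, 2)) ∧ (u67 ≠ ⊤ → f (2, 1) ∧ f (1, 2)) ∧ (u8 ≠ ⊤ → f (2, 2)) := by
  simp only [finiteExponents, exponents, Finset.mem_filter, Finset.mem_insert,
    Finset.mem_singleton, and_imp, forall_eq_or_imp, forall_eq]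
  have e1 : coeffAt k12 u34 k5 u67 u8 (1, 0) ≠ ⊤ := by simp [coeffAt]
  have e2 : coeffAt k12 u34 k5 u67 u8 (0, 1) ≠ ⊤ := by simp [coeffAt]
  have e3 : coeffAt k12 u34 k5 u67 u8 (1, 1) ≠ ⊤ := by simp [coeffAt]
  have e4 : coeffAt k12 u34 k5 u67 u8 (2, 0) = u34 := by simp [coeffAt]
  have e5 : coeffAt k12 u34 k5 u67 u8 (0, 2) = u34 := by simp [coeffAt]
  have e6 : coeffAt k12 u34 k5 u67 u8 (2, 1) = u67 := by simp [coeffAt]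
  have e7 : coeffAt k12 u34 k5 u67 u8 (1, 2) = u67 := by simp [coeffAt]
  have e8 : coeffAt k12 u34 k5 u67 u8 (2, 2) = u8 := by simp [coeffAt]
  rw [e4, e5, e6, e7, e8]
  constructor
  · rintro ⟨a1, a2, a3, a4, a5, a6, a7, a8⟩
    exact ⟨a2 e2, a1 e1, a5 e3, fun h => ⟨a3 h, a4 h⟩, fun h => ⟨a6 h, a7 h⟩, a8⟩
  · rintro ⟨a2, a1, a5, a34, a67, a8⟩
    exact ⟨fun _ => a1, fun _ => a2, fun h => (a34 h).1, fun h => (a34 h).2, fun _ => a5,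
      fun h => (a67 h).1, fun h => (a67 h).2, a8⟩

theorem exists_finiteExponents_iff {u34 u67 u8 : EReal} {k12 k5 : ℝ} {f : ℤ × ℤ → Prop} :
    (∃ m ∈ finiteExponents k12 u34 k5 u67 u8, f m) ↔ f (0, 1) ∨ f (1, 0) ∨ f (1, 1) ∨
      (u34 ≠ ⊤ ∧ (f (2, 0) ∨ f (0, 2))) ∨ (u67 ≠ ⊤ ∧ (f (2, 1) ∨ f (1, 2))) ∨
      (u8 ≠ ⊤ ∧ f (2, 2)) := by
  constructor
  · rintro ⟨m, hm, hf⟩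
    by_contra h
    push Not at h
    exact forall_finiteExponents_iff (f := fun m => ¬ f m).2 h m hm hf
  · intro h
    by_contra hcon
    push Not at hcon
    obtain ⟨a2, a1, a5, a34, a67, a8⟩ := forall_finiteExponents_iff.1 hcon
    rcases h with h | h | h | ⟨h, h' | h'⟩ | ⟨h, h' | h'⟩ | ⟨h, h'⟩
    exacts [a2 h, a1 h, a5 h, (a34 h).1 h', (a34 h).2 h', (a67 h).1 h', (a67 h).2 h', a8 h h']

theorem exists_isActive_iff {u34 u67 u8 : EReal} (k12 k5 : ℝ) (P : ℝ × ℝ) :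
    (IsActive (finiteExponents k12 u34 k5 u67 u8) (realCoeff k12 u34 k5 u67 u8) (1, 1) P ∧
      ∃ m, m ≠ (1, 1) ∧
        IsActive (finiteExponents k12 u34 k5 u67 u8) (realCoeff k12 u34 k5 u67 u8) m P) ↔
    (0 ≤ k12 + P.2 - (k5 + P.1 + P.2) ∧ 0 ≤ k12 + P.1 - (k5 + P.1 + P.2) ∧
      (u34 ≠ ⊤ → 0 ≤ u34.toReal + 2 * P.1 - (k5 + P.1 + P.2) ∧
        0 ≤ u34.toReal + 2 * P.2 - (k5 + P.1 + P.2)) ∧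
      (u67 ≠ ⊤ → 0 ≤ u67.toReal + 2 * P.1 + P.2 - (k5 + P.1 + P.2) ∧
        0 ≤ u67.toReal + P.1 + 2 * P.2 - (k5 + P.1 + P.2)) ∧
      (u8 ≠ ⊤ → 0 ≤ u8.toReal + 2 * P.1 + 2 * P.2 - (k5 + P.1 + P.2))) ∧
    (k12 + P.2 - (k5 + P.1 + P.2) = 0 ∨ k12 + P.1 - (k5 + P.1 + P.2) = 0 ∨
      (u34 ≠ ⊤ ∧ (u34.toReal + 2 * P.1 - (k5 + P.1 + P.2) = 0 ∨
        u34.toReal + 2 * P.2 - (k5 + P.1 + P.2) = 0)) ∨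
      (u67 ≠ ⊤ ∧ (u67.toReal + 2 * P.1 + P.2 - (k5 + P.1 + P.2) = 0 ∨
        u67.toReal + P.1 + 2 * P.2 - (k5 + P.1 + P.2) = 0)) ∨
      (u8 ≠ ⊤ ∧ u8.toReal + 2 * P.1 + 2 * P.2 - (k5 + P.1 + P.2) = 0)) := by
  set M := finiteExponents k12 u34 k5 u67 u8 with hM
  set c := realCoeff k12 u34 k5 u67 u8 with hc
  have h1 : IsActive M c (1, 1) P ↔ ∀ m ∈ M,
      0 ≤ monomialValue c m P - monomialValue c (1, 1) P := by
    have h11 : (1, 1) ∈ M := Finset.mem_filter.2 ⟨by simp [exponents], by simp [coeffAt]⟩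
    simp only [IsActive, h11, true_and, sub_nonneg]
  have h2 : (IsActive M c (1, 1) P ∧ ∃ m, m ≠ (1, 1) ∧ IsActive M c m P) ↔
      (∀ m ∈ M, 0 ≤ monomialValue c m P - monomialValue c (1, 1) P) ∧
        ∃ m ∈ M, m ≠ (1, 1) ∧ monomialValue c m P - monomialValue c (1, 1) P = 0 := by
    rw [← h1]
    refine and_congr_right fun h => ⟨?_, ?_⟩
    · rintro ⟨m, hne, hm⟩
      exact ⟨m, hm.1, hne, sub_eq_zero.2 (le_antisymm (hm.2 _ h.1) (h.2 _ hm.1))⟩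
    · rintro ⟨m, hm, hne, h0⟩
      exact ⟨m, hne, hm, fun m' hm' => (sub_eq_zero.1 h0).le.trans (h.2 m' hm')⟩
  rw [h2, hM, hc]
  rw [forall_finiteExponents_iff, exists_finiteExponents_iff]
  have v1 : monomialValue c (0, 1) P = k12 + P.2 := by
    simp [hc, monomialValue, realCoeff, coeffAt, dot]
  have v2 : monomialValue c (1, 0) P = k12 + P.1 := by
    simp [hc, monomialValue, realCoeff, coeffAt, dot]
  have v3 : monomialValue c (1, 1) P = k5 + P.1 + P.2 := by
    simp [hc, monomialValue, realCoeff, coeffAt, dot, add_assoc]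
  have v4 : monomialValue c (2, 0) P = u34.toReal + 2 * P.1 := by
    simp [hc, monomialValue, realCoeff, coeffAt, dot]
  have v5 : monomialValue c (0, 2) P = u34.toReal + 2 * P.2 := by
    simp [hc, monomialValue, realCoeff, coeffAt, dot]
  have v6 : monomialValue c (2, 1) P = u67.toReal + 2 * P.1 + P.2 := by
    simp [hc, monomialValue, realCoeff, coeffAt, dot, add_assoc]
  have v7 : monomialValue c (1, 2) P = u67.toReal + P.1 + 2 * P.2 := by
    simp [hc, monomialValue, realCoeff, coeffAt, dot, add_assoc]
  have v8 : monomialValue c (2, 2) P = u8.toReal + 2 * P.1 + 2 * P.2 := by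
    simp [hc, monomialValue, realCoeff, coeffAt, dot, add_assoc]
  rw [← hc, v1, v2, v3, v4, v5, v6, v7, v8, sub_self]
  simp

/-- Up to a translation, the polygonal cycles of the tropical curve are those of the boundary
polygon. -/
theorem isPolygonalCycle_iff_boundaryPolygon {k c D : ℝ} {a o g : EReal} (hD : -1 < D)
    (hD2 : D ≤ 2) (ha : ((min D 1 : ℝ) : EReal) ≤ a) (ha' : D ≠ 1 → a = (min D 1 : ℝ))
    (ho : (D : EReal) ≤ o) (ho' : D < 2 → o = D)
    (hg : ((2 * min D 1 : ℝ) : EReal) ≤ g) (hg' : D ≠ 1 → g = (2 * min D 1 : ℝ))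
    {u12 u34 u5 u67 u8 : EReal} (h12 : u12 = (k + 1 - c : ℝ)) (h5 : u5 = (k - 2 * c : ℝ))
    (h34 : u34 = (k - 2 * c + 1 : ℝ) + a) (h67 : u67 = (k - 3 * c : ℝ) + o)
    (h8 : u8 = (k - 4 * c : ℝ) + g) {n : ℕ} [NeZero n] {p : Fin n → ℝ × ℝ} :
    IsPolygonalCycle {P | ¬ DifferentiableAt ℝ (tropPoly u12 u34 u5 u67 u8) P} p ↔
      IsPolygonalCycle {P | P - (c, c) ∈ boundaryPolygon D} p := by
  have nb : ∀ {x : ℝ} {z : EReal}, (x : EReal) ≤ z → z ≠ ⊥ := fun h h' => by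
    rw [h', le_bot_iff] at h
    exact EReal.coe_ne_bot _ h
  have sb : ∀ {x : ℝ} {z : EReal}, z ≠ ⊥ → (x : EReal) + z ≠ ⊥ := fun h h' => by
    rcases EReal.add_eq_bot_iff.1 h' with h' | h'
    · exact EReal.coe_ne_bot _ h'
    · exact h h'
  have st : ∀ {x : ℝ} {z : EReal}, (x : EReal) + z ≠ ⊤ ↔ z ≠ ⊤ := fun {x z} => by
    induction z with
    | bot => simp
    | top => simp
    | coe z => rw [← EReal.coe_add]; simp [-EReal.coe_add]
  have sr : ∀ {x : ℝ} {z : EReal}, z ≠ ⊥ → z ≠ ⊤ →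
      ((x : EReal) + z).toReal = x + z.toReal := fun {x z} h h' => by
    rw [EReal.toReal_add (by simp) (by simp) h' h, EReal.toReal_coe]
  have tr : ∀ {x : ℝ} {z : EReal}, (x : EReal) ≤ z → z ≠ ⊤ → x ≤ z.toReal := fun {x z} h h' => by
    have := EReal.coe_toReal h' (nb h)
    rw [← this] at h
    exact_mod_cast h
  subst h12 h5 h34 h67 h8
  rw [setOf_not_differentiableAt_tropPoly (EReal.coe_ne_bot _) (sb (nb ha)) (EReal.coe_ne_bot _)
    (sb (nb ho)) (sb (nb hg)) (EReal.coe_ne_top _)]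
  set u34 := ((k - 2 * c + 1 : ℝ) : EReal) + a with h34
  set u67 := ((k - 3 * c : ℝ) : EReal) + o with h67
  set u8 := ((k - 4 * c : ℝ) : EReal) + g with h8
  have key : ∀ P : ℝ × ℝ, (IsActive (finiteExponents (k + 1 - c : ℝ) u34 (k - 2 * c : ℝ) u67 u8)
      (realCoeff (k + 1 - c : ℝ) u34 (k - 2 * c : ℝ) u67 u8) (1, 1) P ∧
      ∃ m, m ≠ (1, 1) ∧ IsActive (finiteExponents (k + 1 - c : ℝ) u34 (k - 2 * c : ℝ) u67 u8)
        (realCoeff (k + 1 - c : ℝ) u34 (k - 2 * c : ℝ) u67 u8) m P) ↔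
      P - (c, c) ∈ boundaryPolygon D := by
    intro P
    have hb := mem_boundaryPolygon_iff (A34 := a ≠ ⊤) (A67 := o ≠ ⊤) (A8 := g ≠ ⊤) (a := a.toReal)
      (o := o.toReal) (g := g.toReal) (x := P.1 - c) (y := P.2 - c) hD hD2 (tr ha)
      (fun h => by
        rw [ha' h]; exact ⟨EReal.coe_ne_top _, EReal.toReal_coe _⟩) (tr ho) (fun h => by
        rw [ho' h]; exact ⟨EReal.coe_ne_top _, EReal.toReal_coe _⟩) (tr hg)
      (fun h => by
        rw [hg' h]; exact ⟨EReal.coe_ne_top _, EReal.toReal_coe _⟩)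
    have he : P - (c, c) = (P.1 - c, P.2 - c) := rfl
    rw [exists_isActive_iff, he, ← hb, h34, h67, h8, st, st, st]
    have q34 : a ≠ ⊤ → (((k - 2 * c + 1 : ℝ) : EReal) + a).toReal = _ := sr (nb ha)
    have q67 : o ≠ ⊤ → (((k - 3 * c : ℝ) : EReal) + o).toReal = _ := sr (nb ho)
    have q8 : g ≠ ⊤ → (((k - 4 * c : ℝ) : EReal) + g).toReal = _ := sr (nb hg)
    refine and_congr (and_congr ?_ (and_congr ?_ (and_congr (forall_congr' fun h => ?_)
      (and_congr (forall_congr' fun h => ?_) (forall_congr' fun h => ?_)))))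
      (or_congr ?_ (or_congr ?_ (or_congr (and_congr_right fun h => ?_)
      (or_congr (and_congr_right fun h => ?_) (and_congr_right fun h => ?_)))))
    · ring_nf
    · ring_nf
    · rw [q34 h]; ring_nf
    · rw [q67 h]; ring_nf
    · rw [q8 h]; ring_nf
    · ring_nf
    · ring_nf
    · rw [q34 h]; ring_nf
    · rw [q67 h]; ring_nf
    · rw [q8 h]; ring_nf
  constructor
  · intro hp
    refine ⟨hp.1, fun i P hP => ?_⟩
    have h11 := isActive_of_mem_closure_strictRegion
      (hp.segment_subset_closure_of_subset (Finset.filter_subset _ _) i hP)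
    refine (key P).1 ⟨h11, ?_⟩
    obtain ⟨m, m', hne, hm, hm'⟩ := hp.2 i hP
    by_cases h : m = (1, 1)
    · exact ⟨m', fun h' => hne (h.trans h'.symm), hm'⟩
    · exact ⟨m, h, hm⟩
  · intro hp
    refine ⟨hp.1, fun i P hP => ?_⟩
    obtain ⟨h11, m, hne, hm⟩ := (key P).2 (hp.2 i hP)
    exact ⟨m, (1, 1), hne, hm, h11⟩

/-- There are no polygonal cycles if the monomial with exponent `(1, 1)` is nowhere strictly
minimal. -/
theorem not_isPolygonalCycle {u12 u34 u5 u67 u8 : EReal} (h12 : u12 ≠ ⊥) (h34 : u34 ≠ ⊥)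
    (h5 : u5 ≠ ⊥) (h67 : u67 ≠ ⊥) (h8 : u8 ≠ ⊥) (h12' : u12 ≠ ⊤) (h34' : u34 ≠ ⊤)
    (hle : u34 ≤ u5) {n : ℕ} [NeZero n] (p : Fin n → ℝ × ℝ) :
    ¬ IsPolygonalCycle {P | ¬ DifferentiableAt ℝ (tropPoly u12 u34 u5 u67 u8) P} p := by
  rw [setOf_not_differentiableAt_tropPoly h12 h34 h5 h67 h8 h12']
  intro hp
  obtain ⟨P, hP⟩ := closure_nonempty_iff.1 ⟨_, hp.segment_subset_closure_of_subset
    (Finset.filter_subset _ _) 0 (left_mem_segment ℝ _ _)⟩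
  rw [mem_strictRegion] at hP
  have h20 : (2, 0) ∈ finiteExponents u12 u34 u5 u67 u8 :=
    Finset.mem_filter.2 ⟨by simp [exponents], by simp [coeffAt, h34']⟩
  have h02 : (0, 2) ∈ finiteExponents u12 u34 u5 u67 u8 :=
    Finset.mem_filter.2 ⟨by simp [exponents], by simp [coeffAt, h34']⟩
  have h5' : u5 ≠ ⊤ := by
    have := (Finset.mem_filter.1 hP.1).2
    simpa [coeffAt] using this
  -- Adding the inequalities for (2, 0) and (0, 2) cancels the coordinates and leaves u5 < u34.
  have e1 := hP.2 _ h20 (by decide)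
  have e2 := hP.2 _ h02 (by decide)
  have hle' := EReal.toReal_le_toReal hle h34 h5'
  simp [monomialValue, realCoeff, coeffAt, dot] at e1 e2
  linarith

end TropEdwards

namespace TropEdwards

/-! ### Boundaries of convex polygons -/

/-- The affine function with coefficients `g`. -/
def affineValue (g : ℝ × ℝ × ℝ) (P : ℝ × ℝ) : ℝ := g.1 + g.2.1 * P.1 + g.2.2 * P.2

/-- The part of `⋂ j, {g j ≥ 0}` on which some `g j` vanishes. -/
def polygonBoundary {k : ℕ} (g : Fin k → ℝ × ℝ × ℝ) : Set (ℝ × ℝ) :=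
  {P | (∀ j, 0 ≤ affineValue (g j) P) ∧ ∃ j, affineValue (g j) P = 0}

/-- The half planes `g j ≥ 0` are cyclically arranged: only the boundaries of consecutive ones meet
in their intersection, and they do so transversally. -/
structure IsCyclicArrangement {k : ℕ} [NeZero k] (g : Fin k → ℝ × ℝ × ℝ) : Prop where
  three_le : 3 ≤ k
  adjacent : ∀ P, (∀ j, 0 ≤ affineValue (g j) P) → ∀ i j, i ≠ j →
    affineValue (g i) P = 0 → affineValue (g j) P = 0 → j = i + 1 ∨ i = j + 1
  transverse : ∀ i, (g i).2.1 * (g (i + 1)).2.2 - (g i).2.2 * (g (i + 1)).2.1 ≠ 0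

theorem affineValue_lineMap (g : ℝ × ℝ × ℝ) (P Q : ℝ × ℝ) (t : ℝ) :
    affineValue g (AffineMap.lineMap P Q t) =
      (1 - t) * affineValue g P + t * affineValue g Q := by
  rw [AffineMap.lineMap_apply_module]
  simp only [affineValue, Prod.fst_add, Prod.snd_add, Prod.smul_fst, Prod.smul_snd, smul_eq_mul]
  ring

theorem eq_of_affineValue_eq_zero {g h : ℝ × ℝ × ℝ} (hdet : g.2.1 * h.2.2 - g.2.2 * h.2.1 ≠ 0)
    {P Q : ℝ × ℝ} (hP : affineValue g P = 0) (hP' : affineValue h P = 0)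
    (hQ : affineValue g Q = 0) (hQ' : affineValue h Q = 0) : P = Q := by
  unfold affineValue at *
  have e1 : (g.2.1 * h.2.2 - g.2.2 * h.2.1) * (P.1 - Q.1) = 0 := by
    linear_combination h.2.2 * (hP - hQ) - g.2.2 * (hP' - hQ')
  have e2 : (g.2.1 * h.2.2 - g.2.2 * h.2.1) * (P.2 - Q.2) = 0 := by
    linear_combination g.2.1 * (hP' - hQ') - h.2.1 * (hP - hQ)
  exact Prod.ext (sub_eq_zero.1 ((mul_eq_zero.1 e1).resolve_left hdet))
    (sub_eq_zero.1 ((mul_eq_zero.1 e2).resolve_left hdet))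

theorem collinear_of_affineValue_eq_zero {g : ℝ × ℝ × ℝ} (hg : g.2 ≠ 0) {P Q R : ℝ × ℝ}
    (hP : affineValue g P = 0) (hQ : affineValue g Q = 0) (hR : affineValue g R = 0) :
    Collinear ℝ {P, Q, R} := by
  rw [collinear_iff_of_mem (p₀ := P) (by simp)]
  have hv : ((-g.2.2, g.2.1) : ℝ × ℝ) ≠ 0 := by
    intro h
    have h1 := congrArg Prod.fst h
    have h2 := congrArg Prod.snd h
    simp only [Prod.fst_zero, Prod.snd_zero, neg_eq_zero] at h1 h2
    exact hg (Prod.ext h2 h1)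
  refine ⟨(-g.2.2, g.2.1), ?_⟩
  have key : ∀ S, affineValue g S = 0 → ∃ r : ℝ, S = r • (-g.2.2, g.2.1) +ᵥ P := by
    intro S hS
    obtain ⟨r, hr⟩ := exists_smul_of_det2_eq_zero (v := (-g.2.2, g.2.1)) (w := S - P) hv (by
      unfold affineValue at hS hP
      simp only [det2, Prod.fst_sub, Prod.snd_sub]
      linear_combination hP - hS)
    exact ⟨r, by rw [← hr, vadd_eq_add, sub_add_cancel]⟩
  rintro S (rfl | rfl | rfl)
  exacts [key _ hP, key _ hQ, key _ hR]

namespace IsCyclicArrangement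

variable {k : ℕ} [NeZero k] {g : Fin k → ℝ × ℝ × ℝ}

/-- The sides of a polygonal cycle in the boundary of a convex polygon lie on distinct edges, and
consecutive sides lie on consecutive edges. -/
theorem exists_edges (hg : IsCyclicArrangement g) {n : ℕ} [NeZero n] {p : Fin n → ℝ × ℝ}
    (hp : IsPolygonalCycle (polygonBoundary g) p) : ∃ e : Fin n → Fin k, Function.Bijective e ∧
      (∀ i, affineValue (g (e i)) (p i) = 0) ∧ (∀ i, affineValue (g (e i)) (p (i + 1)) = 0) ∧
      ∀ i, e (i + 1) = e i + 1 ∨ e i = e (i + 1) + 1 := by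
  have hin : ∀ i j, 0 ≤ affineValue (g j) (p i) := fun i =>
    (hp.2 i (left_mem_segment ℝ _ _)).1
  have hmid : ∀ i, ∃ j, affineValue (g j) (p i) = 0 ∧ affineValue (g j) (p (i + 1)) = 0 := by
    intro i
    -- An affine function that is nonnegative at both ends and vanishes at the midpoint vanishes at
    -- both ends.
    have hm : AffineMap.lineMap (p i) (p (i + 1)) (1 / 2 : ℝ) ∈ segment ℝ (p i) (p (i + 1)) := by
      rw [segment_eq_image_lineMap]
      exact Set.mem_image_of_mem _ (Set.mem_Icc.2 ⟨by norm_num, by norm_num⟩)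
    obtain ⟨-, j, hj⟩ := hp.2 i hm
    rw [affineValue_lineMap] at hj
    have h1 := hin i j
    have h2 := hin (i + 1) j
    exact ⟨j, by linarith, by linarith⟩
  choose e h0 h1 using hmid
  have hg0 : ∀ j, (g j).2 ≠ 0 := fun j h => by
    have := hg.transverse j
    rw [h] at this
    simp at this
  have hne : ∀ i, e i ≠ e (i + 1) := by
    intro i h
    refine hp.1.2.1 i (collinear_of_affineValue_eq_zero (hg0 (e i)) (h0 i) (h1 i) ?_)
    rw [h]; exact h1 (i + 1)
  have hadj : ∀ i, e (i + 1) = e i + 1 ∨ e i = e (i + 1) + 1 := fun i =>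
    hg.adjacent _ (hin (i + 1)) _ _ (hne i) (h1 i) (h0 (i + 1))
  have huniq : ∀ i j : Fin k, (j = i + 1 ∨ i = j + 1) → ∀ P Q, affineValue (g i) P = 0 →
      affineValue (g j) P = 0 → affineValue (g i) Q = 0 → affineValue (g j) Q = 0 → P = Q := by
    rintro i j (rfl | rfl) P Q a b c d
    · exact eq_of_affineValue_eq_zero (hg.transverse _) a b c d
    · exact eq_of_affineValue_eq_zero (hg.transverse _) b a d c
  -- Turning back to the previous edge would put two consecutive vertices on the same pair of
  -- transverse lines. Hence the edges are traversed in one constant direction.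
  have hback : ∀ i, e (i + 1 + 1) ≠ e i := by
    intro i h
    exact hp.1.ne_succ (i + 1) (huniq _ _ (hadj i) _ _ (h1 i) (h0 (i + 1))
      (by rw [← h]; exact h0 _) (h1 (i + 1)))
  have hdir : (∀ i, e (i + 1) = e i + 1) ∨ ∀ i, e i = e (i + 1) + 1 := by
    rcases hadj 0 with h | h
    · refine Or.inl (fin_cyclic_induction h fun j hj => ?_)
      refine (hadj (j + 1)).resolve_right fun h' => hback j ?_
      rw [hj] at h'
      exact (add_right_cancel h').symm
    · refine Or.inr (fin_cyclic_induction h fun j hj => ?_)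
      refine (hadj (j + 1)).resolve_left fun h' => hback j ?_
      rw [h', ← hj]
  refine ⟨e, ⟨fun i j h => ?_, ?_⟩, h0, h1, hadj⟩
  · have h' : e (i + 1) = e (j + 1) := by
      rcases hdir with hd | hd
      · rw [hd, hd, h]
      · have := hd i
        rw [h, hd j] at this
        exact (add_right_cancel this).symm
    have := hp.1.injective (huniq _ _ (hadj i) _ _ (h1 i) (h0 (i + 1)) (h ▸ h1 j)
      (h' ▸ h0 (j + 1)))
    exact add_right_cancel this
  · refine fin_cyclic_induction (S := fun x => ∃ i, e i = x) ⟨0, rfl⟩ ?_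
    rintro _ ⟨i, rfl⟩
    rcases hdir with hd | hd
    · exact ⟨i + 1, hd i⟩
    · refine ⟨i - 1, ?_⟩
      have := hd (i - 1)
      rwa [sub_add_cancel] at this

theorem card_eq (hg : IsCyclicArrangement g) {n : ℕ} [NeZero n] {p : Fin n → ℝ × ℝ}
    (hp : IsPolygonalCycle (polygonBoundary g) p) : n = k := by
  obtain ⟨e, he, -⟩ := hg.exists_edges hp
  simpa using Fintype.card_of_bijective he

/-- Side `i` lies on the zero line of `g i` inside the polygon. Transversality then gives genuine
corners and single common points of neighbouring sides, while adjacency keeps the other sides apart.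
-/
theorem isPolygonalCycle (hg : IsCyclicArrangement g) {V : Fin k → ℝ × ℝ}
    (hin : ∀ i j, 0 ≤ affineValue (g j) (V i)) (h0 : ∀ i, affineValue (g i) (V i) = 0)
    (h1 : ∀ i, affineValue (g i) (V (i + 1)) = 0) (hne : ∀ i, V i ≠ V (i + 1)) :
    IsPolygonalCycle (polygonBoundary g) V := by
  have hseg : ∀ i, ∀ z ∈ segment ℝ (V i) (V (i + 1)),
      (∀ j, 0 ≤ affineValue (g j) z) ∧ affineValue (g i) z = 0 := by
    intro i z hz
    rw [segment_eq_image_lineMap] at hz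
    obtain ⟨t, ht, rfl⟩ := hz
    refine ⟨fun j => ?_, ?_⟩
    · rw [affineValue_lineMap]
      have a := mul_nonneg (sub_nonneg.2 ht.2) (hin i j)
      have b := mul_nonneg ht.1 (hin (i + 1) j)
      linarith
    · rw [affineValue_lineMap, h0, h1]; ring
  refine ⟨⟨hg.three_le, fun i hc => ?_, fun i => ?_, fun i j hj h2 h3 => ?_⟩, fun i z hz =>
    ⟨(hseg i z hz).1, i, (hseg i z hz).2⟩⟩
  · have hmem := hc.mem_affineSpan_of_mem_of_ne (p₁ := V i) (p₂ := V (i + 1))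
      (p₃ := V (i + 1 + 1)) (by simp) (by simp) (by simp) (hne i)
    obtain ⟨r, hr⟩ := mem_affineSpan_pair_iff_exists_lineMap_eq.1 hmem
    have h2 : affineValue (g i) (V (i + 1 + 1)) = 0 := by
      rw [← hr, affineValue_lineMap, h0, h1]; ring
    exact hne (i + 1) (eq_of_affineValue_eq_zero (hg.transverse i) (h1 i) (h0 (i + 1)) h2
      (h1 (i + 1)))
  · refine Set.Subset.antisymm ?_ ?_
    · rintro z ⟨hz, hz'⟩
      exact eq_of_affineValue_eq_zero (hg.transverse i) (hseg i z hz).2 (hseg (i + 1) z hz').2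
        (h1 i) (h0 (i + 1))
    · rintro z rfl
      exact ⟨right_mem_segment ℝ _ _, left_mem_segment ℝ _ _⟩
  · rw [Set.disjoint_left]
    intro z hz hz'
    rcases hg.adjacent z (hseg i z hz).1 i j hj.symm (hseg i z hz).2 (hseg j z hz').2 with h | h
    · exact h2 h
    · exact h3 h

end IsCyclicArrangement

/-! ### The square, the heptagon and the pentagon -/

theorem forall_fin_four_succ {Q : Fin 4 → Fin 4 → Prop} (h0 : Q 0 1) (h1 : Q 1 2) (h2 : Q 2 3)
    (h3 : Q 3 0) (i : Fin 4) : Q i (i + 1) := by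
  fin_cases i <;> assumption

theorem forall_fin_five_succ {Q : Fin 5 → Fin 5 → Prop} (h0 : Q 0 1) (h1 : Q 1 2) (h2 : Q 2 3)
    (h3 : Q 3 4) (h4 : Q 4 0) (i : Fin 5) : Q i (i + 1) := by
  fin_cases i <;> assumption

theorem forall_fin_seven_succ {Q : Fin 7 → Fin 7 → Prop} (h0 : Q 0 1) (h1 : Q 1 2) (h2 : Q 2 3)
    (h3 : Q 3 4) (h4 : Q 4 5) (h5 : Q 5 6) (h6 : Q 6 0) (i : Fin 7) : Q i (i + 1) := by
  fin_cases i <;> assumption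

/-- The edges of the square. -/
def squareEdges (D : ℝ) : Fin 4 → ℝ × ℝ × ℝ := ![(1, -1, 0), (1, 0, -1), (D, 1, 0), (D, 0, 1)]

/-- The edges of the heptagon. -/
def heptagonEdges (D : ℝ) : Fin 7 → ℝ × ℝ × ℝ :=
  ![(1, -1, 0), (1, 0, -1), (2, 1, -1), (D, 1, 0), (2, 1, 1), (D, 0, 1), (2, -1, 1)]

/-- The edges of the pentagon. -/
def pentagonEdges : Fin 5 → ℝ × ℝ × ℝ :=
  ![(1, -1, 0), (1, 0, -1), (2, 1, -1), (2, 1, 1), (2, -1, 1)]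

/-- Opposite edges can meet only if D = -1. -/
theorem isCyclicArrangement_squareEdges {D : ℝ} (h : -1 < D) :
    IsCyclicArrangement (squareEdges D) := by
  refine ⟨by norm_num, fun P hP i j hij hi hj => ?_, fun i => ?_⟩
  · simp only [Fin.forall_fin_succ, squareEdges, affineValue] at hP
    simp at hP
    fin_cases i <;> fin_cases j <;>
      first
      | exact absurd rfl hij
      | exact Or.inl rfl
      | exact Or.inr rfl
      | (exfalso; simp [squareEdges, affineValue] at hi hj; linarith)
  · refine forall_fin_four_succ (Q := fun i j => (squareEdges D i).2.1 * (squareEdges D j).2.2 -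
      (squareEdges D i).2.2 * (squareEdges D j).2.1 ≠ 0) ?_ ?_ ?_ ?_ i <;>
      simp [squareEdges]

theorem isCyclicArrangement_pentagonEdges : IsCyclicArrangement pentagonEdges := by
  refine ⟨by norm_num, fun P hP i j hij hi hj => ?_, fun i => ?_⟩
  · simp only [Fin.forall_fin_succ, pentagonEdges, affineValue] at hP
    simp at hP
    fin_cases i <;> fin_cases j <;>
      first
      | exact absurd rfl hij
      | exact Or.inl rfl
      | exact Or.inr rfl
      | (exfalso; simp [pentagonEdges, affineValue] at hi hj; linarith)
  · refine forall_fin_five_succ (Q := fun i j => (pentagonEdges i).2.1 * (pentagonEdges j).2.2 -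
      (pentagonEdges i).2.2 * (pentagonEdges j).2.1 ≠ 0) ?_ ?_ ?_ ?_ ?_ i <;>
      simp [pentagonEdges]

/-- Both bounds are needed. At D = 1 the edge 2 + x - y = 0 shrinks to the point (-1, 1), and at D =
2 the edge x = -D shrinks to (-2, 0); its two neighbours then meet. -/
theorem isCyclicArrangement_heptagonEdges {D : ℝ} (h1 : 1 < D) (h2 : D < 2) :
    IsCyclicArrangement (heptagonEdges D) := by
  refine ⟨by norm_num, fun P hP i j hij hi hj => ?_, fun i => ?_⟩
  · simp only [Fin.forall_fin_succ, heptagonEdges, affineValue] at hP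
    simp at hP
    fin_cases i <;> fin_cases j <;>
      first
      | exact absurd rfl hij
      | exact Or.inl rfl
      | exact Or.inr rfl
      | (exfalso; simp [heptagonEdges, affineValue] at hi hj; linarith)
  · refine forall_fin_seven_succ (Q := fun i j => (heptagonEdges D i).2.1 * (heptagonEdges D j).2.2 -
      (heptagonEdges D i).2.2 * (heptagonEdges D j).2.1 ≠ 0) ?_ ?_ ?_ ?_ ?_ ?_ ?_ i <;>
      simp [heptagonEdges]

end TropEdwards

/-! ### Identification of the polygon; explicit vertices and lengths -/

namespace TropEdwards

/-- For D ≤ 1 the three diagonal inequalities are sums of two of the inequalities -D ≤ x, y ≤ 1,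
with equality only at corners of the square. -/
theorem boundaryPolygon_eq_square {D : ℝ} (h1 : D ≤ 1) :
    boundaryPolygon D = polygonBoundary (squareEdges D) := by
  ext ⟨x, y⟩
  simp only [boundaryPolygon, polygonBoundary, Set.mem_ofPred_eq, min_eq_left h1,
    Fin.forall_fin_succ, Fin.exists_fin_succ, affineValue, squareEdges]
  simp
  constructor
  · rintro ⟨⟨p1, p2, p3, p4, p5, p6, p7⟩, h⟩
    refine ⟨⟨by linarith, by linarith, by linarith, by linarith⟩, ?_⟩
    rcases h with h | h | h | h | h | h | h
    · exact Or.inl (by linarith)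
    · exact Or.inr (Or.inl (by linarith))
    · exact Or.inr (Or.inl (by linarith))
    · exact Or.inl (by linarith)
    · exact Or.inr (Or.inr (Or.inl (by linarith)))
    · exact Or.inr (Or.inr (Or.inr (by linarith)))
    · exact Or.inr (Or.inr (Or.inl (by linarith)))
  · rintro ⟨⟨p1, p2, p3, p4⟩, h⟩
    refine ⟨⟨by linarith, by linarith, by linarith, by linarith, by linarith, by linarith,
      by linarith⟩, ?_⟩
    rcases h with h | h | h | h
    · exact Or.inl (by linarith)
    · exact Or.inr (Or.inl (by linarith))
    · exact Or.inr (Or.inr (Or.inr (Or.inr (Or.inl (by linarith)))))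
    · exact Or.inr (Or.inr (Or.inr (Or.inr (Or.inr (Or.inl (by linarith))))))

theorem boundaryPolygon_eq_heptagon {D : ℝ} (h1 : 1 < D) :
    boundaryPolygon D = polygonBoundary (heptagonEdges D) := by
  ext ⟨x, y⟩
  simp only [boundaryPolygon, polygonBoundary, Set.mem_ofPred_eq, min_eq_right h1.le,
    Fin.forall_fin_succ, Fin.exists_fin_succ, affineValue, heptagonEdges]
  simp
  constructor
  · rintro ⟨⟨p1, p2, p3, p4, p5, p6, p7⟩, h⟩
    refine ⟨⟨by linarith, by linarith, by linarith, by linarith, by linarith, by linarith,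
      by linarith⟩, ?_⟩
    rcases h with h | h | h | h | h | h | h
    · exact Or.inl (by linarith)
    · exact Or.inr (Or.inl (by linarith))
    · exact Or.inr (Or.inr (Or.inl (by linarith)))
    · exact Or.inr (Or.inr (Or.inr (Or.inr (Or.inr (Or.inr (by linarith))))))
    · exact Or.inr (Or.inr (Or.inr (Or.inl (by linarith))))
    · exact Or.inr (Or.inr (Or.inr (Or.inr (Or.inr (Or.inl (by linarith))))))
    · exact Or.inr (Or.inr (Or.inr (Or.inr (Or.inl (by linarith)))))
  · rintro ⟨⟨p1, p2, p3, p4, p5, p6, p7⟩, h⟩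
    refine ⟨⟨by linarith, by linarith, by linarith, by linarith, by linarith, by linarith,
      by linarith⟩, ?_⟩
    rcases h with h | h | h | h | h | h | h
    · exact Or.inl (by linarith)
    · exact Or.inr (Or.inl (by linarith))
    · exact Or.inr (Or.inr (Or.inl (by linarith)))
    · exact Or.inr (Or.inr (Or.inr (Or.inr (Or.inl (by linarith)))))
    · exact Or.inr (Or.inr (Or.inr (Or.inr (Or.inr (Or.inr (by linarith))))))
    · exact Or.inr (Or.inr (Or.inr (Or.inr (Or.inr (Or.inl (by linarith))))))
    · exact Or.inr (Or.inr (Or.inr (Or.inl (by linarith))))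

/-- The inequality 2 + x ≥ 0 is half the sum of 2 + x - y ≥ 0 and 2 + x + y ≥ 0, and likewise for y;
equality holds only where both summands vanish. -/
theorem boundaryPolygon_eq_pentagon : boundaryPolygon 2 = polygonBoundary pentagonEdges := by
  ext ⟨x, y⟩
  simp only [boundaryPolygon, polygonBoundary, Set.mem_ofPred_eq,
    min_eq_right (show (1 : ℝ) ≤ 2 by norm_num),
    Fin.forall_fin_succ, Fin.exists_fin_succ, affineValue, pentagonEdges]
  simp
  constructor
  · rintro ⟨⟨p1, p2, p3, p4, p5, p6, p7⟩, h⟩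
    refine ⟨⟨by linarith, by linarith, by linarith, by linarith, by linarith⟩, ?_⟩
    rcases h with h | h | h | h | h | h | h
    · exact Or.inl (by linarith)
    · exact Or.inr (Or.inl (by linarith))
    · exact Or.inr (Or.inr (Or.inl (by linarith)))
    · exact Or.inr (Or.inr (Or.inr (Or.inr (by linarith))))
    · exact Or.inr (Or.inr (Or.inl (by linarith)))
    · exact Or.inr (Or.inr (Or.inr (Or.inr (by linarith))))
    · exact Or.inr (Or.inr (Or.inr (Or.inl (by linarith))))
  · rintro ⟨⟨p1, p2, p3, p4, p5⟩, h⟩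
    refine ⟨⟨by linarith, by linarith, by linarith, by linarith, by linarith, by linarith,
      by linarith⟩, ?_⟩
    rcases h with h | h | h | h | h
    · exact Or.inl (by linarith)
    · exact Or.inr (Or.inl (by linarith))
    · exact Or.inr (Or.inr (Or.inl (by linarith)))
    · exact Or.inr (Or.inr (Or.inr (Or.inr (Or.inr (Or.inr (by linarith))))))
    · exact Or.inr (Or.inr (Or.inr (Or.inl (by linarith))))

/-- The number of corners of the polygonal cycles of the boundary polygon. -/
theorem card_eq_of_isPolygonalCycle_boundaryPolygon {D : ℝ} (h : -1 < D) (h2 : D ≤ 2) {n : ℕ}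
    [NeZero n] {p : Fin n → ℝ × ℝ} (hp : IsPolygonalCycle (boundaryPolygon D) p) :
    n = if D ≤ 1 then 4 else if D < 2 then 7 else 5 := by
  split_ifs with h3 h4
  · rw [boundaryPolygon_eq_square h3] at hp
    exact (isCyclicArrangement_squareEdges h).card_eq hp
  · rw [boundaryPolygon_eq_heptagon (not_le.1 h3)] at hp
    exact (isCyclicArrangement_heptagonEdges (not_le.1 h3) h4).card_eq hp
  · obtain rfl : D = 2 := le_antisymm h2 (not_lt.1 h4)
    rw [boundaryPolygon_eq_pentagon] at hp
    exact isCyclicArrangement_pentagonEdges.card_eq hp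

theorem hasPolygonalCycle_pentagon : HasPolygonalCycle (boundaryPolygon 2) 5 8 := by
  rw [boundaryPolygon_eq_pentagon]
  -- Vertex `i` is the intersection of edges `i - 1` and `i`, so side `i` lies on edge `i`.
  set V : Fin 5 → ℝ × ℝ := ![(1, -1), (1, 1), (-1, 1), (-2, 0), (0, -2)] with hV
  refine ⟨V, isCyclicArrangement_pentagonEdges.isPolygonalCycle (fun i j => ?_) (fun i => ?_)
    (forall_fin_five_succ (Q := fun i j => affineValue (pentagonEdges i) (V j) = 0)
      ?_ ?_ ?_ ?_ ?_)
    (forall_fin_five_succ (Q := fun i j => V i ≠ V j) ?_ ?_ ?_ ?_ ?_),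
    ![2, 2, 1, 2, 1], forall_fin_five_succ (Q := fun i j => HasLatticeLength (V i) (V j)
      ((![2, 2, 1, 2, 1] : Fin 5 → ℝ) i)) ⟨?_, 0, 1, ?_, ?_⟩ ⟨?_, -1, 0, ?_, ?_⟩ ⟨?_, -1, -1, ?_, ?_⟩
      ⟨?_, 1, -1, ?_, ?_⟩ ⟨?_, 1, 1, ?_, ?_⟩, ?_⟩
  · fin_cases i <;> fin_cases j <;> simp [hV, pentagonEdges, affineValue] <;> norm_num
  · fin_cases i <;> simp [hV, pentagonEdges, affineValue] <;> norm_num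
  all_goals first
    | (simp [hV, pentagonEdges, affineValue]; norm_num)
    | (simp [hV, pentagonEdges, affineValue]; done)
    | (simp [Fin.sum_univ_succ]; norm_num)
    | norm_num [IsCoprime]

theorem hasPolygonalCycle_heptagon {D : ℝ} (h1 : 1 < D) (h2 : D < 2) :
    HasPolygonalCycle (boundaryPolygon D) 7 8 := by
  rw [boundaryPolygon_eq_heptagon h1]
  set V : Fin 7 → ℝ × ℝ := ![(1, -1), (1, 1), (-1, 1), (-D, 2 - D), (-D, D - 2), (D - 2, -D),
    (2 - D, -D)] with hV
  -- The lattice lengths depend on D, but their sum is always 8.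
  set m : Fin 7 → ℝ := ![2, 2, D - 1, 4 - 2 * D, 2 * D - 2, 4 - 2 * D, D - 1] with hm
  refine ⟨V, (isCyclicArrangement_heptagonEdges h1 h2).isPolygonalCycle (fun i j => ?_)
    (fun i => ?_)
    (forall_fin_seven_succ (Q := fun i j => affineValue (heptagonEdges D i) (V j) = 0)
      ?_ ?_ ?_ ?_ ?_ ?_ ?_)
    (forall_fin_seven_succ (Q := fun i j => V i ≠ V j) ?_ ?_ ?_ ?_ ?_ ?_ ?_),
    m, forall_fin_seven_succ (Q := fun i j => HasLatticeLength (V i) (V j) (m i))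
      ⟨?_, 0, 1, ?_, ?_⟩ ⟨?_, -1, 0, ?_, ?_⟩ ⟨?_, -1, -1, ?_, ?_⟩
      ⟨?_, 0, -1, ?_, ?_⟩ ⟨?_, 1, -1, ?_, ?_⟩ ⟨?_, 1, 0, ?_, ?_⟩ ⟨?_, 1, 1, ?_, ?_⟩, ?_⟩
  · fin_cases i <;> fin_cases j <;> simp [hV, heptagonEdges, affineValue] <;> linarith
  · fin_cases i <;> simp [hV, heptagonEdges, affineValue] <;> ring
  all_goals try rw [Prod.mk.injEq]
  all_goals first
    | (simp [hV, heptagonEdges, affineValue]; done)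
    | (simp [hV, heptagonEdges, affineValue]; ring; done)
    | (intro h
       have e1 := congrArg Prod.fst h
       have e2 := congrArg Prod.snd h
       simp [hV] at e1 e2
       linarith)
    | (simp [hm]; done)
    | (simp [hm]; linarith)
    | (simp [hV, hm]; done)
    | (simp [hV, hm]; norm_num; done)
    | (simp [hV, hm]; ring; done)
    | (simp [hV, hm]; constructor <;> ring)
    | (simp [hm, Fin.sum_univ_succ]; ring)
    | norm_num [IsCoprime]

theorem isPolygonalCycle_square {D : ℝ} (h : -1 < D) (h1 : D ≤ 1) :
    IsPolygonalCycle (boundaryPolygon D) ![(1, -D), (1, 1), (-D, 1), (-D, -D)] := by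
  rw [boundaryPolygon_eq_square h1]
  set V : Fin 4 → ℝ × ℝ := ![(1, -D), (1, 1), (-D, 1), (-D, -D)] with hV
  refine (isCyclicArrangement_squareEdges h).isPolygonalCycle (fun i j => ?_)
    (fun i => ?_)
    (forall_fin_four_succ (Q := fun i j => affineValue (squareEdges D i) (V j) = 0)
      ?_ ?_ ?_ ?_)
    (forall_fin_four_succ (Q := fun i j => V i ≠ V j) ?_ ?_ ?_ ?_)
  · fin_cases i <;> fin_cases j <;> simp [hV, squareEdges, affineValue] <;> linarith
  · fin_cases i <;> simp [hV, squareEdges, affineValue]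
  all_goals first
    | (simp [hV, squareEdges, affineValue]; done)
    | (intro h
       have e1 := congrArg Prod.fst h
       have e2 := congrArg Prod.snd h
       simp [hV] at e1 e2
       linarith)

theorem hasSquareCycle_square {D : ℝ} (h : -1 < D) (h1 : D ≤ 1) :
    HasSquareCycle (boundaryPolygon D) (4 * (D + 1)) := by
  refine ⟨_, isPolygonalCycle_square h h1, ⟨?_, ?_, ?_⟩, fun _ => D + 1,
    forall_fin_four_succ (Q := fun i j => HasLatticeLength
      ((![(1, -D), (1, 1), (-D, 1), (-D, -D)] : Fin 4 → ℝ × ℝ) i)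
      ((![(1, -D), (1, 1), (-D, 1), (-D, -D)] : Fin 4 → ℝ × ℝ) j) (D + 1))
      ⟨?_, 0, 1, ?_, ?_⟩ ⟨?_, -1, 0, ?_, ?_⟩ ⟨?_, 0, -1, ?_, ?_⟩ ⟨?_, 1, 0, ?_, ?_⟩, ?_⟩
  all_goals first
    | linarith
    | (simp [IsCoprime]; done)
    | (simp; linarith)
    | norm_num [IsCoprime]

/-- Quadrilateral cycles in the boundary of the square have the perimeter of the square. -/
theorem perimeter_eq_of_square {D l : ℝ} (h : -1 < D) (h1 : D ≤ 1) {p : Fin 4 → ℝ × ℝ}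
    (hp : IsPolygonalCycle (boundaryPolygon D) p) (hl : HasPerimeter p l) : l = 4 * (D + 1) := by
  rw [boundaryPolygon_eq_square h1] at hp
  obtain ⟨e, -, h0, hs, hadj⟩ := (isCyclicArrangement_squareEdges h).exists_edges hp
  have hedge : ∀ (a : Fin 4) (P : ℝ × ℝ), affineValue (squareEdges D a) P = 0 →
      (a = 0 ∧ P.1 = 1) ∨ (a = 1 ∧ P.2 = 1) ∨ (a = 2 ∧ P.1 = -D) ∨ (a = 3 ∧ P.2 = -D) := by
    intro a P hP
    fin_cases a <;> simp [squareEdges, affineValue] at hP ⊢ <;> linarith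
  have hcorner : ∀ i, ((p (i + 1)).1 = 1 ∨ (p (i + 1)).1 = -D) ∧
      ((p (i + 1)).2 = 1 ∨ (p (i + 1)).2 = -D) := by
    intro i
    have k := hadj i
    rcases hedge _ _ (hs i) with ⟨a, b⟩ | ⟨a, b⟩ | ⟨a, b⟩ | ⟨a, b⟩ <;>
    rcases hedge _ _ (h0 (i + 1)) with ⟨a', b'⟩ | ⟨a', b'⟩ | ⟨a', b'⟩ | ⟨a', b'⟩ <;>
    first
    | exact ⟨Or.inl b, Or.inl b'⟩
    | exact ⟨Or.inl b, Or.inr b'⟩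
    | exact ⟨Or.inr b, Or.inl b'⟩
    | exact ⟨Or.inr b, Or.inr b'⟩
    | exact ⟨Or.inl b', Or.inl b⟩
    | exact ⟨Or.inl b', Or.inr b⟩
    | exact ⟨Or.inr b', Or.inl b⟩
    | exact ⟨Or.inr b', Or.inr b⟩
    | (rw [a, a'] at k; exact absurd k (by decide))
  have hcorner' : ∀ i, ((p i).1 = 1 ∨ (p i).1 = -D) ∧ ((p i).2 = 1 ∨ (p i).2 = -D) := fun i => by
    have := hcorner (i - 1)
    rwa [sub_add_cancel] at this
  have hshare : ∀ i, (p i).1 = (p (i + 1)).1 ∨ (p i).2 = (p (i + 1)).2 := by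
    intro i
    rcases hedge _ _ (h0 i) with ⟨a, b⟩ | ⟨a, b⟩ | ⟨a, b⟩ | ⟨a, b⟩ <;>
    rcases hedge _ _ (hs i) with ⟨a', b'⟩ | ⟨a', b'⟩ | ⟨a', b'⟩ | ⟨a', b'⟩ <;>
    first
    | exact Or.inl (b.trans b'.symm)
    | exact Or.inr (b.trans b'.symm)
    | (rw [a] at a'; exact absurd a' (by decide))
  have habs : ∀ x y : ℝ, (x = 1 ∨ x = -D) → (y = 1 ∨ y = -D) → x ≠ y → |y - x| = D + 1 := by
    rintro x y (rfl | rfl) (rfl | rfl) hne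
    · exact absurd rfl hne
    · rw [abs_of_neg] <;> linarith
    · rw [abs_of_pos] <;> linarith
    · exact absurd rfl hne
  -- A primitive integer vector parallel to an axis is a unit vector up to sign, so lattice length
  -- equals Euclidean length on the sides of the square.
  have hunit : ∀ (m : ℝ) (a : ℤ), 0 ≤ m → IsCoprime a 0 → |m * a| = m := by
    intro m a hm ha
    rw [isCoprime_zero_right, Int.isUnit_iff] at ha
    rcases ha with rfl | rfl <;> simp [abs_of_nonneg hm]
  obtain ⟨m, hm, rfl⟩ := hl
  have hside : ∀ i, m i = D + 1 := by
    intro i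
    obtain ⟨hm0, a, b, hab, hd⟩ := hm i
    have d1 := congrArg Prod.fst hd
    have d2 := congrArg Prod.snd hd
    simp only [Prod.fst_sub, Prod.snd_sub] at d1 d2
    have hne := hp.1.ne_succ i
    rcases hshare i with hx | hx
    · have hy : (p i).2 ≠ (p (i + 1)).2 := fun h => hne (Prod.ext hx h)
      have e := habs _ _ (hcorner' i).2 (hcorner i).2 hy
      rw [← hx, sub_self] at d1
      rcases mul_eq_zero.1 d1.symm with h3 | h3
      · rw [d2, h3] at e
        simp at e
        linarith
      · rw [Int.cast_eq_zero.1 h3] at hab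
        rw [d2, hunit _ _ hm0 hab.symm] at e
        exact e
    · have hy : (p i).1 ≠ (p (i + 1)).1 := fun h => hne (Prod.ext h hx)
      have e := habs _ _ (hcorner' i).1 (hcorner i).1 hy
      rw [← hx, sub_self] at d2
      rcases mul_eq_zero.1 d2.symm with h3 | h3
      · rw [d1, h3] at e
        simp at e
        linarith
      · rw [Int.cast_eq_zero.1 h3] at hab
        rw [d1, hunit _ _ hm0 hab] at e
        exact e
  simp [hside]
  ring

/-! ### Translations -/

section Translation

variable {n : ℕ} [NeZero n] {p : Fin n → ℝ × ℝ} (w : ℝ × ℝ)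

theorem segment_translate (P Q : ℝ × ℝ) :
    segment ℝ (w + P) (w + Q) = (fun z => w + z) '' segment ℝ P Q :=
  (segment_translate_image ℝ w P Q).symm

theorem mem_segment_translate {P Q z : ℝ × ℝ} :
    z ∈ segment ℝ (w + P) (w + Q) ↔ z - w ∈ segment ℝ P Q := by
  rw [segment_translate]
  constructor
  · rintro ⟨z, hz, rfl⟩
    simpa using hz
  · intro h
    exact ⟨z - w, h, by simp⟩

theorem IsSimplePolygon.translate (hp : IsSimplePolygon p) :
    IsSimplePolygon fun i => w + p i := by
  refine ⟨hp.1, fun i hc => hp.2.1 i ?_, fun i => ?_, fun i j h1 h2 h3 => ?_⟩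
  · rw [collinear_iff_of_mem (p₀ := w + p i) (by simp)] at hc
    rw [collinear_iff_of_mem (p₀ := p i) (by simp)]
    obtain ⟨v, hv⟩ := hc
    refine ⟨v, fun z hz => ?_⟩
    obtain ⟨r, hr⟩ := hv (w + z) (by
      rcases hz with rfl | rfl | rfl <;> simp)
    refine ⟨r, add_left_cancel (a := w) ?_⟩
    rw [hr, vadd_eq_add, vadd_eq_add]
    abel
  · ext z
    rw [Set.mem_inter_iff, mem_segment_translate, mem_segment_translate, ← Set.mem_inter_iff,
      hp.2.2.1 i, Set.mem_singleton_iff, Set.mem_singleton_iff, sub_eq_iff_eq_add']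
  · rw [Set.disjoint_left]
    intro z hz hz'
    rw [mem_segment_translate] at hz hz'
    exact Set.disjoint_left.1 (hp.2.2.2 i j h1 h2 h3) hz hz'

theorem isPolygonalCycle_translate_iff {C : Set (ℝ × ℝ)} :
    IsPolygonalCycle C (fun i => w + p i) ↔ IsPolygonalCycle {P | w + P ∈ C} p := by
  have hs : IsSimplePolygon (fun i => w + p i) ↔ IsSimplePolygon p := by
    refine ⟨fun h => ?_, fun h => h.translate w⟩
    have := h.translate (-w)
    simpa using this
  refine and_congr hs (forall_congr' fun i => ?_)
  simp only [segment_translate, Set.image_subset_iff]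
  rfl

theorem hasPerimeter_translate_iff {l : ℝ} :
    HasPerimeter (fun i => w + p i) l ↔ HasPerimeter p l := by
  simp only [HasPerimeter, HasLatticeLength, add_sub_add_left_eq_sub]

theorem isSquareShape_translate_iff {p : Fin 4 → ℝ × ℝ} :
    IsSquareShape (fun i => w + p i) ↔ IsSquareShape p := by
  simp only [IsSquareShape, add_sub_add_left_eq_sub]

end Translation

end TropEdwards

namespace TropEdwards

/-! ### The Euler product -/

section EulerProduct

variable {K : Type*} [NontriviallyNormedField K] [IsUltrametricDist K]

/-- `a` and `b` are the parts of the product even and odd in q. A factor with even exponent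
preserves the parity and one with odd exponent mixes the two parts; after the first factor every
change has norm at most ‖q‖². Tracking the parts separately avoids estimating a difference and then
dividing by 2, which would lose a factor in residue characteristic 2. -/
theorem exists_partialProduct_eq {q : K} (hq1 : ‖q‖ < 1) (N : ℕ) : ∃ a b : K,
    ∏ n ∈ Finset.range (N + 1), (1 + q ^ (n + 1)) = a + b ∧
    ∏ n ∈ Finset.range (N + 1), (1 + (-q) ^ (n + 1)) = a - b ∧
    ‖a - 1‖ ≤ ‖q‖ ^ 2 ∧ ‖b - q‖ ≤ ‖q‖ ^ 2 := by
  induction N with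
  | zero => exact ⟨1, q, by simp, by simp [sub_eq_add_neg], by simp, by simp⟩
  | succ N ih =>
    obtain ⟨a, b, h1, h2, h3, h4⟩ := ih
    have hpow : ‖q ^ (N + 1 + 1)‖ ≤ ‖q‖ ^ 2 := by
      rw [norm_pow]
      exact pow_le_pow_of_le_one (norm_nonneg q) hq1.le (by omega)
    have hsq : ‖q‖ ^ 2 ≤ 1 := pow_le_one₀ (norm_nonneg q) hq1.le
    have ha : ‖a‖ ≤ 1 := by
      have := IsUltrametricDist.norm_add_le_max (a - 1) 1
      rw [sub_add_cancel, norm_one] at this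
      exact this.trans (max_le (h3.trans hsq) le_rfl)
    have hb : ‖b‖ ≤ 1 := by
      have := IsUltrametricDist.norm_add_le_max (b - q) q
      rw [sub_add_cancel] at this
      exact this.trans (max_le (h4.trans hsq) hq1.le)
    have step : ∀ z w c : K, ‖w‖ ≤ 1 → ‖z - c‖ ≤ ‖q‖ ^ 2 →
        ‖z + w * q ^ (N + 1 + 1) - c‖ ≤ ‖q‖ ^ 2 := by
      intro z w c hw hz
      rw [show z + w * q ^ (N + 1 + 1) - c = (z - c) + w * q ^ (N + 1 + 1) by ring]
      refine (IsUltrametricDist.norm_add_le_max _ _).trans (max_le hz ?_)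
      rw [norm_mul]
      calc ‖w‖ * ‖q ^ (N + 1 + 1)‖ ≤ 1 * ‖q ^ (N + 1 + 1)‖ := by gcongr
        _ ≤ ‖q‖ ^ 2 := by rwa [one_mul]
    rcases Nat.even_or_odd (N + 1 + 1) with he | ho
    · refine ⟨a + a * q ^ (N + 1 + 1), b + b * q ^ (N + 1 + 1), ?_, ?_, step _ _ _ ha h3,
        step _ _ _ hb h4⟩
      · rw [Finset.prod_range_succ, h1]; ring
      · rw [Finset.prod_range_succ, h2, he.neg_pow]; ring
    · refine ⟨a + b * q ^ (N + 1 + 1), b + a * q ^ (N + 1 + 1), ?_, ?_, step _ _ _ hb h3,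
        step _ _ _ ha h4⟩
      · rw [Finset.prod_range_succ, h1]; ring
      · rw [Finset.prod_range_succ, h2, ho.neg_pow]; ring

/-- The even part of the Euler product is a unit, and its odd part has the same absolute value
as `q`. -/
theorem exists_eps_eq [CompleteSpace K] [CharZero K] {q : K} (hq0 : q ≠ 0) (hq1 : ‖q‖ < 1) :
    ∃ x y : K, eps q = x + y ∧ eps (-q) = x - y ∧ ‖x‖ = 1 ∧ ‖y‖ = ‖q‖ := by
  have lim : ∀ q : K, ‖q‖ < 1 → Filter.Tendsto
      (fun N => ∏ n ∈ Finset.range (N + 1), (1 + q ^ (n + 1))) Filter.atTop (nhds (eps q)) :=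
    fun q h => (Filter.tendsto_add_atTop_iff_nat 1).2
      (multipliable_eps q h).hasProd.tendsto_prod_nat
  have l1 := lim q hq1
  have l2 := lim (-q) (by rwa [norm_neg])
  have h2 : (2 : K) ≠ 0 := two_ne_zero
  have hqpos : 0 < ‖q‖ := norm_pos_iff.2 hq0
  have hsq : ‖q‖ ^ 2 < ‖q‖ := by nlinarith
  -- Half the sum of the partial products is exactly `a`, so its bound passes to the limit with no
  -- factor ‖2‖.
  have hx : ‖(eps q + eps (-q)) / 2 - 1‖ ≤ ‖q‖ ^ 2 := by
    refine le_of_tendsto (((l1.add l2).div_const 2).sub_const 1).norm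
      (Filter.Eventually.of_forall fun N => ?_)
    obtain ⟨a, b, e1, e2, e3, -⟩ := exists_partialProduct_eq hq1 N
    rw [e1, e2]
    rwa [show (a + b + (a - b)) / 2 = a by ring]
  have hy : ‖(eps q - eps (-q)) / 2 - q‖ ≤ ‖q‖ ^ 2 := by
    refine le_of_tendsto (((l1.sub l2).div_const 2).sub_const q).norm
      (Filter.Eventually.of_forall fun N => ?_)
    obtain ⟨a, b, e1, e2, -, e4⟩ := exists_partialProduct_eq hq1 N
    rw [e1, e2]
    rwa [show (a + b - (a - b)) / 2 = b by ring]
  have hdom : ∀ z w : K, ‖z - w‖ < ‖w‖ → ‖z‖ = ‖w‖ := by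
    intro z w h
    have := IsUltrametricDist.norm_add_eq_max_of_norm_ne_norm h.ne
    rwa [sub_add_cancel, max_eq_right h.le] at this
  refine ⟨(eps q + eps (-q)) / 2, (eps q - eps (-q)) / 2, by field_simp; ring,
    by field_simp; ring, ?_, hdom _ _ (hy.trans_lt hsq)⟩
  rw [hdom _ 1 (by rw [norm_one]; exact hx.trans_lt (hsq.trans hq1)), norm_one]

end EulerProduct

/-! ### Properties of the valuation -/

section Valuation

variable {K : Type*} [NontriviallyNormedField K] [IsUltrametricDist K] [CompleteSpace K]
  {L : Type*} [Field L] [Algebra K L] [Algebra.IsAlgebraic K L] {q : K}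

theorem spectralNorm_pos {x : L} (hx : x ≠ 0) : 0 < spectralNorm K L x :=
  spectralNorm_zero_lt hx (Algebra.IsAlgebraic.isAlgebraic x)

theorem val_eq_coe {x : L} (hx : x ≠ 0) :
    val L q x = ((Real.log (spectralNorm K L x) / Real.log ‖q‖ : ℝ) : EReal) := if_neg hx

theorem val_ne_bot (x : L) : val L q x ≠ ⊥ := by
  by_cases hx : x = 0
  · rw [hx, val_zero]; exact top_ne_bot
  · rw [val_eq_coe hx]; exact EReal.coe_ne_bot _

theorem val_eq_top_iff {x : L} : val L q x = ⊤ ↔ x = 0 := by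
  refine ⟨fun h => by_contra fun hx => ?_, fun h => h ▸ val_zero L q⟩
  rw [val_eq_coe hx] at h
  exact EReal.coe_ne_top _ h

theorem val_mul (x y : L) : val L q (x * y) = val L q x + val L q y := by
  by_cases hx : x = 0
  · rw [hx, zero_mul, val_zero, EReal.top_add_of_ne_bot (val_ne_bot y)]
  by_cases hy : y = 0
  · rw [hy, mul_zero, val_zero, EReal.add_top_of_ne_bot (val_ne_bot x)]
  have h := spectralAlgNorm_mul (K := K) x y
  rw [spectralAlgNorm_def, spectralAlgNorm_def, spectralAlgNorm_def] at h
  rw [val_eq_coe hx, val_eq_coe hy, val_eq_coe (mul_ne_zero hx hy), h,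
    Real.log_mul (spectralNorm_pos hx).ne' (spectralNorm_pos hy).ne', add_div, EReal.coe_add]

theorem val_neg (x : L) : val L q (-x) = val L q x := by
  by_cases hx : x = 0
  · rw [hx, neg_zero]
  · rw [val_eq_coe hx, val_eq_coe (neg_ne_zero.2 hx),
      spectralNorm_neg (Algebra.IsAlgebraic.isAlgebraic x)]

variable (hq0 : q ≠ 0) (hq1 : ‖q‖ < 1)
include hq0 hq1

theorem val_le_val_iff {x y : L} :
    val L q x ≤ val L q y ↔ spectralNorm K L y ≤ spectralNorm K L x := by
  have hlog : Real.log ‖q‖ < 0 := Real.log_neg (norm_pos_iff.2 hq0) hq1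
  by_cases hy : y = 0
  · rw [hy, val_zero, spectralNorm_zero]
    exact iff_of_true le_top (spectralNorm_nonneg _)
  by_cases hx : x = 0
  · rw [hx, val_zero, spectralNorm_zero, top_le_iff, val_eq_top_iff]
    exact iff_of_false hy (spectralNorm_pos hy).not_ge
  · rw [val_eq_coe hx, val_eq_coe hy, EReal.coe_le_coe_iff, div_le_div_right_of_neg hlog,
      Real.log_le_log_iff (spectralNorm_pos hy) (spectralNorm_pos hx)]

theorem min_val_le_val_add (x y : L) : min (val L q x) (val L q y) ≤ val L q (x + y) := by
  have h := isNonarchimedean_spectralNorm (K := K) (L := L) x y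
  rw [min_le_iff, val_le_val_iff hq0 hq1, val_le_val_iff hq0 hq1]
  exact le_max_iff.1 h

theorem val_add_eq_left {x y : L} (h : val L q x < val L q y) :
    val L q (x + y) = val L q x := by
  have h1 := min_val_le_val_add hq0 hq1 x y
  rw [min_eq_left h.le] at h1
  refine le_antisymm ?_ h1
  have h2 := min_val_le_val_add hq0 hq1 (x + y) (-y)
  rw [add_neg_cancel_right, val_neg] at h2
  exact (min_le_iff.1 h2).resolve_right h.not_ge

theorem val_add_eq_right {x y : L} (h : val L q y < val L q x) :
    val L q (x + y) = val L q y := by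
  rw [add_comm, val_add_eq_left hq0 hq1 h]

omit hq0 hq1 in
theorem val_algebraMap_of_norm_eq_one {x : K} (hx : ‖x‖ = 1) :
    val L q (algebraMap K L x) = 0 := by
  rw [val_algebraMap L q x (by rintro rfl; simp at hx), hx, Real.log_one, zero_div, EReal.coe_zero]

theorem val_algebraMap_of_norm_eq {x : K} (hx : ‖x‖ = ‖q‖) :
    val L q (algebraMap K L x) = 1 := by
  have h0 : x ≠ 0 := by
    rintro rfl
    rw [norm_zero] at hx
    exact hq0 (norm_eq_zero.1 hx.symm)
  rw [val_algebraMap L q x h0, hx, div_self (Real.log_neg (norm_pos_iff.2 hq0) hq1).ne]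
  rfl

/-- Needed because residue characteristic 2 or 3 is allowed: the integer constants in the
coefficients may have positive valuation, but never a negative one. -/
theorem val_natCast_nonneg (n : ℕ) : 0 ≤ val L q (n : L) := by
  have h1 : val L q (1 : L) = 0 := by
    have := val_algebraMap_of_norm_eq_one (L := L) (q := q) (x := (1 : K)) norm_one
    rwa [map_one] at this
  rw [← h1, val_le_val_iff hq0 hq1, spectralNorm_one]
  have h2 := spectralNorm_extends (K := K) (L := L) (n : K)
  rw [map_natCast] at h2
  rw [h2]
  exact IsUltrametricDist.norm_natCast_le_one K n

end Valuation

end TropEdwards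

namespace TropEdwards

/-! ### The valuations of the coefficients -/

section Coefficients

variable {K : Type*} [NontriviallyNormedField K] [IsUltrametricDist K] [CompleteSpace K]
  {L : Type*} [Field L] [Algebra K L] [Algebra.IsAlgebraic K L] {q : K}
  (hq0 : q ≠ 0) (hq1 : ‖q‖ < 1) {x y : L} {t : ℝ}
  (hx : val L q x = (0 : ℝ)) (hy : val L q y = (1 : ℝ)) (ht : val L q (2 : L) = t)

include hx in
theorem val_pow_eq_zero (n : ℕ) : val L q (x ^ n) = (0 : ℝ) := by
  induction n with
  | zero =>
    have := val_algebraMap_of_norm_eq_one (L := L) (q := q) (x := (1 : K)) norm_one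
    rw [map_one] at this
    rw [pow_zero, this, EReal.coe_zero]
  | succ n ih => rw [pow_succ, val_mul, ih, hx, ← EReal.coe_add, add_zero]

include hy in
theorem val_pow_eq (n : ℕ) : val L q (y ^ n) = (n : ℝ) := by
  induction n with
  | zero =>
    have := val_algebraMap_of_norm_eq_one (L := L) (q := q) (x := (1 : K)) norm_one
    rw [map_one] at this
    rw [pow_zero, this, Nat.cast_zero, EReal.coe_zero]
  | succ n ih => rw [pow_succ, val_mul, ih, hy, ← EReal.coe_add, Nat.cast_succ]

include hq0 hq1 hx in
theorem val_pow_add_eq_zero (n : ℕ) {z : L} (hz : (1 : ℝ) ≤ val L q z) :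
    val L q (x ^ n + z) = (0 : ℝ) := by
  have h := val_pow_eq_zero hx n
  rw [val_add_eq_left hq0 hq1, h]
  rw [h]
  exact lt_of_lt_of_le (EReal.coe_lt_coe_iff.2 one_pos) hz

include hq0 hq1 hx hy in
theorem val_unit_add : val L q (x ^ 2 + y ^ 2) = (0 : ℝ) :=
  val_pow_add_eq_zero hq0 hq1 hx 2 (by
    rw [val_pow_eq hy, EReal.coe_le_coe_iff]; norm_num)

include hq0 hq1 hx hy in
theorem val_unit_sub : val L q (x ^ 2 - y ^ 2) = (0 : ℝ) := by
  rw [sub_eq_add_neg]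
  exact val_pow_add_eq_zero hq0 hq1 hx 2 (by
    rw [val_neg, val_pow_eq hy, EReal.coe_le_coe_iff]; norm_num)

include hq0 hq1 hx hy ht in
-- Here ε⁴ - ε̄⁴ = 8xy(x² + y²) and εε̄ = x² - y². The factor 16 contributes 4t, the factor y
-- contributes 1, and x² ± y² are units.
theorem val_d12 (r s : L) : val L q (d12 (x + y) (x - y) r s) =
    ((4 * t + 1 : ℝ) : EReal) + val L q (x * (r - s) + y * (r + s)) := by
  rw [show d12 (x + y) (x - y) r s = 2 * (2 * (2 * 2)) * (x * y) * (x ^ 2 + y ^ 2) *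
    (x ^ 2 - y ^ 2) * -(x * (r - s) + y * (r + s)) by unfold d12; ring]
  simp only [val_mul, val_neg, val_unit_add hq0 hq1 hx hy, val_unit_sub hq0 hq1 hx hy, hx, hy, ht,
    ← EReal.coe_add]
  ring_nf

include hq0 hq1 hx hy ht in
theorem val_d34 (r s : L) : val L q (d34 (x + y) (x - y) r s) =
    ((3 * t + 1 : ℝ) : EReal) + val L q (x * (r - s) + y * (r + s)) +
      val L q (x * (r + s) + y * (r - s)) := by
  rw [show d34 (x + y) (x - y) r s = (2 * (2 * 2)) * (x * y) * (x ^ 2 + y ^ 2) *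
    -(x * (r - s) + y * (r + s)) * (x * (r + s) + y * (r - s)) by unfold d34; ring]
  simp only [val_mul, val_neg, val_unit_add hq0 hq1 hx hy, hx, hy, ht, ← EReal.coe_add]
  ring_nf

include hq0 hq1 hx hy ht in
theorem val_d5 (r s : L) : val L q (d5 (x + y) (x - y) r s) =
    ((3 * t : ℝ) : EReal) + val L q (x * (r - s) + y * (r + s)) +
      val L q (x * (x ^ 2 + 3 * y ^ 2) * (r - s) - y * (3 * x ^ 2 + y ^ 2) * (r + s)) := by
  rw [show d5 (x + y) (x - y) r s = (2 * (2 * 2)) * (x ^ 2 - y ^ 2) *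
    (x * (r - s) + y * (r + s)) *
    (x * (x ^ 2 + 3 * y ^ 2) * (r - s) - y * (3 * x ^ 2 + y ^ 2) * (r + s)) by unfold d5; ring]
  rw [val_mul, val_mul _ (x * (r - s) + y * (r + s))]
  simp only [val_mul _ (x ^ 2 - y ^ 2), val_mul (2 : L), val_unit_sub hq0 hq1 hx hy, ht,
    ← EReal.coe_add]
  ring_nf

include ht in
-- The bracket is arranged so that its first term is a unit times (r + s)(r - s), the expected
-- leading term; the other two carry a factor y and a factor 2.
theorem val_d67 (r s : L) : val L q (d67 (x + y) (x - y) r s) =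
    ((2 * t : ℝ) : EReal) + val L q (x * (r - s) + y * (r + s)) +
      val L q ((x ^ 2 - y ^ 2) * (x ^ 2 + y ^ 2) * ((r + s) * (r - s)) +
        (2 * (x * y ^ 3 * ((r - s) * (r - s))) - 2 * (x ^ 3 * y * ((r + s) * (r + s))))) := by
  rw [show d67 (x + y) (x - y) r s = (2 * 2) * (x * (r - s) + y * (r + s)) *
    ((x ^ 2 - y ^ 2) * (x ^ 2 + y ^ 2) * ((r + s) * (r - s)) +
        (2 * (x * y ^ 3 * ((r - s) * (r - s))) - 2 * (x ^ 3 * y * ((r + s) * (r + s))))) by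
    unfold d67; ring]
  rw [val_mul, val_mul, val_mul (2 : L), ht, ← EReal.coe_add]
  ring_nf

include ht in
theorem val_d8 (r s : L) : val L q (d8 (x + y) (x - y) r s) =
    (t : EReal) + val L q (x * (r - s) + y * (r + s)) +
      (val L q (x * (r - s) + -(y * (r + s))) + (val L q (x * (r + s) + -(y * (r - s))) +
      val L q (x * (r + s) + y * (r - s)))) := by
  rw [show d8 (x + y) (x - y) r s = 2 * (x * (r - s) + y * (r + s)) *
    ((x * (r - s) + -(y * (r + s))) * ((x * (r + s) + -(y * (r - s))) *
      (x * (r + s) + y * (r - s)))) by unfold d8; ring]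
  simp only [val_mul _ (_ * _), val_mul (2 : L), val_mul (_ + _), ht]

include hq0 hq1 in
theorem le_val_add {z w : L} {c : EReal} (hz : c ≤ val L q z) (hw : c ≤ val L q w) :
    c ≤ val L q (z + w) :=
  (le_min hz hw).trans (min_val_le_val_add hq0 hq1 z w)

include hq0 hq1 in
theorem val_ofNat_mul_nonneg {n : ℕ} {z : L} {c : ℝ} (hz : (c : EReal) ≤ val L q z) :
    (c : EReal) ≤ val L q ((n : L) * z) := by
  rw [val_mul]
  exact le_add_of_nonneg_of_le (val_natCast_nonneg hq0 hq1 n) hz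

include hq0 hq1 hx hy in
theorem val_cubic_left (z : L) : val L q (x * (x ^ 2 + 3 * y ^ 2) * z) = val L q z := by
  have h : val L q (x ^ 2 + 3 * y ^ 2) = (0 : ℝ) := by
    refine val_pow_add_eq_zero hq0 hq1 hx 2 ?_
    have := val_ofNat_mul_nonneg hq0 hq1 (n := 3) (z := y ^ 2) (c := 1) (by
      rw [val_pow_eq hy, EReal.coe_le_coe_iff]; norm_num)
    exact_mod_cast this
  rw [val_mul, val_mul, h, hx, ← EReal.coe_add, add_zero, EReal.coe_zero, zero_add]

include hq0 hq1 hx hy in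
theorem le_val_cubic_right {z : L} {c : EReal} (hz : c ≤ val L q z) :
    ((1 : ℝ) : EReal) + c ≤ val L q (y * (3 * x ^ 2 + y ^ 2) * z) := by
  have h : ((0 : ℝ) : EReal) ≤ val L q (3 * x ^ 2 + y ^ 2) := by
    refine le_val_add hq0 hq1 ?_ ?_
    · have := val_ofNat_mul_nonneg hq0 hq1 (n := 3) (z := x ^ 2) (c := 0) (by
        rw [val_pow_eq_zero hx])
      exact_mod_cast this
    · rw [val_pow_eq hy, EReal.coe_le_coe_iff]; norm_num
  rw [val_mul, val_mul, hy]
  refine add_le_add ?_ hz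
  calc ((1 : ℝ) : EReal) = ((1 : ℝ) : EReal) + ((0 : ℝ) : EReal) := by
        rw [EReal.coe_zero, add_zero]
    _ ≤ _ := add_le_add le_rfl h

section NormalForm

variable {D β : ℝ} {A : EReal} (hD : -1 < D) (hD2 : D ≤ 2) (hA : ((D + β : ℝ) : EReal) ≤ A)
  (hA' : D < 2 → A = ((D + β : ℝ) : EReal))

include hq0 hq1 hA hA' in
-- The two terms have valuations v(r + s) and 1 + v(r - s), which coincide exactly when δ = 1. Only
-- then can cancellation occur, leaving just a lower bound.
theorem val_add_normal_form {z w : L} (hz : val L q z = A) (hw : val L q w = ((1 + β : ℝ) : EReal)) :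
    ((min D 1 + β : ℝ) : EReal) ≤ val L q (z + w) ∧
      (D ≠ 1 → val L q (z + w) = ((min D 1 + β : ℝ) : EReal)) := by
  constructor
  · refine le_val_add hq0 hq1 ?_ ?_
    · rw [hz]
      exact (EReal.coe_le_coe_iff.2 (by linarith [min_le_left D 1])).trans hA
    · rw [hw, EReal.coe_le_coe_iff]
      linarith [min_le_right D 1]
  · intro hne
    rcases lt_or_gt_of_ne hne with h | h
    · rw [min_eq_left h.le]
      have hz' := hz.trans (hA' (by linarith))
      rw [val_add_eq_left hq0 hq1, hz']
      rw [hz', hw, EReal.coe_lt_coe_iff]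
      linarith
    · rw [min_eq_right h.le]
      rw [val_add_eq_right hq0 hq1, hw]
      rw [hw, hz]
      exact (EReal.coe_lt_coe_iff.2 (by linarith)).trans_le hA

include hq0 hq1 hx hy ht hD hD2 hA hA' in
/-- The polygonal cycles of the tropical curve for `δ > -1`. -/
theorem isPolygonalCycle_tropPoly_iff (ht0 : 0 ≤ t) {r s : L} (ha : val L q (r + s) = A)
    (hb : val L q (r - s) = β) {n : ℕ} [NeZero n] {p : Fin n → ℝ × ℝ} :
    IsPolygonalCycle {P | ¬ DifferentiableAt ℝ (tropPoly (val L q (d12 (x + y) (x - y) r s))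
      (val L q (d34 (x + y) (x - y) r s)) (val L q (d5 (x + y) (x - y) r s))
      (val L q (d67 (x + y) (x - y) r s)) (val L q (d8 (x + y) (x - y) r s))) P} p ↔
    IsPolygonalCycle {P | P - (t - β, t - β) ∈ boundaryPolygon D} p := by
  have hxz : ∀ z : L, val L q (x * z) = val L q z := fun z => by
    rw [val_mul, hx, EReal.coe_zero, zero_add]
  -- This is where δ > -1 enters: a term in r - s with unit coefficient dominates y(r + s).
  have hyA : ((β : ℝ) : EReal) < ((1 : ℝ) : EReal) + A := by
    refine lt_of_lt_of_le ?_ (add_le_add_right hA _)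
    rw [← EReal.coe_add, EReal.coe_lt_coe_iff]
    linarith
  have hyb : val L q (y * (r - s)) = ((1 + β : ℝ) : EReal) := by
    rw [val_mul, hy, hb, EReal.coe_add]
  have hya : val L q (y * (r + s)) = ((1 : ℝ) : EReal) + A := by rw [val_mul, hy, ha]
  have hk : val L q (x * (r - s) + y * (r + s)) = β := by
    rw [val_add_eq_left hq0 hq1, hxz, hb]
    rw [hxz, hya, hb]; exact hyA
  have hk' : val L q (x * (r - s) + -(y * (r + s))) = β := by
    rw [val_add_eq_left hq0 hq1, hxz, hb]
    rw [val_neg, hxz, hya, hb]; exact hyA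
  have h5 : val L q (x * (x ^ 2 + 3 * y ^ 2) * (r - s) - y * (3 * x ^ 2 + y ^ 2) * (r + s)) = β := by
    rw [sub_eq_add_neg, val_add_eq_left hq0 hq1, val_cubic_left hq0 hq1 hx hy, hb]
    rw [val_neg, val_cubic_left hq0 hq1 hx hy, hb]
    exact hyA.trans_le (le_val_cubic_right hq0 hq1 hx hy ha.ge)
  have hp := val_add_normal_form hq0 hq1 hA hA' ((hxz (r + s)).trans ha) hyb
  have hm := val_add_normal_form hq0 hq1 hA hA' ((hxz (r + s)).trans ha)
    ((val_neg (y * (r - s))).trans hyb)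
  set V := val L q (x * (r + s) + y * (r - s)) with hV
  set V' := val L q (x * (r + s) + -(y * (r - s))) with hV'
  set W := val L q ((x ^ 2 - y ^ 2) * (x ^ 2 + y ^ 2) * ((r + s) * (r - s)) +
    (2 * (x * y ^ 3 * ((r - s) * (r - s))) - 2 * (x ^ 3 * y * ((r + s) * (r + s))))) with hW
  have hT1 : val L q ((x ^ 2 - y ^ 2) * (x ^ 2 + y ^ 2) * ((r + s) * (r - s))) = A + β := by
    simp only [val_mul, val_unit_add hq0 hq1 hx hy, val_unit_sub hq0 hq1 hx hy, ha, hb,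
      EReal.coe_zero, zero_add]
  have hT1le : ((D + 2 * β : ℝ) : EReal) ≤ A + β := by
    refine le_trans ?_ (add_le_add_left hA (β : EReal))
    rw [← EReal.coe_add, EReal.coe_le_coe_iff]
    linarith
  -- The factor y³ contributes 3, which exceeds D because D ≤ 2. In `hT3` the bound is t + 1 + 2D +
  -- 2β, which exceeds D + 2β because D > -1.
  have hT2 : ((D + 2 * β : ℝ) : EReal) < val L q (2 * (x * y ^ 3 * ((r - s) * (r - s)))) := by
    simp only [val_mul, val_pow_eq hy, hx, hb, ht, ← EReal.coe_add, EReal.coe_lt_coe_iff]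
    push_cast
    linarith
  have hT3 : ((D + 2 * β : ℝ) : EReal) < val L q (-(2 * (x ^ 3 * y * ((r + s) * (r + s))))) := by
    simp only [val_neg, val_mul, val_pow_eq_zero hx, hy, ha, ht]
    refine lt_of_lt_of_le ?_ (add_le_add_right (add_le_add_right (add_le_add hA hA) _) _)
    simp only [← EReal.coe_add, EReal.coe_lt_coe_iff]
    linarith
  have hT23 : ((D + 2 * β : ℝ) : EReal) < val L q (2 * (x * y ^ 3 * ((r - s) * (r - s))) -
      2 * (x ^ 3 * y * ((r + s) * (r + s)))) := by
    rw [sub_eq_add_neg]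
    exact (lt_min hT2 hT3).trans_le (min_val_le_val_add hq0 hq1 _ _)
  have hWle : ((D + 2 * β : ℝ) : EReal) ≤ W := le_val_add hq0 hq1 (hT1 ▸ hT1le) hT23.le
  have hWeq : D < 2 → W = ((D + 2 * β : ℝ) : EReal) := by
    intro h
    have e : A + β = ((D + 2 * β : ℝ) : EReal) := by
      rw [hA' h, ← EReal.coe_add]; ring_nf
    rw [hW, val_add_eq_left hq0 hq1, hT1, e]
    rw [hT1, e]; exact hT23
  have shift : ∀ {b c d : ℝ} {z : EReal}, (b : EReal) ≤ z → b + d = c →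
      (c : EReal) ≤ z + (d : EReal) := by
    rintro b c d z h rfl
    rw [EReal.coe_add]
    exact add_le_add_left h _
  have split : ∀ {b c d : ℝ} (z : EReal), b = c + d →
      (b : EReal) + z = (c : EReal) + (z + (d : EReal)) := by
    rintro b c d z rfl
    rw [EReal.coe_add, add_comm z, add_assoc]
  -- These values solve k + 1 - c = u12 = 4t + 1 + β and k - 2c = u5 = 3t + 2β.
  refine isPolygonalCycle_iff_boundaryPolygon (k := 5 * t) (c := t - β) (D := D)
    (a := V + ((-β : ℝ) : EReal)) (o := W + ((-2 * β : ℝ) : EReal))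
    (g := V' + V + ((-2 * β : ℝ) : EReal)) hD hD2 (shift hp.1 (by ring)) (fun h => ?_)
    (shift hWle (by ring)) (fun h => ?_) (shift (b := 2 * min D 1 + 2 * β) ?_ (by ring))
    (fun h => ?_) ?_ ?_ ?_ ?_ ?_
  · rw [hp.2 h, ← EReal.coe_add]; ring_nf
  · rw [hWeq h, ← EReal.coe_add]; ring_nf
  · refine le_trans (le_of_eq ?_) (add_le_add hm.1 hp.1)
    rw [← EReal.coe_add]; ring_nf
  · rw [hm.2 h, hp.2 h, ← EReal.coe_add, ← EReal.coe_add]; ring_nf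
  · rw [val_d12 hq0 hq1 hx hy ht, hk, ← EReal.coe_add]; ring_nf
  · rw [val_d5 hq0 hq1 hx hy ht, hk, h5, ← EReal.coe_add, ← EReal.coe_add]; ring_nf
  · rw [val_d34 hq0 hq1 hx hy ht, hk, ← EReal.coe_add]
    exact split _ (by ring)
  · rw [val_d67 ht, hk, ← EReal.coe_add]
    exact split _ (by ring)
  · rw [val_d8 ht, hk, hk', ← EReal.coe_add, ← add_assoc, ← EReal.coe_add, add_assoc]
    exact split _ (by ring)

end NormalForm

include hq0 hq1 hx hy ht in
/-- There are no polygonal cycles for `δ ≤ -1`. -/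
theorem not_isPolygonalCycle_tropPoly {α : ℝ} {r s : L} (ha : val L q (r + s) = α)
    (hb : ((α + 1 : ℝ) : EReal) ≤ val L q (r - s)) (hne : x * (r - s) + y * (r + s) ≠ 0)
    {n : ℕ} [NeZero n] (p : Fin n → ℝ × ℝ) :
    ¬ IsPolygonalCycle {P | ¬ DifferentiableAt ℝ (tropPoly (val L q (d12 (x + y) (x - y) r s))
      (val L q (d34 (x + y) (x - y) r s)) (val L q (d5 (x + y) (x - y) r s))
      (val L q (d67 (x + y) (x - y) r s)) (val L q (d8 (x + y) (x - y) r s))) P} p := by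
  -- Cancellation in this common factor is possible when δ = -1, but its valuation is finite and
  -- shifts u34 and u5 equally.
  obtain ⟨κ, hκ⟩ : ∃ κ : ℝ, val L q (x * (r - s) + y * (r + s)) = κ := ⟨_, val_eq_coe hne⟩
  have h34 : val L q (x * (r + s) + y * (r - s)) = α := by
    have hxa : val L q (x * (r + s)) = α := by
      rw [val_mul, hx, EReal.coe_zero, zero_add, ha]
    rw [val_add_eq_left hq0 hq1, hxa]
    rw [hxa, val_mul, hy]
    refine lt_of_lt_of_le ?_ (add_le_add_right hb _)
    rw [← EReal.coe_add, EReal.coe_lt_coe_iff]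
    linarith
  have h5 : ((α + 1 : ℝ) : EReal) ≤
      val L q (x * (x ^ 2 + 3 * y ^ 2) * (r - s) - y * (3 * x ^ 2 + y ^ 2) * (r + s)) := by
    rw [sub_eq_add_neg]
    refine le_val_add hq0 hq1 ?_ ?_
    · rwa [val_cubic_left hq0 hq1 hx hy]
    · rw [val_neg]
      refine le_trans (le_of_eq ?_) (le_val_cubic_right hq0 hq1 hx hy ha.ge)
      rw [← EReal.coe_add]; ring_nf
  refine not_isPolygonalCycle (val_ne_bot _) (val_ne_bot _) (val_ne_bot _) (val_ne_bot _)
    (val_ne_bot _) ?_ ?_ ?_ p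
  · rw [val_d12 hq0 hq1 hx hy ht, hκ, ← EReal.coe_add]
    exact EReal.coe_ne_top _
  · rw [val_d34 hq0 hq1 hx hy ht, hκ, h34, ← EReal.coe_add, ← EReal.coe_add]
    exact EReal.coe_ne_top _
  · rw [val_d34 hq0 hq1 hx hy ht, val_d5 hq0 hq1 hx hy ht, hκ, h34]
    refine le_trans (le_of_eq ?_) (add_le_add_right h5 _)
    simp only [← EReal.coe_add]
    ring_nf

end Coefficients

end TropEdwards

namespace TropEdwards

/-! ### The locus -/

theorem toReal_max_top_right (α e o : ℝ) :
    (max (-(⊤ : EReal) + (e : EReal)) (-(α : EReal) + (o : EReal))).toReal = -α + o := by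
  rw [EReal.neg_top, EReal.bot_add, max_eq_right bot_le, ← EReal.coe_neg, ← EReal.coe_add,
    EReal.toReal_coe]

theorem toReal_max_top_left (β e o : ℝ) :
    (max (-(β : EReal) + (e : EReal)) (-(⊤ : EReal) + (o : EReal))).toReal = -β + e := by
  rw [EReal.neg_top, EReal.bot_add, max_eq_left bot_le, ← EReal.coe_neg, ← EReal.coe_add,
    EReal.toReal_coe]

theorem toReal_max_coe (α β e o : ℝ) :
    (max (-(β : EReal) + (e : EReal)) (-(α : EReal) + (o : EReal))).toReal =
      max (-β + e) (-α + o) := by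
  rw [← EReal.coe_neg, ← EReal.coe_neg, ← EReal.coe_add, ← EReal.coe_add, ← EReal.coe_strictMono.monotone.map_max,
    EReal.toReal_coe]

section

variable {K : Type*} [NontriviallyNormedField K] {L : Type*} [Field L] [Algebra K L] {q : K}

/-- The first maximum does not involve r and s, and the second drops by c when both valuations grow
by c; this also holds if one of them is infinite. -/
theorem coordY_add {r s r' s' : L} {c : ℝ} (hne : ¬ (val L q (r + s) = ⊤ ∧ val L q (r - s) = ⊤))
    (hb : val L q (r + s) ≠ ⊥) (hb' : val L q (r - s) ≠ ⊥)
    (h1 : val L q (r' + s') = val L q (r + s) + c) (h2 : val L q (r' - s') = val L q (r - s) + c)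
    (u : ℝ) : coordY q r' s' u = coordY q r s u + c := by
  unfold coordY
  rw [h1, h2]
  generalize val L q (r + s) = A at *
  generalize val L q (r - s) = B at *
  induction A with
  | bot => exact absurd rfl hb
  | top =>
    induction B with
    | bot => exact absurd rfl hb'
    | top => exact absurd ⟨rfl, rfl⟩ hne
    | coe B =>
      rw [EReal.top_add_coe, ← EReal.coe_add, toReal_max_top_left, toReal_max_top_left]
      ring
  | coe A =>
    induction B with
    | bot => exact absurd rfl hb'
    | top =>
      rw [EReal.top_add_coe, ← EReal.coe_add, toReal_max_top_right, toReal_max_top_right]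
      ring
    | coe B =>
      rw [← EReal.coe_add, ← EReal.coe_add, toReal_max_coe, toReal_max_coe,
        show -(B + c) + thetaEven u = -B + thetaEven u + -c by ring,
        show -(A + c) + thetaOdd u = -A + thetaOdd u + -c by ring, max_add_add_right]
      ring

theorem locus_eq_image {r s r' s' : L} {c : ℝ}
    (h : ∀ u, coordY q r' s' u = coordY q r s u + c) :
    locus q r' s' = (fun P => ((-c, -c) : ℝ × ℝ) + P) '' locus q r s := by
  rw [locus, locus, ← Set.range_comp]
  congr 1
  funext u
  simp only [coordX, h, Function.comp, Prod.mk_add_mk]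
  congr 1 <;> ring

end

/-- The periodic trapezoidal function of height `l`. -/
noncomputable def bump (l u : ℝ) : ℝ := min (max 0 (1 - 4 * |u - 2 * (⌊(u + 1) / 2⌋ : ℝ)|)) l

theorem bump_eq {l u : ℝ} (k : ℤ) (h1 : -1 ≤ u - 2 * k) (h2 : u - 2 * k < 1) :
    bump l u = min (max 0 (1 - 4 * |u - 2 * k|)) l := by
  have : ⌊(u + 1) / 2⌋ = k := by
    rw [Int.floor_eq_iff]
    constructor <;> linarith
  rw [bump, this]

theorem bump_nonneg {l : ℝ} (hl : 0 ≤ l) (u : ℝ) : 0 ≤ bump l u := le_min (le_max_left _ _) hl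

theorem bump_le (l u : ℝ) : bump l u ≤ l := min_le_right _ _

/-- A bump is supported within distance 1/4 of the even integers, so it never overlaps with its
shift by 1/2. -/
theorem bump_eq_zero_or {l : ℝ} (hl : 0 ≤ l) (u : ℝ) : bump l u = 0 ∨ bump l (u - 1 / 2) = 0 := by
  set k := ⌊(u + 1) / 2⌋ with hk
  have h1 := Int.floor_le ((u + 1) / 2)
  have h2 := Int.lt_floor_add_one ((u + 1) / 2)
  rw [← hk] at h1 h2
  rcases le_or_gt (1 / 4) |u - 2 * k| with h | h
  · left
    rw [bump, ← hk, max_eq_left (by linarith), min_eq_left hl]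
  · right
    rw [abs_lt] at h
    rw [bump_eq k (by linarith) (by linarith), abs_of_neg (by linarith),
      max_eq_left (by linarith), min_eq_left hl]

/-- Both theta functions depend only on the distance d from u to the nearest even integer. Their
difference 2 - 4d is linear in d. -/
theorem theta_eq (u : ℝ) : thetaEven u = -2 * |u - 2 * (⌊(u + 1) / 2⌋ : ℝ)| ^ 2 ∧
    thetaOdd u = -2 * (1 - |u - 2 * (⌊(u + 1) / 2⌋ : ℝ)|) ^ 2 := by
  set k := ⌊(u + 1) / 2⌋ with hk
  have h1 := Int.floor_le ((u + 1) / 2)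
  have h2 := Int.lt_floor_add_one ((u + 1) / 2)
  rw [← hk] at h1 h2
  constructor
  · rw [thetaEven, ← hk, sq_abs]; ring
  · rcases le_or_gt 0 (u - 2 * k) with h | h
    · have : ⌊u / 2⌋ = k := by
        rw [Int.floor_eq_iff]
        constructor <;> linarith
      rw [thetaOdd, this, abs_of_nonneg h]; ring
    · have : ⌊u / 2⌋ = k - 1 := by
        rw [Int.floor_eq_iff]
        push_cast
        constructor <;> linarith
      rw [thetaOdd, this, abs_of_neg h]
      push_cast
      ring

/-- With d as above, the left side is α + max(0, 1 - 4d) - max(0, 2 - m + α - 4d). The subtracted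
term cuts the tent off at height m - α - 1. -/
theorem max_theta_sub (u α m : ℝ) (h : α + 1 ≤ m) :
    max (thetaOdd u) (-1 + thetaEven u) - max (-m + thetaEven u) (-α + thetaOdd u) =
      α + bump (min 1 (m - α - 1)) u := by
  obtain ⟨h1, h2⟩ := theta_eq u
  rw [bump, h1, h2]
  set d := |u - 2 * (⌊(u + 1) / 2⌋ : ℝ)|
  have hd : 0 ≤ d := abs_nonneg _
  have e : -2 * d ^ 2 = -2 * (1 - d) ^ 2 + (2 - 4 * d) := by ring
  rw [e]
  generalize -2 * (1 - d) ^ 2 = o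
  rcases le_total (2 - m + α - 4 * d) 0 with h3 | h3
  · rw [max_eq_right (a := -m + _) (by linarith)]
    rcases le_total (1 - 4 * d) 0 with h4 | h4
    · rw [max_eq_left (by linarith), max_eq_left h4, min_eq_left (le_min (by norm_num) (by linarith))]
      ring
    · rw [max_eq_right (by linarith), max_eq_right h4,
        min_eq_left (le_min (by linarith) (by linarith))]
      ring
  · rw [max_eq_left (a := -m + _) (by linarith), max_eq_right (by linarith),
      max_eq_right (by linarith : (0 : ℝ) ≤ 1 - 4 * d), min_eq_right (a := 1) (by linarith),
      min_eq_right (by linarith)]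
    ring

/-- For v(r - s) = ∞ the even term is absent. It already never dominates for m = α + 2, so the
finite case applies. -/
theorem max_theta_sub_top (u α : ℝ) :
    max (thetaOdd u) (-1 + thetaEven u) - (-α + thetaOdd u) = α + bump 1 u := by
  have h := max_theta_sub u α (α + 2) (by linarith)
  obtain ⟨h1, h2⟩ := theta_eq u
  rw [max_eq_right (a := -(α + 2) + _), show α + 2 - α - 1 = 1 by ring, min_self] at h
  · exact h
  · rw [h1, h2]
    have hd : 0 ≤ |u - 2 * (⌊(u + 1) / 2⌋ : ℝ)| := abs_nonneg _
    linarith [show -2 * |u - 2 * (⌊(u + 1) / 2⌋ : ℝ)| ^ 2 =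
      -2 * (1 - |u - 2 * (⌊(u + 1) / 2⌋ : ℝ)|) ^ 2 +
        (2 - 4 * |u - 2 * (⌊(u + 1) / 2⌋ : ℝ)|) by ring]

theorem mem_segment_sub_smul_iff {P v : ℝ × ℝ} {l : ℝ} (hl : 0 ≤ l) {z : ℝ × ℝ} :
    z ∈ segment ℝ P (P - l • v) ↔ ∃ τ, 0 ≤ τ ∧ τ ≤ l ∧ z = P - τ • v := by
  rw [segment_eq_image']
  constructor
  · rintro ⟨θ, hθ, rfl⟩
    refine ⟨θ * l, mul_nonneg hθ.1 hl, mul_le_of_le_one_left hl hθ.2, ?_⟩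
    module
  · rintro ⟨τ, h0, h1, rfl⟩
    rcases hl.eq_or_lt with h | h
    · refine ⟨0, Set.mem_Icc.2 ⟨le_rfl, zero_le_one⟩, ?_⟩
      have : τ = 0 := by linarith
      simp [this]
    · refine ⟨τ / l, Set.mem_Icc.2 ⟨div_nonneg h0 hl, div_le_one_of_le₀ h1 hl⟩, ?_⟩
      dsimp only
      rw [sub_sub_cancel_left, smul_neg, smul_smul, div_mul_cancel₀ _ h.ne', sub_eq_add_neg]

theorem isUnionOfTwoSegments_range_bump (α : ℝ) {l : ℝ} (hl : 0 ≤ l) (hl1 : l ≤ 1) :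
    IsUnionOfTwoSegments
      (Set.range fun u : ℝ => (-(α + bump l (u - 1 / 2)), -(α + bump l u))) l := by
  set P : ℝ × ℝ := (-α, -α) with hP
  have hS : (Set.range fun u : ℝ => (-(α + bump l (u - 1 / 2)), -(α + bump l u))) =
      segment ℝ P (P - l • (1, 0)) ∪ segment ℝ P (P - l • (0, 1)) := by
    ext z
    rw [Set.mem_union, mem_segment_sub_smul_iff hl, mem_segment_sub_smul_iff hl]
    constructor
    · rintro ⟨u, rfl⟩
      rcases bump_eq_zero_or hl u with h | h
      · refine Or.inl ⟨bump l (u - 1 / 2), bump_nonneg hl _, bump_le _ _, ?_⟩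
        simp only [h, hP]
        ext <;> simp; ring
      · refine Or.inr ⟨bump l u, bump_nonneg hl _, bump_le _ _, ?_⟩
        simp only [h, hP]
        ext <;> simp; ring
    · rintro (⟨τ, h0, h1, rfl⟩ | ⟨τ, h0, h1, rfl⟩)
      · refine ⟨1 / 2 + (1 - τ) / 4, ?_⟩
        have e1 : bump l (1 / 2 + (1 - τ) / 4) = 0 := by
          rw [bump_eq 0 (by push_cast; linarith) (by push_cast; linarith),
            abs_of_nonneg (by push_cast; linarith), max_eq_left (by push_cast; linarith),
            min_eq_left hl]
        have e2 : bump l (1 / 2 + (1 - τ) / 4 - 1 / 2) = τ := by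
          rw [bump_eq 0 (by push_cast; linarith) (by push_cast; linarith),
            abs_of_nonneg (by push_cast; linarith), max_eq_right (by push_cast; linarith),
            min_eq_left (by push_cast; linarith)]
          push_cast; ring
        simp only [e1, e2, hP]
        ext <;> simp; ring
      · refine ⟨(1 - τ) / 4, ?_⟩
        have e1 : bump l ((1 - τ) / 4) = τ := by
          rw [bump_eq 0 (by push_cast; linarith) (by push_cast; linarith),
            abs_of_nonneg (by push_cast; linarith), max_eq_right (by push_cast; linarith),
            min_eq_left (by push_cast; linarith)]
          push_cast; ring
        have e2 : bump l ((1 - τ) / 4 - 1 / 2) = 0 := by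
          rw [bump_eq 0 (by push_cast; linarith) (by push_cast; linarith),
            abs_of_nonpos (by push_cast; linarith), max_eq_left (by push_cast; linarith),
            min_eq_left hl]
        simp only [e1, e2, hP]
        ext <;> simp; ring
  refine ⟨?_, P, P - l • (1, 0), P - l • (0, 1), hS, ?_, ⟨hl, -1, 0, by norm_num [IsCoprime], ?_⟩,
    ⟨hl, 0, -1, by norm_num [IsCoprime], ?_⟩⟩
  · rw [hS]
    exact IsConnected.union ⟨P, left_mem_segment ℝ _ _, left_mem_segment ℝ _ _⟩
      ⟨⟨P, left_mem_segment ℝ _ _⟩, (convex_segment _ _).isPreconnected⟩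
      ⟨⟨P, left_mem_segment ℝ _ _⟩, (convex_segment _ _).isPreconnected⟩
  · refine Set.Subset.antisymm ?_ ?_
    · rintro z ⟨hz, hz'⟩
      rw [mem_segment_sub_smul_iff hl] at hz hz'
      obtain ⟨τ, -, -, rfl⟩ := hz
      obtain ⟨τ', -, -, h⟩ := hz'
      have := congrArg Prod.fst h
      simp at this
      simp [this]
    · rintro z rfl
      exact ⟨left_mem_segment ℝ _ _, left_mem_segment ℝ _ _⟩
  · ext <;> simp
  · ext <;> simp

theorem exists_isUnionOfTwoSegments {K : Type*} [NontriviallyNormedField K] {L : Type*} [Field L]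
    [Algebra K L] {q : K} {r s : L} {α : ℝ} (ha : val L q (r + s) = α)
    (hb : ((α + 1 : ℝ) : EReal) ≤ val L q (r - s)) :
    ∃ l : ℝ, (l : EReal) = min 1 (-delta q r s - 1) ∧ IsUnionOfTwoSegments (locus q r s) l := by
  unfold locus coordX coordY delta
  rw [ha]
  generalize val L q (r - s) = B at *
  induction B with
  | bot => exact absurd (le_bot_iff.1 hb) (EReal.coe_ne_bot _)
  | top =>
    refine ⟨1, ?_, ?_⟩
    · rw [sub_eq_add_neg (α : EReal), EReal.neg_top, EReal.add_bot, EReal.neg_bot, ← EReal.coe_one, EReal.top_sub_coe,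
        min_eq_left le_top]
    · simp only [toReal_max_top_right, max_theta_sub_top]
      exact isUnionOfTwoSegments_range_bump α zero_le_one le_rfl
  | coe m =>
    rw [EReal.coe_le_coe_iff] at hb
    refine ⟨min 1 (m - α - 1), ?_, ?_⟩
    · rw [EReal.coe_strictMono.monotone.map_min,
        ← EReal.coe_sub, ← EReal.coe_neg, ← EReal.coe_one, ← EReal.coe_sub]
      congr 2
      ring
    · simp only [toReal_max_coe]
      simp only [max_theta_sub _ α m hb]
      exact isUnionOfTwoSegments_range_bump α (le_min zero_le_one (by linarith)) (min_le_left _ _)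

end TropEdwards

namespace TropEdwards

/-! ### The shape of the tropical curve -/

theorem isPolygonalCycle_sub_iff {S : Set (ℝ × ℝ)} (c : ℝ × ℝ) {n : ℕ} [NeZero n]
    {p : Fin n → ℝ × ℝ} :
    IsPolygonalCycle {P | P - c ∈ S} p ↔ IsPolygonalCycle S fun i => -c + p i := by
  rw [isPolygonalCycle_translate_iff]
  simp only [neg_add_eq_sub]

section Transfer

variable {C S : Set (ℝ × ℝ)} {w : ℝ × ℝ}

theorem hasPolygonalCycle_iff_of_translate {n : ℕ} [NeZero n] {l : ℝ}
    (h : ∀ p : Fin n → ℝ × ℝ, IsPolygonalCycle C p ↔ IsPolygonalCycle S fun i => w + p i) :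
    HasPolygonalCycle C n l ↔ HasPolygonalCycle S n l := by
  constructor
  · rintro ⟨p, hp, hl⟩
    exact ⟨_, (h p).1 hp, (hasPerimeter_translate_iff w).2 hl⟩
  · rintro ⟨p, hp, hl⟩
    refine ⟨fun i => -w + p i, (h _).2 ?_, (hasPerimeter_translate_iff _).2 hl⟩
    simpa using hp

theorem hasSquareCycle_iff_of_translate {l : ℝ}
    (h : ∀ p : Fin 4 → ℝ × ℝ, IsPolygonalCycle C p ↔ IsPolygonalCycle S fun i => w + p i) :
    HasSquareCycle C l ↔ HasSquareCycle S l := by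
  constructor
  · rintro ⟨p, hp, hq, hl⟩
    exact ⟨_, (h p).1 hp, (isSquareShape_translate_iff w).2 hq,
      (hasPerimeter_translate_iff w).2 hl⟩
  · rintro ⟨p, hp, hq, hl⟩
    refine ⟨fun i => -w + p i, (h _).2 ?_, (isSquareShape_translate_iff _).2 hq,
      (hasPerimeter_translate_iff _).2 hl⟩
    simpa using hp

end Transfer

section

variable {K : Type*} [NontriviallyNormedField K] [IsUltrametricDist K] [CompleteSpace K]
  [CharZero K] {L : Type*} [Field L] [Algebra K L] [Algebra.IsAlgebraic K L] {q : K}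

theorem exists_real_data (hq0 : q ≠ 0) (hq1 : ‖q‖ < 1) : ∃ (x y : L) (t : ℝ),
    algebraMap K L (eps q) = x + y ∧ algebraMap K L (eps (-q)) = x - y ∧
    val L q x = (0 : ℝ) ∧ val L q y = (1 : ℝ) ∧ val L q (2 : L) = t ∧ 0 ≤ t := by
  obtain ⟨x, y, h1, h2, hx, hy⟩ := exists_eps_eq hq0 hq1
  have h2ne : (2 : L) ≠ 0 := by
    have := (map_ne_zero (algebraMap K L)).2 (two_ne_zero : (2 : K) ≠ 0)
    rwa [map_ofNat] at this
  refine ⟨algebraMap K L x, algebraMap K L y, _, by rw [h1, map_add], by rw [h2, map_sub],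
    val_algebraMap_of_norm_eq_one hx, val_algebraMap_of_norm_eq hq0 hq1 hy, val_eq_coe h2ne, ?_⟩
  have := val_natCast_nonneg (L := L) hq0 hq1 2
  rw [Nat.cast_ofNat, val_eq_coe h2ne] at this
  exact_mod_cast this

/-- For `δ > -1` the polygonal cycles are those of a translate of the boundary polygon. -/
theorem exists_isPolygonalCycle_iff (L : Type*) [Field L] [Algebra K L] [Algebra.IsAlgebraic K L]
    (hq0 : q ≠ 0) (hq1 : ‖q‖ < 1) : ∃ t : ℝ, ∀ r s : L, -1 < delta q r s →
    ∃ D β : ℝ, val L q (r - s) = β ∧ -1 < D ∧ D ≤ 2 ∧ (D : EReal) = min (delta q r s) 2 ∧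
      ∀ (n : ℕ) [NeZero n] (p : Fin n → ℝ × ℝ), IsPolygonalCycle (tropCurve q r s) p ↔
        IsPolygonalCycle (boundaryPolygon D) fun i => -(t - β, t - β) + p i := by
  obtain ⟨x, y, t, he, hf, hx, hy, ht, ht0⟩ := exists_real_data (L := L) hq0 hq1
  -- The constant t = v(2) is fixed before r and s, so translations for different pairs can be
  -- compared.
  refine ⟨t, fun r s hδ => ?_⟩
  have key : ∀ {D β : ℝ} {A : EReal}, -1 < D → D ≤ 2 → ((D + β : ℝ) : EReal) ≤ A →
      (D < 2 → A = ((D + β : ℝ) : EReal)) → val L q (r + s) = A → val L q (r - s) = β →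
      ∀ (n : ℕ) [NeZero n] (p : Fin n → ℝ × ℝ), IsPolygonalCycle (tropCurve q r s) p ↔
        IsPolygonalCycle (boundaryPolygon D) fun i => -(t - β, t - β) + p i := by
    intro D β A hD hD2 hA hA' ha hb n _ p
    rw [← isPolygonalCycle_sub_iff,
      ← isPolygonalCycle_tropPoly_iff hq0 hq1 hx hy ht hD hD2 hA hA' ht0 ha hb]
    unfold tropCurve trop
    rw [he, hf]
  unfold delta at hδ ⊢
  generalize hA : val L q (r + s) = A at *
  generalize hB : val L q (r - s) = B at *
  have hAb : A ≠ ⊥ := hA ▸ val_ne_bot _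
  have hBb : B ≠ ⊥ := hB ▸ val_ne_bot _
  have hBt : B ≠ ⊤ := by
    rintro rfl
    rw [sub_eq_add_neg, EReal.neg_top, EReal.add_bot] at hδ
    exact not_lt_bot hδ
  lift B to ℝ using ⟨hBt, hBb⟩
  induction A with
  | bot => exact absurd rfl hAb
  | top =>
    refine ⟨2, B, rfl, by norm_num, le_rfl, ?_, key (by norm_num) le_rfl le_top
      (fun h => absurd h (lt_irrefl _)) rfl rfl⟩
    rw [EReal.top_sub_coe, min_eq_right le_top]
    rfl
  | coe a =>
    have h1 : -1 < a - B := by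
      rw [← EReal.coe_sub] at hδ
      exact EReal.coe_lt_coe_iff.1 (show ((-1 : ℝ) : EReal) < _ from hδ)
    refine ⟨min (a - B) 2, B, rfl, lt_min h1 (by norm_num), min_le_right _ _, ?_,
      key (lt_min h1 (by norm_num)) (min_le_right _ _) ?_ (fun h => ?_) rfl rfl⟩
    · rw [EReal.coe_strictMono.monotone.map_min, EReal.coe_sub]
      rfl
    · rw [EReal.coe_le_coe_iff]
      linarith [min_le_left (a - B) 2]
    · have h2 : a - B < 2 := by
        by_contra h'
        rw [min_eq_right (not_lt.1 h')] at h
        exact lt_irrefl _ h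
      rw [min_eq_left h2.le, sub_add_cancel]

theorem not_both_top {r s : L} {e f : L} (hne : e * r ≠ f * s) (h2 : (2 : L) ≠ 0) :
    ¬ (val L q (r + s) = ⊤ ∧ val L q (r - s) = ⊤) := by
  rintro ⟨h, h'⟩
  rw [val_eq_top_iff] at h h'
  have hr : r = 0 := by
    have : 2 * r = 0 := by linear_combination h + h'
    exact (mul_eq_zero.1 this).resolve_left h2
  have hs : s = 0 := by rw [hr, zero_add] at h; exact h
  exact hne (by rw [hr, hs, mul_zero, mul_zero])

/-- For `δ ≤ -1` there are no polygonal cycles. -/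
theorem not_isPolygonalCycle_tropCurve (hq0 : q ≠ 0) (hq1 : ‖q‖ < 1) {r s : L}
    (hne : algebraMap K L (eps q) * r ≠ algebraMap K L (eps (-q)) * s)
    (hδ : delta q r s ≤ -1) :
    (∃ α : ℝ, val L q (r + s) = α ∧ ((α + 1 : ℝ) : EReal) ≤ val L q (r - s)) ∧
      ∀ (n : ℕ) [NeZero n] (p : Fin n → ℝ × ℝ), ¬ IsPolygonalCycle (tropCurve q r s) p := by
  obtain ⟨x, y, t, he, hf, hx, hy, ht, ht0⟩ := exists_real_data (L := L) hq0 hq1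
  have h2 : (2 : L) ≠ 0 := fun h => by
    rw [h, val_zero] at ht
    exact EReal.coe_ne_top _ ht.symm
  have hnt := not_both_top (q := q) hne h2
  have h1 : ∃ α : ℝ, val L q (r + s) = α ∧ ((α + 1 : ℝ) : EReal) ≤ val L q (r - s) := by
    unfold delta at hδ
    have hAb := val_ne_bot (q := q) (r + s)
    have hBb := val_ne_bot (q := q) (r - s)
    generalize val L q (r + s) = A at *
    generalize val L q (r - s) = B at *
    induction B with
    | bot => exact absurd rfl hBb
    | top =>
      induction A with
      | bot => exact absurd rfl hAb
      | top => exact absurd ⟨rfl, rfl⟩ hnt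
      | coe a => exact ⟨a, rfl, le_top⟩
    | coe b =>
      induction A with
      | bot => exact absurd rfl hAb
      | top =>
        rw [EReal.top_sub_coe, top_le_iff] at hδ
        exact absurd hδ (EReal.coe_ne_top (-1))
      | coe a =>
        refine ⟨a, rfl, ?_⟩
        rw [← EReal.coe_sub] at hδ
        have : a - b ≤ -1 := EReal.coe_le_coe_iff.1 (show _ ≤ ((-1 : ℝ) : EReal) from hδ)
        rw [EReal.coe_le_coe_iff]
        linarith
  refine ⟨h1, fun n _ p => ?_⟩
  obtain ⟨α, ha, hb⟩ := h1
  have := not_isPolygonalCycle_tropPoly hq0 hq1 hx hy ht ha hb (fun h => hne ?_) p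
  · unfold tropCurve trop
    rw [he, hf]
    exact this
  · rw [he, hf]
    linear_combination h

/-- If δ is infinite, the same one of the two valuations is infinite for both pairs, and the finite
one determines c. -/
theorem exists_val_shift {r s r' s' : L} (hne : ¬ (val L q (r + s) = ⊤ ∧ val L q (r - s) = ⊤))
    (hne' : ¬ (val L q (r' + s') = ⊤ ∧ val L q (r' - s') = ⊤))
    (h : delta q r s = delta q r' s') : ∃ c : ℝ,
      val L q (r' + s') = val L q (r + s) + c ∧ val L q (r' - s') = val L q (r - s) + c := by
  unfold delta at h
  have hA := val_ne_bot (q := q) (r + s)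
  have hB := val_ne_bot (q := q) (r - s)
  have hA' := val_ne_bot (q := q) (r' + s')
  have hB' := val_ne_bot (q := q) (r' - s')
  generalize val L q (r + s) = A at *
  generalize val L q (r - s) = B at *
  generalize val L q (r' + s') = A' at *
  generalize val L q (r' - s') = B' at *
  induction B with
  | bot => exact absurd rfl hB
  | top =>
    rw [sub_eq_add_neg, EReal.neg_top, EReal.add_bot] at h
    have e : B' = ⊤ := by
      by_contra hcon
      lift B' to ℝ using ⟨hcon, hB'⟩
      induction A' with
      | bot => exact hA' rfl
      | top => rw [EReal.top_sub_coe] at h; exact bot_ne_top h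
      | coe a => rw [← EReal.coe_sub] at h; exact EReal.coe_ne_bot _ h.symm
    subst e
    lift A to ℝ using ⟨fun h => hne ⟨h, rfl⟩, hA⟩
    lift A' to ℝ using ⟨fun h => hne' ⟨h, rfl⟩, hA'⟩
    refine ⟨A' - A, ?_, by rw [EReal.top_add_coe]⟩
    rw [← EReal.coe_add, add_sub_cancel]
  | coe b =>
    have e : B' ≠ ⊤ := by
      rintro rfl
      rw [sub_eq_add_neg A', EReal.neg_top, EReal.add_bot] at h
      induction A with
      | bot => exact hA rfl
      | top => rw [EReal.top_sub_coe] at h; exact bot_ne_top h.symm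
      | coe a => rw [← EReal.coe_sub] at h; exact EReal.coe_ne_bot _ h
    lift B' to ℝ using ⟨e, hB'⟩
    refine ⟨B' - b, ?_, by rw [← EReal.coe_add, add_sub_cancel]⟩
    induction A with
    | bot => exact absurd rfl hA
    | top =>
      rw [EReal.top_sub_coe] at h
      rw [EReal.top_add_coe]
      by_contra hcon
      lift A' to ℝ using ⟨hcon, hA'⟩
      rw [← EReal.coe_sub] at h
      exact EReal.coe_ne_top _ h.symm
    | coe a =>
      induction A' with
      | bot => exact absurd rfl hA'
      | top =>
        rw [EReal.top_sub_coe, ← EReal.coe_sub] at h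
        exact absurd h (EReal.coe_ne_top _)
      | coe a' =>
        rw [← EReal.coe_sub, ← EReal.coe_sub, EReal.coe_eq_coe_iff] at h
        rw [← EReal.coe_add, EReal.coe_eq_coe_iff]
        linarith

end

end TropEdwards

/-! ### Assembly of the classification -/

theorem corollary1p3
    {K : Type*} [NontriviallyNormedField K] [IsUltrametricDist K] [CompleteSpace K] [CharZero K]
    (hK : TropEdwards.IsDiscretelyValued K)
    {L : Type*} [Field L] [Algebra K L] [IsAlgClosure K L]
    (q : K) (hq0 : q ≠ 0) (hq1 : ‖q‖ < 1) :
    (∀ r s : L,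
      algebraMap K L (TropEdwards.eps q) * r ≠ algebraMap K L (TropEdwards.eps (-q)) * s →
      -- pentagons
      (TropEdwards.HasPolygonalCycle (TropEdwards.tropCurve q r s) 5 8 ↔
        2 ≤ TropEdwards.delta q r s) ∧
      -- heptagons
      (TropEdwards.HasPolygonalCycle (TropEdwards.tropCurve q r s) 7 8 ↔
        1 < TropEdwards.delta q r s ∧ TropEdwards.delta q r s < 2) ∧
      -- squares
      ((∃ l : ℝ, (l : EReal) = 4 * (TropEdwards.delta q r s + 1) ∧
          TropEdwards.HasSquareCycle (TropEdwards.tropCurve q r s) l) ↔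
        -1 < TropEdwards.delta q r s ∧ TropEdwards.delta q r s ≤ 1) ∧
      (TropEdwards.HasSquareCycle (TropEdwards.tropCurve q r s) 8 ↔
        TropEdwards.delta q r s = 1) ∧
      -- the degenerate case
      (TropEdwards.delta q r s ≤ -1 →
        ∃ l : ℝ, (l : EReal) = min 1 (-TropEdwards.delta q r s - 1) ∧
          TropEdwards.IsUnionOfTwoSegments (TropEdwards.locus q r s) l)) ∧
    -- up to a translation, the cycle and the locus depend only on the parameter `delta`
    (∀ r s r' s' : L,
      algebraMap K L (TropEdwards.eps q) * r ≠ algebraMap K L (TropEdwards.eps (-q)) * s →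
      algebraMap K L (TropEdwards.eps q) * r' ≠ algebraMap K L (TropEdwards.eps (-q)) * s' →
      TropEdwards.delta q r s = TropEdwards.delta q r' s' →
      ∃ w : ℝ × ℝ,
        TropEdwards.locus q r' s' = (fun P => w + P) '' TropEdwards.locus q r s ∧
        ∀ (n : ℕ) [NeZero n] (p : Fin n → ℝ × ℝ),
          TropEdwards.IsPolygonalCycle (TropEdwards.tropCurve q r s) p ↔
            TropEdwards.IsPolygonalCycle (TropEdwards.tropCurve q r' s') (fun i => w + p i)) := by
  have : Algebra.IsAlgebraic K L := IsAlgClosure.isAlgebraic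
  obtain ⟨t, hcyc⟩ := TropEdwards.exists_isPolygonalCycle_iff (q := q) L hq0 hq1
  have h2L : (2 : L) ≠ 0 := by
    have := (map_ne_zero (algebraMap K L)).2 (two_ne_zero : (2 : K) ≠ 0)
    rwa [map_ofNat] at this
  constructor
  · intro r s hne
    by_cases hδ : -1 < TropEdwards.delta q r s
    · obtain ⟨D, β, hb, hD, hD2, hDδ, hC⟩ := hcyc r s hδ
      have hpoly : ∀ (n : ℕ) [NeZero n] (l : ℝ),
          TropEdwards.HasPolygonalCycle (TropEdwards.tropCurve q r s) n l ↔
          TropEdwards.HasPolygonalCycle (TropEdwards.boundaryPolygon D) n l := fun n _ l =>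
        TropEdwards.hasPolygonalCycle_iff_of_translate (hC n)
      have hsq : ∀ l : ℝ, TropEdwards.HasSquareCycle (TropEdwards.tropCurve q r s) l ↔
          TropEdwards.HasSquareCycle (TropEdwards.boundaryPolygon D) l := fun l =>
        TropEdwards.hasSquareCycle_iff_of_translate (hC 4)
      have hcard : ∀ {n : ℕ} [NeZero n] {p : Fin n → ℝ × ℝ}, _ → n = _ := fun {n} _ {p} h =>
        TropEdwards.card_eq_of_isPolygonalCycle_boundaryPolygon (n := n) (p := p) hD hD2 h
      rw [hpoly, hpoly]
      simp only [hsq]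
      generalize TropEdwards.delta q r s = δ at *
      have hlt : ∀ z : ℝ, z ≤ 2 → (δ < z ↔ D < z) := by
        intro z hz
        have h2 : ¬ (2 : EReal) < z := not_lt.2 (EReal.coe_le_coe_iff.2 hz)
        rw [← EReal.coe_lt_coe_iff, hDδ, min_lt_iff, or_iff_left h2]
      have hgt : ∀ z : ℝ, z < 2 → ((z : EReal) < δ ↔ z < D) := by
        intro z hz
        have h2 : (z : EReal) < 2 := EReal.coe_lt_coe_iff.2 hz
        rw [← EReal.coe_lt_coe_iff, hDδ, lt_min_iff, and_iff_left h2]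
      have g2 : δ < 2 ↔ D < 2 := hlt 2 le_rfl
      have g1 : δ < 1 ↔ D < 1 := hlt 1 (by norm_num)
      have g1' : 1 < δ ↔ 1 < D := hgt 1 (by norm_num)
      have hDeq : D < 2 → δ = D := fun h => by
        rw [hDδ, min_eq_left (g2.2 h).le]
      -- Four corners force D ≤ 1, and then the perimeter is determined; in particular length 8
      -- gives D = 1.
      have hsquare : ∀ l, TropEdwards.HasSquareCycle (TropEdwards.boundaryPolygon D) l →
          D ≤ 1 ∧ l = 4 * (D + 1) := by
        rintro l ⟨p, hp, -, hl⟩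
        have hD1 : D ≤ 1 := by
          by_contra hcon
          have := hcard hp
          rw [if_neg hcon] at this
          split_ifs at this <;> omega
        exact ⟨hD1, TropEdwards.perimeter_eq_of_square hD hD1 hp hl⟩
      refine ⟨⟨?_, ?_⟩, ⟨?_, ?_⟩, ⟨?_, ?_⟩, ⟨?_, ?_⟩, ?_⟩
      · rintro ⟨p, hp, -⟩
        rw [← not_lt, g2]
        intro h
        have := hcard hp
        split_ifs at this <;> omega
      · intro h
        rw [← not_lt, g2, not_lt] at h
        rw [le_antisymm hD2 h]
        exact TropEdwards.hasPolygonalCycle_pentagon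
      · rintro ⟨p, hp, -⟩
        rw [g1', g2]
        have := hcard hp
        by_cases h1 : D ≤ 1
        · rw [if_pos h1] at this; omega
        · rw [if_neg h1] at this
          refine ⟨not_le.1 h1, ?_⟩
          by_contra h
          rw [if_neg h] at this; omega
      · rintro ⟨h1, h2⟩
        exact TropEdwards.hasPolygonalCycle_heptagon (g1'.1 h1) (g2.1 h2)
      · rintro ⟨l, -, hl⟩
        refine ⟨hδ, ?_⟩
        rw [← not_lt, g1', not_lt]
        exact (hsquare l hl).1
      · rintro ⟨-, h⟩
        rw [← not_lt, g1', not_lt] at h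
        refine ⟨4 * (D + 1), ?_, TropEdwards.hasSquareCycle_square hD h⟩
        rw [hDeq (by linarith), EReal.coe_mul, EReal.coe_add]
        rfl
      · intro h
        obtain ⟨h1, h2⟩ := hsquare 8 h
        have : D = 1 := by linarith
        rw [hDeq (by linarith), this]
        rfl
      · intro h
        have hD1 : D = 1 := by
          refine le_antisymm (not_lt.1 fun h' => ?_) (not_lt.1 fun h' => ?_)
          · exact absurd h (g1'.2 h').ne'
          · exact absurd h (g1.2 h').ne
        have := TropEdwards.hasSquareCycle_square hD hD1.le
        rw [hD1] at this ⊢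
        norm_num at this
        exact this
      · intro h
        exact absurd hδ h.not_gt
    · obtain ⟨⟨α, ha, hb⟩, hno⟩ :=
        TropEdwards.not_isPolygonalCycle_tropCurve hq0 hq1 hne (not_lt.1 hδ)
      have hδ' := not_lt.1 hδ
      have c1 : (-1 : EReal) < 1 := by
        rw [show (-1 : EReal) = ((-1 : ℝ) : EReal) from rfl, ← EReal.coe_one,
          EReal.coe_lt_coe_iff]
        norm_num
      have c2 : (1 : EReal) < 2 := by
        rw [show (2 : EReal) = ((2 : ℝ) : EReal) from rfl, ← EReal.coe_one,
          EReal.coe_lt_coe_iff]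
        norm_num
      refine ⟨iff_of_false ?_ ?_, iff_of_false ?_ ?_, iff_of_false ?_ ?_, iff_of_false ?_ ?_,
        fun _ => TropEdwards.exists_isUnionOfTwoSegments ha hb⟩
      · rintro ⟨p, hp, -⟩
        exact hno 5 p hp
      · exact (hδ'.trans_lt (c1.trans c2)).not_ge
      · rintro ⟨p, hp, -⟩
        exact hno 7 p hp
      · exact fun h => (hδ'.trans_lt c1).not_gt h.1
      · rintro ⟨l, -, p, hp, -⟩
        exact hno 4 p hp
      · exact fun h => hδ h.1
      · rintro ⟨p, hp, -⟩
        exact hno 4 p hp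
      · exact (hδ'.trans_lt c1).ne
  · intro r s r' s' hne hne' hδδ
    have hnt := TropEdwards.not_both_top (q := q) hne h2L
    obtain ⟨c, h1, h2⟩ := TropEdwards.exists_val_shift hnt
      (TropEdwards.not_both_top (q := q) hne' h2L) hδδ
    -- The locus consists of negated coordinates, and the centre t - v(r - s) of the polygon also
    -- drops by c, so the same vector serves for both.
    refine ⟨(-c, -c), TropEdwards.locus_eq_image (TropEdwards.coordY_add hnt
      (TropEdwards.val_ne_bot _) (TropEdwards.val_ne_bot _) h1 h2), fun n _ p => ?_⟩
    by_cases hδ : -1 < TropEdwards.delta q r s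
    · obtain ⟨D, β, hb, hD, hD2, hDδ, hC⟩ := hcyc r s hδ
      obtain ⟨D', β', hb', hD', hD2', hDδ', hC'⟩ := hcyc r' s' (hδδ ▸ hδ)
      have eD : D = D' := by
        rw [← EReal.coe_eq_coe_iff, hDδ, hDδ', hδδ]
      have eβ : β' = β + c := by
        rw [hb, hb', ← EReal.coe_add, EReal.coe_eq_coe_iff] at h2
        exact h2
      rw [hC, hC', eD, eβ]
      refine iff_of_eq (congrArg _ (funext fun i => ?_))
      rw [← add_assoc]
      congr 1
      ext <;> simp <;> ring
    · have hδ' := not_lt.1 hδ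
      exact iff_of_false ((TropEdwards.not_isPolygonalCycle_tropCurve hq0 hq1 hne hδ').2 n p)
        ((TropEdwards.not_isPolygonalCycle_tropCurve hq0 hq1 hne' (hδδ ▸ hδ')).2 n _)
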